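/- Consider the focusing coupled nonlinear Schrödinger equations $$i q_{j,t}+\tfrac12 q_{j,xx}+(|q_1|^2+|q_2|^2)q_j=0,\qquad j=1,2,\quad (x,t)\in\mathbb R^2 .$$ Let $a_1,a_2,b_1\in\mathbb R$, let $\theta_1=i[b_1x+(a_1^2+a_2^2-\tfrac12b_1^2)t]$, $\theta_2=i[-b_1x+(a_1^2+a_2^2-\tfrac12b_1^2)t]$, and assume only that $$\Delta=\frac{a_1^2a_2^2b_1^2}{16384}\left[(a_1^2+a_2^2+4b_1^2)^3-27a_1^2a_2^2(4b_1^2)\right]^3>0 .$$ This is the discriminant of the quartic below; no further relation between $b_1$ and $a_1,a_2$ is required. **Spectral data.** For $i=1,2$ let $\lambda_i\in\mathbb C$ be a root of the quartic $$\begin{aligned}&b_1^2\lambda^4+\tfrac12(a_1^2-a_2^2)b_1\lambda^3-\left[\tfrac12b_1^4-\tfrac54(a_1^2+a_2^2)b_1^2-\tfrac1{16}(a_1^2+a_2^2)^2\right]\lambda^2+\tfrac{9}{16}b_1(a_1^2+a_2^2-2b_1^2)(a_1^2-a_2^2)\lambda\\&\quad+\tfrac1{16}b_1^6+\tfrac3{16}(a_1^2+a_2^2)b_1^4+\tfrac1{16}(a_1^2+a_2^2)^3-\tfrac3{64}(5a_1^2-a_2^2)(a_1^2-5a_2^2)b_1^2=0,\end{aligned}$$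 with $\lambda_1\ne\lambda_2$ and $\lambda_1\neq\overline{\lambda_2}$, and let $\chi_i\in\mathbb C$ be a multiple (double) root of $$\xi^3-2\lambda_i\xi^2-(a_1^2+a_2^2+b_1^2)\xi+(a_1^2-a_2^2)b_1+2b_1^2\lambda_i=0 .$$ Let $(\alpha_i^{[k]})_{k\ge0}$ be arbitrary complex parameters and $N_1,N_2\ge0$ arbitrary integers. **Formal series.** Put $d_i=\dfrac{2\lambda_i-3\chi_i}{2b_1^2-2\chi_i^2}$, $\lambda_i(\epsilon)=\lambda_i+d_i\epsilon^2$ and $\chi_i(\epsilon)=\sum_{j\ge0}\chi_i^{[j]}\epsilon^j$, where $\chi_i^{[0]}=\chi_i$, $\chi_i^{[1]}=1$ and, for $j\ge3$, $$\chi_i^{[j-1]}=\frac1{3\chi_i-2\lambda_i}\Big[-\tfrac12\!\!\sum_{\substack{m+n+k=j\\0\le m,n,k\le j-2}}\!\!\chi_i^{[m]}\chi_i^{[n]}\chi_i^{[k]}+\lambda_i\!\!\sum_{\substack{m+n=j\\0\le m,n\le j-2}}\!\!\chi_i^{[m]}\chi_i^{[n]}+d_i\!\!\sum_{m+n=j-2}\!\!\chi_i^{[m]}\chi_i^{[n]}\Big].$$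 Let $X_i^{[k]}=i\big(\chi_i^{[k]}x+\tfrac12\sum_{j=0}^k\chi_i^{[j]}\chi_i^{[k-j]}t\big)$ and, as formal power series in $\epsilon$, $$\Phi_i(\epsilon)=D\,\exp\Big(\sum_{k\ge1}X_i^{[k]}\epsilon^k\Big)\Big(1,\ \frac{a_1}{\chi_i(\epsilon)+b_1},\ \frac{a_2}{\chi_i(\epsilon)-b_1}\Big)^{T},\qquad D=\mathrm{diag}(1,e^{\theta_1},e^{\theta_2}).$$ With $\alpha_i(\epsilon)=\sum_{k\ge0}\alpha_i^{[k]}\epsilon^{2k}$ define the vectors $\Psi_i^{[k]}=\Psi_i^{[k]}(x,t)\in\mathbb C^3$ by $$\frac{e^{\epsilon\alpha_i(\epsilon)}\Phi_i(\epsilon)-e^{-\epsilon\alpha_i(\epsilon)}\Phi_i(-\epsilon)}{2\epsilon}=\sum_{k\ge0}\Psi_i^{[k]}\epsilon^{2k}.$$ **Matrices.** With $\langle u,v\rangle=u^\dagger v$ let, for $r,t\ge1$, $$M_{i,j}^{[r,t]}=\sum_{l=0}^{r+t-2}\ \sum_{\substack{m+n=t-1\\0\le m\le l,\ 0\le n\le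 r+t-l-2}}\binom lm\frac{\overline{d_i}^{\,l-m}(-d_j)^m}{(\lambda_j-\overline{\lambda_i})^{l+1}}\big\langle\Psi_i^{[r+t-l-n-2]},\Psi_j^{[n]}\big\rangle$$ (here $t$ is an index), let $M=(M_{i,j})_{i,j=1,2}$ be the square block matrix of size $N_1+N_2$ with blocks $M_{i,j}=(M_{i,j}^{[r,t]})_{1\le r\le N_i,\,1\le t\le N_j}$, let $X$ be the $3\times(N_1+N_2)$ matrix $[\Psi_1^{[0]},\dots,\Psi_1^{[N_1-1]},\Psi_2^{[0]},\dots,\Psi_2^{[N_2-1]}]$ with rows $X_1,X_2,X_3$, and let $$Y_2=\frac{X_2e^{-\theta_1}}{a_1},\quad Y_3=\frac{X_3e^{-\theta_2}}{a_2},\quad M_1=M-2X_1^\dagger Y_2,\quad M_2=M-2X_1^\dagger Y_3 .$$ **Theorem.** For all $(x,t)\in\mathbb R^2$ one has $\det M\ne0$. The functions $$q_1[N]=a_1\frac{\det M_1}{\det M}e^{\theta_1},\qquad q_2[N]=a_2\frac{\det M_2}{\det M}e^{\theta_2}$$ satisfy $Q[N]=Q[0]+i[P,\sigma_3]$ with $P=-XM^{-1}X^\dagger$,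 $\sigma_3=\mathrm{diag}(1,-1,-1)$, where $$Q=\begin{pmatrix}0&i\bar q_1&i\bar q_2\\ iq_1&0&0\\ iq_2&0&0\end{pmatrix}$$ and $Q[0]$ is this matrix for the seed $q_j=a_je^{\theta_j}$. They form a rational rogue-wave solution of the coupled equations: $(q_1[N],q_2[N])$ is a $C^\infty$ solution on $\mathbb R^2$; $q_j[N]e^{-\theta_j}$ is a rational function of $(x,t)$ with complex coefficients and without poles on $\mathbb R^2$; and $|q_j[N](x,t)|\to|a_j|$ as $|x|+|t|\to\infty$, for $j=1,2$. -/

import Mathlib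

open scoped ContDiff ComplexConjugate Matrix

noncomputable section

namespace CNLS

/-! ## The coupled nonlinear Schroedinger equations -/

/-- `(q₁, q₂)` is a smooth global solution, on the whole `(x, t)`-plane, of
`i q_{j,t} + (1/2) q_{j,xx} + (|q₁|² + |q₂|²) q_j = 0`, `j = 1, 2`. The first argument is `x`,
the second one is `t`. -/
structure IsSolution (q₁ q₂ : ℝ → ℝ → ℂ) : Prop where
  smooth₁ : ContDiff ℝ ∞ (fun p : ℝ × ℝ => q₁ p.1 p.2)
  smooth₂ : ContDiff ℝ ∞ (fun p : ℝ × ℝ => q₂ p.1 p.2)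
  eq₁ : ∀ x t : ℝ,
    Complex.I * deriv (fun s => q₁ x s) t
      + (1 / 2 : ℂ) * iteratedDeriv 2 (fun y => q₁ y t) x
      + ((‖q₁ x t‖ ^ 2 + ‖q₂ x t‖ ^ 2 : ℝ) : ℂ) * q₁ x t = 0
  eq₂ : ∀ x t : ℝ,
    Complex.I * deriv (fun s => q₂ x s) t
      + (1 / 2 : ℂ) * iteratedDeriv 2 (fun y => q₂ y t) x
      + ((‖q₁ x t‖ ^ 2 + ‖q₂ x t‖ ^ 2 : ℝ) : ℂ) * q₂ x t = 0

/-- The phase `i [b x + (a₁² + a₂² - b²/2) t]` of a plane wave with wave number `b`. -/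
def theta (a₁ a₂ b x t : ℝ) : ℂ :=
  Complex.I * ((b * x + (a₁ ^ 2 + a₂ ^ 2 - b ^ 2 / 2) * t : ℝ) : ℂ)

/-- A rational rogue wave on the plane-wave background `a_j exp θ_j` with wave numbers
`b₁`, `-b₁`: a smooth solution of the coupled NLS equations, each component of which is
`a_j exp θ_j` times a rational function of `(x, t)` without real poles, and whose moduli return
to the background amplitudes at space-time infinity (in every direction). -/
structure IsRationalRogueWave (a₁ a₂ b₁ : ℝ) (q₁ q₂ : ℝ → ℝ → ℂ) : Prop where
  solution : IsSolution q₁ q₂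
  rational : ∃ p₁ p₂ r : MvPolynomial (Fin 2) ℂ, ∀ x t : ℝ,
    MvPolynomial.eval ![(x : ℂ), (t : ℂ)] r ≠ 0 ∧
    q₁ x t = a₁ * (MvPolynomial.eval ![(x : ℂ), (t : ℂ)] p₁ /
      MvPolynomial.eval ![(x : ℂ), (t : ℂ)] r) * Complex.exp (theta a₁ a₂ b₁ x t) ∧
    q₂ x t = a₂ * (MvPolynomial.eval ![(x : ℂ), (t : ℂ)] p₂ /
      MvPolynomial.eval ![(x : ℂ), (t : ℂ)] r) * Complex.exp (theta a₁ a₂ (-b₁) x t)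
  background₁ : Filter.Tendsto (fun p : ℝ × ℝ => ‖q₁ p.1 p.2‖)
    (Filter.cocompact (ℝ × ℝ)) (nhds |a₁|)
  background₂ : Filter.Tendsto (fun p : ℝ × ℝ => ‖q₂ p.1 p.2‖)
    (Filter.cocompact (ℝ × ℝ)) (nhds |a₂|)

/-- The potential matrix `Q` of the Lax pair. -/
def potential (u v : ℂ) : Matrix (Fin 3) (Fin 3) ℂ :=
  !![0, Complex.I * conj u, Complex.I * conj v;
     Complex.I * u, 0, 0;
     Complex.I * v, 0, 0]

/-- `σ₃ = diag(1, -1, -1)`. -/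
def sigma3 : Matrix (Fin 3) (Fin 3) ℂ := Matrix.diagonal ![1, -1, -1]

/-! ## The spectral curve -/

/-- The cubic `ξ³ - 2λξ² - (a₁² + a₂² + b₁²)ξ + (a₁² - a₂²)b₁ + 2b₁²λ` in `ξ`. -/
def cubic (a₁ a₂ b₁ : ℝ) (lam : ℂ) : Polynomial ℂ :=
  Polynomial.X ^ 3 - Polynomial.C (2 * lam) * Polynomial.X ^ 2
    - Polynomial.C ((a₁ : ℂ) ^ 2 + (a₂ : ℂ) ^ 2 + (b₁ : ℂ) ^ 2) * Polynomial.X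
    + Polynomial.C (((a₁ : ℂ) ^ 2 - (a₂ : ℂ) ^ 2) * b₁ + 2 * (b₁ : ℂ) ^ 2 * lam)

/-- The quartic in `λ` whose vanishing is the discriminant equation of the cubic. -/
def discrQuartic (a₁ a₂ b₁ : ℝ) (lam : ℂ) : ℂ :=
  (b₁ : ℂ) ^ 2 * lam ^ 4
    + 1 / 2 * ((a₁ : ℂ) ^ 2 - (a₂ : ℂ) ^ 2) * b₁ * lam ^ 3
    - (1 / 2 * (b₁ : ℂ) ^ 4 - 5 / 4 * ((a₁ : ℂ) ^ 2 + (a₂ : ℂ) ^ 2) * (b₁ : ℂ) ^ 2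
        - 1 / 16 * ((a₁ : ℂ) ^ 2 + (a₂ : ℂ) ^ 2) ^ 2) * lam ^ 2
    + 9 * (b₁ : ℂ) * ((a₁ : ℂ) ^ 2 + (a₂ : ℂ) ^ 2 - 2 * (b₁ : ℂ) ^ 2)
        * ((a₁ : ℂ) ^ 2 - (a₂ : ℂ) ^ 2) / 16 * lam
    + 1 / 16 * (b₁ : ℂ) ^ 6 + 3 / 16 * ((a₁ : ℂ) ^ 2 + (a₂ : ℂ) ^ 2) * (b₁ : ℂ) ^ 4
    + 1 / 16 * ((a₁ : ℂ) ^ 2 + (a₂ : ℂ) ^ 2) ^ 3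
    - 3 * (5 * (a₁ : ℂ) ^ 2 - (a₂ : ℂ) ^ 2) * ((a₁ : ℂ) ^ 2 - 5 * (a₂ : ℂ) ^ 2)
        * (b₁ : ℂ) ^ 2 / 64

/-- The discriminant `Δ` of the quartic `discrQuartic`. -/
def Delta (a₁ a₂ b₁ : ℝ) : ℝ :=
  a₁ ^ 2 * a₂ ^ 2 * b₁ ^ 2 / 16384 *
    ((a₁ ^ 2 + a₂ ^ 2 + 4 * b₁ ^ 2) ^ 3 - 27 * a₁ ^ 2 * a₂ ^ 2 * (4 * b₁ ^ 2)) ^ 3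

/-! ## The formal series

Throughout, `lam` is a spectral parameter, `chi` a double root of the cubic at `lam`, and `alpha`
the sequence of free complex parameters `α^{[k]}`. -/

/-- `d = (2λ - 3χ) / (2b₁² - 2χ²)`, so that the spectral parameter is expanded as `λ + d ε²`. -/
def dCoeff (b₁ : ℝ) (lam chi : ℂ) : ℂ :=
  (2 * lam - 3 * chi) / (2 * (b₁ : ℂ) ^ 2 - 2 * chi ^ 2)

/-- The coefficients `χ^{[j]}`: `χ^{[0]} = χ`, `χ^{[1]} = 1`, and, for `j ≥ 3`,
`χ^{[j-1]} = (3χ - 2λ)⁻¹ [ -1/2 ∑_{m+p+k=j, m,p,k ≤ j-2} χ^{[m]} χ^{[p]} χ^{[k]}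
  + λ ∑_{m+p=j, m,p ≤ j-2} χ^{[m]} χ^{[p]} + d ∑_{m+p=j-2} χ^{[m]} χ^{[p]} ]`.
In the last clause `j = n + 3`, and the indices run through `{0, …, j - 2}`. -/
def chiCoeff (b₁ : ℝ) (lam chi : ℂ) : ℕ → ℂ
  | 0 => chi
  | 1 => 1
  | n + 2 =>
    1 / (3 * chi - 2 * lam) *
      (-(1 / 2) * (∑ m : Fin (n + 2), ∑ p : Fin (n + 2), ∑ k : Fin (n + 2),
          if (m : ℕ) + p + k = n + 3 then
            chiCoeff b₁ lam chi m * chiCoeff b₁ lam chi p * chiCoeff b₁ lam chi k else 0)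
        + lam * (∑ m : Fin (n + 2), ∑ p : Fin (n + 2),
          if (m : ℕ) + p = n + 3 then
            chiCoeff b₁ lam chi m * chiCoeff b₁ lam chi p else 0)
        + dCoeff b₁ lam chi * (∑ m : Fin (n + 2), ∑ p : Fin (n + 2),
          if (m : ℕ) + p = n + 1 then
            chiCoeff b₁ lam chi m * chiCoeff b₁ lam chi p else 0))

/-- The formal series `χ(ε) = ∑ χ^{[j]} ε^j`. -/
def chiSeries (b₁ : ℝ) (lam chi : ℂ) : PowerSeries ℂ :=
  PowerSeries.mk (chiCoeff b₁ lam chi)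

/-- The coefficients `X^{[k]} = i (χ^{[k]} x + (1/2) ∑_{j ≤ k} χ^{[j]} χ^{[k-j]} t)` of
`ω = i [χ(ε) x + χ(ε)² t / 2]`. -/
def omegaCoeff (b₁ : ℝ) (lam chi : ℂ) (x t : ℝ) (k : ℕ) : ℂ :=
  Complex.I * (chiCoeff b₁ lam chi k * x
    + 1 / 2 * (∑ j ∈ Finset.range (k + 1),
        chiCoeff b₁ lam chi j * chiCoeff b₁ lam chi (k - j)) * t)

/-- The exponential of a formal power series with zero constant coefficient. -/
def expSeries (g : PowerSeries ℂ) : PowerSeries ℂ :=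
  PowerSeries.subst g (PowerSeries.exp ℂ)

/-- The series `∑_j S^{[j]} ε^j = exp (∑_{k ≥ 1} X^{[k]} ε^k)` of elementary Schur polynomials. -/
def schurSeries (b₁ : ℝ) (lam chi : ℂ) (x t : ℝ) : PowerSeries ℂ :=
  expSeries (PowerSeries.mk fun k => if k = 0 then 0 else omegaCoeff b₁ lam chi x t k)

/-- The three components of `D⁻¹ Φ(ε)`, `D = diag(1, exp θ₁, exp θ₂)`, as formal series:
`S(ε) (1, a₁ / (χ(ε) + b₁), a₂ / (χ(ε) - b₁))`. -/
def phiSeries (a₁ a₂ b₁ : ℝ) (lam chi : ℂ) (x t : ℝ) : Fin 3 → PowerSeries ℂ :=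
  ![schurSeries b₁ lam chi x t,
    PowerSeries.C (a₁ : ℂ) * (chiSeries b₁ lam chi + PowerSeries.C (b₁ : ℂ))⁻¹
      * schurSeries b₁ lam chi x t,
    PowerSeries.C (a₂ : ℂ) * (chiSeries b₁ lam chi - PowerSeries.C (b₁ : ℂ))⁻¹
      * schurSeries b₁ lam chi x t]

/-- The diagonal entries of `D = diag(1, exp θ₁, exp θ₂)`. -/
def gauge (a₁ a₂ b₁ x t : ℝ) : Fin 3 → ℂ :=
  ![1, Complex.exp (theta a₁ a₂ b₁ x t), Complex.exp (theta a₁ a₂ (-b₁) x t)]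

/-- The series `ε α(ε)`, where `α(ε) = ∑_k α^{[k]} ε^{2k}`. -/
def epsAlphaSeries (alpha : ℕ → ℂ) : PowerSeries ℂ :=
  PowerSeries.mk fun n => if n % 2 = 1 then alpha (n / 2) else 0

/-- `Ψ^{[k]}`, `k ≥ 0`: the coefficient of `ε^{2k}` in
`Ψ(ε) = (exp (ε α(ε)) Φ(ε) - exp (-ε α(ε)) Φ(-ε)) / (2ε)`, that is, as `α` is even, the
coefficient of `ε^{2k+1}` in `exp (ε α(ε)) Φ(ε)`. -/
def Psi (a₁ a₂ b₁ : ℝ) (lam chi : ℂ) (alpha : ℕ → ℂ) (x t : ℝ) (k : ℕ) : Fin 3 → ℂ :=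
  fun c => gauge a₁ a₂ b₁ x t c *
    PowerSeries.coeff (2 * k + 1)
      (expSeries (epsAlphaSeries alpha) * phiSeries a₁ a₂ b₁ lam chi x t c)

/-! ## The determinant formula

The two families of data are indexed by `Fin 2` (indices `0`, `1` for the English `1`, `2`), and
the row and column indices inside the blocks start from `0`. -/

/-- The coefficient of `ε_j^{2t'} conj(ε_i)^{2r}` in
`⟨Ψ_i(ε_i), Ψ_j(ε_j)⟩ / (λ_j(ε_j) - conj λ_i(ε_i))`. Here `⟨u, v⟩ = u† v`. -/
def Mentry (a₁ a₂ b₁ : ℝ) (lam chi : Fin 2 → ℂ) (alpha : Fin 2 → ℕ → ℂ) (x t : ℝ)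
    (i j : Fin 2) (r t' : ℕ) : ℂ :=
  ∑ l ∈ Finset.range (r + t' + 1),
    ∑ mn ∈ (Finset.HasAntidiagonal.antidiagonal t').filter (fun mn => mn.1 ≤ l ∧ mn.2 ≤ r + t' - l),
      (Nat.choose l mn.1 : ℂ)
        * (conj (dCoeff b₁ (lam i) (chi i)) ^ (l - mn.1)
            * (-dCoeff b₁ (lam j) (chi j)) ^ mn.1 / (lam j - conj (lam i)) ^ (l + 1))
        * (star (Psi a₁ a₂ b₁ (lam i) (chi i) (alpha i) x t (r + t' - l - mn.2)) ⬝ᵥ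
            Psi a₁ a₂ b₁ (lam j) (chi j) (alpha j) x t mn.2)

/-- Index set of the block matrices: block `i` has size `N i`. -/
abbrev Idx (N : Fin 2 → ℕ) : Type := Σ i : Fin 2, Fin (N i)

/-- The block matrix `M = (M_{i,j})`, `M_{i,j} = (M_{i,j}^{[r,t]})` of size `N_i × N_j`. -/
def Mmat (a₁ a₂ b₁ : ℝ) (lam chi : Fin 2 → ℂ) (alpha : Fin 2 → ℕ → ℂ) (N : Fin 2 → ℕ)
    (x t : ℝ) : Matrix (Idx N) (Idx N) ℂ :=
  Matrix.of fun p s => Mentry a₁ a₂ b₁ lam chi alpha x t p.1 s.1 p.2 s.2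

/-- The `3 × (N₁ + N₂)` matrix `X` with columns `Ψ_i^{[k]}`, `0 ≤ k < N_i`. -/
def Xmat (a₁ a₂ b₁ : ℝ) (lam chi : Fin 2 → ℂ) (alpha : Fin 2 → ℕ → ℂ) (N : Fin 2 → ℕ)
    (x t : ℝ) : Matrix (Fin 3) (Idx N) ℂ :=
  Matrix.of fun c s => Psi a₁ a₂ b₁ (lam s.1) (chi s.1) (alpha s.1) x t s.2 c

/-- The row vector `Y₂ = X₂ exp(-θ₁) / a₁`, where `X₂` is the second row of `X`. -/
def Y2 (a₁ a₂ b₁ : ℝ) (lam chi : Fin 2 → ℂ) (alpha : Fin 2 → ℕ → ℂ) (N : Fin 2 → ℕ)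
    (x t : ℝ) : Idx N → ℂ :=
  fun s => Xmat a₁ a₂ b₁ lam chi alpha N x t 1 s * Complex.exp (-theta a₁ a₂ b₁ x t) / a₁

/-- The row vector `Y₃ = X₃ exp(-θ₂) / a₂`, where `X₃` is the third row of `X`. -/
def Y3 (a₁ a₂ b₁ : ℝ) (lam chi : Fin 2 → ℂ) (alpha : Fin 2 → ℕ → ℂ) (N : Fin 2 → ℕ)
    (x t : ℝ) : Idx N → ℂ :=
  fun s => Xmat a₁ a₂ b₁ lam chi alpha N x t 2 s * Complex.exp (-theta a₁ a₂ (-b₁) x t) / a₂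

/-- `M₁ = M - 2 X₁† Y₂`, where `X₁` is the first row of `X`. -/
def M1mat (a₁ a₂ b₁ : ℝ) (lam chi : Fin 2 → ℂ) (alpha : Fin 2 → ℕ → ℂ) (N : Fin 2 → ℕ)
    (x t : ℝ) : Matrix (Idx N) (Idx N) ℂ :=
  Mmat a₁ a₂ b₁ lam chi alpha N x t
    - (2 : ℂ) • Matrix.vecMulVec (star (Xmat a₁ a₂ b₁ lam chi alpha N x t 0))
        (Y2 a₁ a₂ b₁ lam chi alpha N x t)

/-- `M₂ = M - 2 X₁† Y₃`, where `X₁` is the first row of `X`. -/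
def M2mat (a₁ a₂ b₁ : ℝ) (lam chi : Fin 2 → ℂ) (alpha : Fin 2 → ℕ → ℂ) (N : Fin 2 → ℕ)
    (x t : ℝ) : Matrix (Idx N) (Idx N) ℂ :=
  Mmat a₁ a₂ b₁ lam chi alpha N x t
    - (2 : ℂ) • Matrix.vecMulVec (star (Xmat a₁ a₂ b₁ lam chi alpha N x t 0))
        (Y3 a₁ a₂ b₁ lam chi alpha N x t)

/-- `q₁[N] = a₁ (det M₁ / det M) exp θ₁`. -/
def q1N (a₁ a₂ b₁ : ℝ) (lam chi : Fin 2 → ℂ) (alpha : Fin 2 → ℕ → ℂ) (N : Fin 2 → ℕ)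
    (x t : ℝ) : ℂ :=
  a₁ * ((M1mat a₁ a₂ b₁ lam chi alpha N x t).det / (Mmat a₁ a₂ b₁ lam chi alpha N x t).det)
    * Complex.exp (theta a₁ a₂ b₁ x t)

/-- `q₂[N] = a₂ (det M₂ / det M) exp θ₂`. -/
def q2N (a₁ a₂ b₁ : ℝ) (lam chi : Fin 2 → ℂ) (alpha : Fin 2 → ℕ → ℂ) (N : Fin 2 → ℕ)
    (x t : ℝ) : ℂ :=
  a₂ * ((M2mat a₁ a₂ b₁ lam chi alpha N x t).det / (Mmat a₁ a₂ b₁ lam chi alpha N x t).det)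
    * Complex.exp (theta a₁ a₂ (-b₁) x t)

/-- `P = -X M⁻¹ X†`. -/
def Pmat (a₁ a₂ b₁ : ℝ) (lam chi : Fin 2 → ℂ) (alpha : Fin 2 → ℕ → ℂ) (N : Fin 2 → ℕ)
    (x t : ℝ) : Matrix (Fin 3) (Fin 3) ℂ :=
  -(Xmat a₁ a₂ b₁ lam chi alpha N x t * (Mmat a₁ a₂ b₁ lam chi alpha N x t)⁻¹
      * (Xmat a₁ a₂ b₁ lam chi alpha N x t)ᴴ)

end CNLS

end

noncomputable section

namespace CNLS

open PowerSeries

/-! ## Exponentials of formal power series -/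

/-! Everything is linear algebra on truncated power series in ε. Multiplication by `χ(ε)` on
coefficient vectors is a block Toeplitz matrix `J` (`chiMat`). Since `χ(ε)` lies on the spectral
curve over `λ + d ε²` (`chiSeries_root`), multiplication by `λ + d ε²` is `Λ` with `2Λ = J - a₁² (J
+ b₁)⁻¹ - a₂² (J - b₁)⁻¹`.

Let `u` be the row with a 1 at the start of each block, and let `H` be the constant Cauchy matrix
solving `H J - J† H = 2 u† u`. By the partial fractions above, `H Λ - Λ† H` is the Gram matrix of
`u`, `a₁ u (J + b₁)⁻¹`, `a₂ u (J - b₁)⁻¹` (`IsCauchy.spectral`). Let `B` be the matrix extracting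
the odd coefficients of the scalar wave series, so that the rows of `X` are, up to unimodular gauge,
those three rows times `B`. Then `B† H B` and `M` satisfy the same Sylvester equation, whose
solution is unique because `λ_j ≠ conj λ_i`; hence `M = B† H B` (`Mmat_eq`). Likewise `M₁` and `M₂`
are `B† (J + c)† H (J + c)⁻¹ B` with `c = b₁, -b₁`. All dependence on `x`, `t` sits in `B`.

Non-degeneracy (`sylvester_det_ne_zero`) is an observability argument: a kernel vector of a
skew-Hermitian solution of a Sylvester equation with Gram right-hand side is killed by `X`, the
kernel is invariant under the spectral matrix, and the only eigenvectors of that matrix are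
multiples of the first basis vectors of the blocks, where `X` has nonzero columns.

The equation: `B` evolves, up to an irrelevant column scaling, by `∂ₓ B = i J B`, `∂ₜ B = (i/2) J²
B`. As `H J - J† H` has rank at most one, derivatives of the scalars `(u K B) M⁻¹ (u K' B)†` are
quadratic polynomials in scalars of the same kind. The quotients `det M_j / det M` are envelopes
`f_c = 1 - 2 (u (J + c)⁻¹ B) M⁻¹ (u B)†`, and they satisfy `i f_t + f_xx / 2 + i c f_x + W f = 0`
with the same `W` for both `c` (`envelope_equation`). The relation between `J` and `Λ` identifies
`W` with `a₁² (|f_{b₁}|² - 1) + a₂² (|f_{-b₁}|² - 1)` (`envelope_potential`), which closes the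
system.

Background: `χ` is not real, so `z = i (x + χ t)` is large in every direction and the coefficients
of the wave series behave like `z^j / j!`. The column space of `B` then tends to the span of the
first `N_i` basis vectors of each block (`exists_frame`). This space is invariant under Toeplitz
matrices, so in the limit the quotient becomes `conj (det L) / det L` with `L` a block of `J + c`,
of modulus one (`det_incl_shift`). Rationality holds because the coefficients of the wave series are
polynomials in `x` and `t`. -/

theorem coeff_succ_of_derivative_eq {g f : PowerSeries ℂ}
    (hf : derivative ℂ f = derivative ℂ g * f) (n : ℕ) :
    coeff (n + 1) f = (∑ p ∈ Finset.HasAntidiagonal.antidiagonal n,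
      (coeff (p.1 + 1) g * (p.1 + 1)) * coeff p.2 f) / (n + 1) := by
  have h := congrArg (coeff n) hf
  rw [coeff_derivative, coeff_mul] at h
  have hn : (n + 1 : ℂ) ≠ 0 := Nat.cast_add_one_ne_zero n
  rw [eq_div_iff hn, h]
  simp only [coeff_derivative]

/-- The equation `f' = g' f` is a recursion for the coefficients of `f` whose only freedom is the
constant term. The same recursion underlies the parameter derivative, the asymptotics and the
polynomiality of `expSeries` further on. -/
theorem eq_of_derivative_eq {g f e : PowerSeries ℂ}
    (hf : derivative ℂ f = derivative ℂ g * f) (he : derivative ℂ e = derivative ℂ g * e)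
    (h0 : constantCoeff f = constantCoeff e) : f = e := by
  ext n
  induction n using Nat.strong_induction_on with
  | _ n ih =>
    rcases n with _ | n
    · simpa using h0
    · rw [coeff_succ_of_derivative_eq hf, coeff_succ_of_derivative_eq he]
      congr 1
      refine Finset.sum_congr rfl fun p hp => ?_
      rw [ih p.2 (by have := Finset.HasAntidiagonal.mem_antidiagonal.1 hp; omega)]

theorem constantCoeff_expSeries {g : PowerSeries ℂ} (hg : constantCoeff g = 0) :
    constantCoeff (expSeries g) = 1 := by
  unfold expSeries
  have h := PowerSeries.constantCoeff_subst
    (PowerSeries.HasSubst.of_constantCoeff_zero' hg) (PowerSeries.exp ℂ)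
  rw [finsum_eq_single _ 0] at h
  · change constantCoeff (subst g (PowerSeries.exp ℂ)) = _ at h
    simp [h]
  · intro n hn
    change _ • constantCoeff (g ^ n) = 0
    simp [hg, hn]

theorem derivative_expSeries {g : PowerSeries ℂ} (hg : constantCoeff g = 0) :
    derivative ℂ (expSeries g) = derivative ℂ g * expSeries g := by
  unfold expSeries
  rw [PowerSeries.derivative_subst (PowerSeries.HasSubst.of_constantCoeff_zero' hg),
    PowerSeries.derivative_exp, mul_comm]

theorem expSeries_add {g h : PowerSeries ℂ} (hg : constantCoeff g = 0)
    (hh : constantCoeff h = 0) : expSeries (g + h) = expSeries g * expSeries h := by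
  have hgh : constantCoeff (g + h) = 0 := by simp [hg, hh]
  refine eq_of_derivative_eq (derivative_expSeries hgh) ?_ ?_
  · rw [Derivation.leibniz, derivative_expSeries hg, derivative_expSeries hh, map_add]
    simp only [smul_eq_mul]
    ring
  · simp [constantCoeff_expSeries, hg, hh, hgh]

/-- Differentiation of `exp (g(s))` with respect to a parameter on which `g` depends affinely. -/
theorem hasDerivAt_coeff_expSeries {g : ℝ → PowerSeries ℂ} {h : PowerSeries ℂ} (s : ℝ)
    (hg0 : ∀ s, constantCoeff (g s) = 0)
    (hg : ∀ n, HasDerivAt (fun s => coeff n (g s)) (coeff n h) s) (n : ℕ) :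
    HasDerivAt (fun s => coeff n (expSeries (g s))) (coeff n (h * expSeries (g s))) s := by
  induction n using Nat.strong_induction_on with
  | _ n ih =>
    rcases n with _ | n
    · have h0 : coeff 0 h = 0 := by
        refine (hg 0).unique ?_
        simpa [hg0] using hasDerivAt_const s (0 : ℂ)
      have h1 : constantCoeff h = 0 := by simpa using h0
      simpa [constantCoeff_expSeries (hg0 _), h1] using hasDerivAt_const s (1 : ℂ)
    · have hrec : (fun s => coeff (n + 1) (expSeries (g s))) = fun s =>
          (∑ p ∈ Finset.HasAntidiagonal.antidiagonal n,
            (coeff (p.1 + 1) (g s) * (p.1 + 1)) * coeff p.2 (expSeries (g s))) / (n + 1) :=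
        funext fun s => coeff_succ_of_derivative_eq (derivative_expSeries (hg0 s)) n
      rw [hrec]
      have hsum := HasDerivAt.fun_sum (u := Finset.HasAntidiagonal.antidiagonal n)
        (A := fun p s => (coeff (p.1 + 1) (g s) * (p.1 + 1)) * coeff p.2 (expSeries (g s)))
        (A' := fun p => (coeff (p.1 + 1) h * (p.1 + 1)) * coeff p.2 (expSeries (g s))
          + (coeff (p.1 + 1) (g s) * (p.1 + 1)) * coeff p.2 (h * expSeries (g s))) (x := s)
        (fun p hp => ((hg (p.1 + 1)).mul_const _).mul
          (ih p.2 (by have := Finset.HasAntidiagonal.mem_antidiagonal.1 hp; omega)))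
      refine (hsum.div_const ((n : ℂ) + 1)).congr_deriv ?_
      -- The claimed derivative `h exp g` obeys the recursion obtained by differentiating that of
      -- `exp g` in the parameter.
      have hd : derivative ℂ (h * expSeries (g s))
          = derivative ℂ h * expSeries (g s) + derivative ℂ (g s) * (h * expSeries (g s)) := by
        rw [Derivation.leibniz, derivative_expSeries (hg0 s)]
        simp only [smul_eq_mul]
        ring
      have h2 := congrArg (coeff n) hd
      rw [coeff_derivative, map_add, coeff_mul, coeff_mul, coeff_mul] at h2
      rw [div_eq_iff (Nat.cast_add_one_ne_zero n), coeff_mul, h2, ← Finset.sum_add_distrib]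
      simp only [coeff_derivative]

open Filter Topology in
/-- If the linear coefficient dominates, `exp g` behaves like the exponential of its linear term. -/
theorem tendsto_coeff_expSeries {α : Type*} {l : Filter α} {g : α → PowerSeries ℂ} {z : α → ℂ}
    (hg0 : ∀ a, constantCoeff (g a) = 0)
    (hg1 : Tendsto (fun a => coeff 1 (g a) / z a) l (𝓝 1))
    (hg2 : ∀ k, 2 ≤ k → Tendsto (fun a => coeff k (g a) / z a ^ k) l (𝓝 0)) (n : ℕ) :
    Tendsto (fun a => coeff n (expSeries (g a)) / z a ^ n) l (𝓝 (1 / (n.factorial : ℂ))) := by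
  induction n using Nat.strong_induction_on with
  | _ n ih =>
    rcases n with _ | n
    · simpa [constantCoeff_expSeries (hg0 _)] using tendsto_const_nhds
    · have hrec : (fun a => coeff (n + 1) (expSeries (g a)) / z a ^ (n + 1)) = fun a =>
          (∑ p ∈ Finset.HasAntidiagonal.antidiagonal n,
            (coeff (p.1 + 1) (g a) / z a ^ (p.1 + 1) * (p.1 + 1))
              * (coeff p.2 (expSeries (g a)) / z a ^ p.2)) / (n + 1) := by
        funext a
        rw [coeff_succ_of_derivative_eq (derivative_expSeries (hg0 a)) n, div_right_comm,
          Finset.sum_div]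
        congr 1
        refine Finset.sum_congr rfl fun p hp => ?_
        rw [← Finset.HasAntidiagonal.mem_antidiagonal.1 hp, add_right_comm, pow_add]
        ring
      rw [hrec]
      -- Only the term with the linear coefficient of `g` survives in the limit, so the limits
      -- satisfy `e_{n+1} = e_n / (n + 1)`.
      have hsum := tendsto_finsetSum (Finset.HasAntidiagonal.antidiagonal n)
        (f := fun (p : ℕ × ℕ) a => (coeff (p.1 + 1) (g a) / z a ^ (p.1 + 1) * (p.1 + 1))
              * (coeff p.2 (expSeries (g a)) / z a ^ p.2))
        (a := fun p => (if p.1 = 0 then 1 else 0) * (1 / (p.2.factorial : ℂ))) (x := l)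
        (fun p hp => by
          refine Tendsto.mul ?_ (ih p.2 (by have := Finset.HasAntidiagonal.mem_antidiagonal.1 hp; omega))
          by_cases h0 : p.1 = 0
          · simpa [h0] using hg1
          · simpa [h0] using (hg2 (p.1 + 1) (by omega)).mul_const ((p.1 : ℂ) + 1))
      convert hsum.div_const ((n : ℂ) + 1) using 2
      rw [Finset.Nat.sum_antidiagonal_eq_sum_range_succ
        (fun i j => (if i = 0 then (1 : ℂ) else 0) * (1 / (j.factorial : ℂ))),
        Finset.sum_eq_single 0]
      · rw [Nat.factorial_succ]
        push_cast
        field_simp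
        simp
      · intro b _ hb
        simp [hb]
      · simp

/-! ## The spectral data -/

section Scalars

variable {a₁ a₂ b₁ : ℝ} {lam chi : ℂ}

theorem ne_zero_of_Delta_pos (h : 0 < Delta a₁ a₂ b₁) : a₁ ≠ 0 ∧ a₂ ≠ 0 ∧ b₁ ≠ 0 := by
  refine ⟨?_, ?_, ?_⟩ <;> rintro rfl <;> simp [Delta] at h

theorem eval_eq_zero_of_two_le_rootMultiplicity
    (h : 2 ≤ (cubic a₁ a₂ b₁ lam).rootMultiplicity chi) :
    chi ^ 3 - 2 * lam * chi ^ 2 - ((a₁ : ℂ) ^ 2 + (a₂ : ℂ) ^ 2 + (b₁ : ℂ) ^ 2) * chi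
        + (((a₁ : ℂ) ^ 2 - (a₂ : ℂ) ^ 2) * b₁ + 2 * (b₁ : ℂ) ^ 2 * lam) = 0 ∧
      3 * chi ^ 2 - 4 * lam * chi - ((a₁ : ℂ) ^ 2 + (a₂ : ℂ) ^ 2 + (b₁ : ℂ) ^ 2) = 0 := by
  have h0 : cubic a₁ a₂ b₁ lam ≠ 0 := by
    intro h0
    rw [h0] at h
    simp at h
  obtain ⟨h1, h2⟩ := (Polynomial.one_lt_rootMultiplicity_iff_isRoot h0).1 h
  constructor
  · simpa [cubic, Polynomial.IsRoot] using h1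
  · have h3 := h2
    simp [cubic, Polynomial.IsRoot, -map_pow] at h3
    linear_combination h3

variable (a₁ a₂ b₁ lam chi) in
/-- `chi` is a double root of the cubic at `lam`, and `a₁ a₂ b₁ ≠ 0`. -/
structure IsDoubleRoot : Prop where
  a₁_ne : a₁ ≠ 0
  a₂_ne : a₂ ≠ 0
  b₁_ne : b₁ ≠ 0
  root : chi ^ 3 - 2 * lam * chi ^ 2 - ((a₁ : ℂ) ^ 2 + (a₂ : ℂ) ^ 2 + (b₁ : ℂ) ^ 2) * chi
        + (((a₁ : ℂ) ^ 2 - (a₂ : ℂ) ^ 2) * b₁ + 2 * (b₁ : ℂ) ^ 2 * lam) = 0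
  deriv : 3 * chi ^ 2 - 4 * lam * chi - ((a₁ : ℂ) ^ 2 + (a₂ : ℂ) ^ 2 + (b₁ : ℂ) ^ 2) = 0

namespace IsDoubleRoot

/-- At `ξ = -b₁` the cubic takes the value `2 a₁² b₁`, whatever `λ` is; at `ξ = b₁` it takes the
value `-2 a₂² b₁`. -/
theorem add_ne (h : IsDoubleRoot a₁ a₂ b₁ lam chi) : chi + b₁ ≠ 0 := by
  intro h0
  have h1 : chi = -b₁ := by linear_combination h0
  have h2 := h.root
  rw [h1] at h2
  have h3 : (2 * a₁ ^ 2 * b₁ : ℂ) = 0 := by linear_combination h2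
  simp [h.a₁_ne, h.b₁_ne] at h3

theorem sub_ne (h : IsDoubleRoot a₁ a₂ b₁ lam chi) : chi - b₁ ≠ 0 := by
  intro h0
  have h1 : chi = b₁ := by linear_combination h0
  have h2 := h.root
  rw [h1] at h2
  have h3 : (2 * a₂ ^ 2 * b₁ : ℂ) = 0 := by linear_combination -h2
  simp [h.a₂_ne, h.b₁_ne] at h3

theorem sq_ne (h : IsDoubleRoot a₁ a₂ b₁ lam chi) : (b₁ : ℂ) ^ 2 - chi ^ 2 ≠ 0 := by
  intro h0
  have : (chi + b₁) * (chi - b₁) = 0 := by linear_combination -h0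
  rcases mul_eq_zero.1 this with h1 | h1
  · exact h.add_ne h1
  · exact h.sub_ne h1

/-- The spectral parameter as a rational function of the double root. -/
theorem lam_eq (h : IsDoubleRoot a₁ a₂ b₁ lam chi) :
    2 * lam = chi - (a₁ : ℂ) ^ 2 / (chi + b₁) - (a₂ : ℂ) ^ 2 / (chi - b₁) := by
  have h1 := h.add_ne
  have h2 := h.sub_ne
  field_simp
  linear_combination -h.root

/-- A double root is a critical point of `2λ = χ - a₁²/(χ + b₁) - a₂²/(χ - b₁)`, whose derivative `1
+ a₁²/(χ + b₁)² + a₂²/(χ - b₁)²` is positive on the real line. The proof uses this with denominators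
cleared, as a vanishing sum of squares. Non-reality of `χ` is what makes the wave localized in all
directions of the plane. -/
theorem chi_im_ne (h : IsDoubleRoot a₁ a₂ b₁ lam chi) : chi.im ≠ 0 := by
  intro h0
  obtain ⟨c, rfl⟩ : ∃ c : ℝ, chi = c := ⟨chi.re, Complex.ext rfl (by simp [h0])⟩
  have h1 : ((c : ℂ) ^ 2 - b₁ ^ 2) ^ 2 + a₁ ^ 2 * (c - b₁) ^ 2 + a₂ ^ 2 * (c + b₁) ^ 2 = 0 := by
    linear_combination ((c : ℂ) ^ 2 - b₁ ^ 2) * h.deriv - 2 * c * h.root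
  have h2 : (c ^ 2 - b₁ ^ 2) ^ 2 + a₁ ^ 2 * (c - b₁) ^ 2 + a₂ ^ 2 * (c + b₁) ^ 2 = 0 := by
    exact_mod_cast h1
  have h3 : a₁ ^ 2 * (c - b₁) ^ 2 = 0 := by
    nlinarith [sq_nonneg (c ^ 2 - b₁ ^ 2), mul_nonneg (sq_nonneg a₁) (sq_nonneg (c - b₁)),
      mul_nonneg (sq_nonneg a₂) (sq_nonneg (c + b₁))]
  have h4 : c - b₁ = 0 := by simpa [h.a₁_ne] using h3
  exact h.sub_ne (by exact_mod_cast h4)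

theorem star (h : IsDoubleRoot a₁ a₂ b₁ lam chi) :
    IsDoubleRoot a₁ a₂ b₁ (starRingEnd ℂ lam) (starRingEnd ℂ chi) where
  a₁_ne := h.a₁_ne
  a₂_ne := h.a₂_ne
  b₁_ne := h.b₁_ne
  root := by simpa [map_ofNat] using congrArg (starRingEnd ℂ) h.root
  deriv := by simpa [map_ofNat] using congrArg (starRingEnd ℂ) h.deriv

/-- For real `λ` the cubic has real coefficients, so `χ` and its distinct conjugate would both be
double roots: too many for degree three. -/
theorem lam_ne_conj (h : IsDoubleRoot a₁ a₂ b₁ lam chi) : lam ≠ starRingEnd ℂ lam := by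
  intro h0
  have hc := h.star
  rw [← h0] at hc
  set c := starRingEnd ℂ chi with hc_def
  have hne : c - chi ≠ 0 := by
    intro h1
    exact h.chi_im_ne (Complex.conj_eq_iff_im.1 (sub_eq_zero.1 h1))
  have e1 : (c - chi) * (c - chi) * (c + 2 * chi - 2 * lam) = 0 := by
    linear_combination hc.root - h.root - (c - chi) * h.deriv
  have e2 : c + 2 * chi - 2 * lam = 0 := by simpa [hne] using e1
  have e3 : (c - chi) * (c - chi) = 0 := by
    linear_combination hc.deriv - h.deriv - 2 * (c - chi) * e2
  simp [hne] at e3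

/-- The roots of the cubic sum to `2λ`, so `3χ = 2λ` means a triple root. That forces `χ` purely
imaginary with `χ² = -3 b₁²` and `a₁² = a₂² = 4 b₁²`, exactly where the bracket in `Delta` vanishes:
`12³ = 27 · 4 · 4 · 4`. -/
theorem three_ne (h : IsDoubleRoot a₁ a₂ b₁ lam chi) (hΔ : 0 < Delta a₁ a₂ b₁) :
    3 * chi - 2 * lam ≠ 0 := by
  intro h0
  have h1 : 3 * chi ^ 2 = -((a₁ ^ 2 + a₂ ^ 2 + b₁ ^ 2 : ℝ) : ℂ) := by
    push_cast
    linear_combination -h.deriv + 2 * chi * h0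
  have h2 : chi ^ 3 + 3 * b₁ ^ 2 * chi = -(((a₁ ^ 2 - a₂ ^ 2) * b₁ : ℝ) : ℂ) := by
    push_cast
    linear_combination h.root - chi * h.deriv + (chi ^ 2 + b₁ ^ 2) * h0
  have hre : chi.re = 0 := by
    have h3 := congrArg Complex.im h1
    have h4 : (3 * chi ^ 2).im = 6 * chi.re * chi.im := by
      simp [pow_two]
      ring
    rw [h4] at h3
    simpa [h.chi_im_ne, -Complex.ofReal_add, -Complex.ofReal_pow] using h3
  have hchi : chi = chi.im * Complex.I := Complex.ext (by simp [hre]) (by simp)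
  set y := chi.im with hy
  have hy0 : y ≠ 0 := h.chi_im_ne
  have e1 : 3 * y ^ 2 = a₁ ^ 2 + a₂ ^ 2 + b₁ ^ 2 := by
    have : ((3 * y ^ 2 : ℝ) : ℂ) = ((a₁ ^ 2 + a₂ ^ 2 + b₁ ^ 2 : ℝ) : ℂ) := by
      rw [hchi, mul_pow, Complex.I_sq] at h1
      push_cast at h1 ⊢
      linear_combination -h1
    exact_mod_cast this
  have e2 : ((3 * b₁ ^ 2 - y ^ 2) * y : ℝ) * Complex.I = -(((a₁ ^ 2 - a₂ ^ 2) * b₁ : ℝ) : ℂ) := by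
    rw [hchi] at h2
    push_cast at h2 ⊢
    linear_combination h2 - (y : ℂ) ^ 3 * Complex.I * Complex.I_sq
  have e3 : (3 * b₁ ^ 2 - y ^ 2) * y = 0 := by
    simpa [-Complex.ofReal_mul, -Complex.ofReal_sub] using congrArg Complex.im e2
  have e4 : 0 = -((a₁ ^ 2 - a₂ ^ 2) * b₁) := by
    simpa [-Complex.ofReal_mul, -Complex.ofReal_sub] using congrArg Complex.re e2
  have e5 : y ^ 2 = 3 * b₁ ^ 2 := by
    rcases mul_eq_zero.1 e3 with h3 | h3
    · linarith
    · exact absurd h3 hy0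
  have e6 : a₁ ^ 2 = a₂ ^ 2 := by
    rcases mul_eq_zero.1 (neg_eq_zero.1 e4.symm) with h3 | h3
    · linarith
    · exact absurd h3 h.b₁_ne
  have e7 : a₂ ^ 2 = 4 * b₁ ^ 2 := by linarith
  have : Delta a₁ a₂ b₁ = 0 := by
    unfold Delta
    rw [e6, e7]
    ring
  linarith

theorem dCoeff_ne (h : IsDoubleRoot a₁ a₂ b₁ lam chi) (hΔ : 0 < Delta a₁ a₂ b₁) :
    dCoeff b₁ lam chi ≠ 0 := by
  have h1 := h.three_ne hΔ
  have h2 := h.sq_ne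
  unfold dCoeff
  refine div_ne_zero (fun h3 => h1 (by linear_combination -h3)) fun h3 => h2 ?_
  linear_combination h3 / 2

theorem chi_ne {lam' chi' : ℂ} (h : IsDoubleRoot a₁ a₂ b₁ lam chi)
    (h' : IsDoubleRoot a₁ a₂ b₁ lam' chi') (hne : lam ≠ lam') : chi ≠ chi' := by
  rintro rfl
  have := h.lam_eq.trans h'.lam_eq.symm
  exact hne (mul_left_cancel₀ two_ne_zero this)

end IsDoubleRoot

end Scalars

/-! ## The formal spectral curve -/

section Series

variable {a₁ a₂ b₁ : ℝ} {lam chi : ℂ}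

theorem coeff_one_mul' (f g : PowerSeries ℂ) :
    coeff 1 (f * g) = coeff 0 f * coeff 1 g + coeff 1 f * coeff 0 g := by
  simp [coeff_mul, Finset.Nat.antidiagonal_succ]

/-- The expansion `λ + d ε²` of the spectral parameter. -/
def lamSeries (b₁ : ℝ) (lam chi : ℂ) : PowerSeries ℂ :=
  C lam + C (dCoeff b₁ lam chi) * X ^ 2

/-- The part of degree at most `n` of `chiSeries`. -/
def chiTrunc (b₁ : ℝ) (lam chi : ℂ) (n : ℕ) : PowerSeries ℂ :=
  ∑ m : Fin (n + 1), monomial (m : ℕ) (chiCoeff b₁ lam chi m)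

theorem coeff_chiTrunc (n k : ℕ) : coeff k (chiTrunc b₁ lam chi n)
    = if k ≤ n then chiCoeff b₁ lam chi k else 0 := by
  unfold chiTrunc
  rw [map_sum]
  simp only [coeff_monomial]
  split_ifs with h
  · rw [Finset.sum_eq_single (⟨k, Nat.lt_succ_of_le h⟩ : Fin (n + 1))]
    · simp
    · intro b _ hb
      rw [if_neg]
      rintro rfl
      exact hb rfl
    · simp
  · refine Finset.sum_eq_zero fun m _ => if_neg ?_
    have := m.2
    omega

theorem chiSeries_eq_trunc (n : ℕ) : ∃ T : PowerSeries ℂ,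
    chiSeries b₁ lam chi = chiTrunc b₁ lam chi n + X ^ (n + 1) * T := by
  obtain ⟨T, hT⟩ := (X_pow_dvd_iff (n := n + 1)
    (φ := chiSeries b₁ lam chi - chiTrunc b₁ lam chi n)).2 fun m hm => by
      rw [map_sub, coeff_chiTrunc, if_pos (Nat.lt_succ_iff.1 hm), chiSeries, coeff_mk, sub_self]
  exact ⟨T, by rw [← hT]; ring⟩

theorem coeff_chiTrunc_sq (n k : ℕ) : coeff k (chiTrunc b₁ lam chi n ^ 2)
    = ∑ m : Fin (n + 1), ∑ p : Fin (n + 1), if (m : ℕ) + p = k then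
        chiCoeff b₁ lam chi m * chiCoeff b₁ lam chi p else 0 := by
  rw [pow_two, chiTrunc, Finset.sum_mul_sum, map_sum]
  refine Finset.sum_congr rfl fun m _ => ?_
  rw [map_sum]
  refine Finset.sum_congr rfl fun p _ => ?_
  rw [monomial_mul_monomial, coeff_monomial]
  simp only [eq_comm]

theorem coeff_chiTrunc_cube (n k : ℕ) : coeff k (chiTrunc b₁ lam chi n ^ 3)
    = ∑ m : Fin (n + 1), ∑ p : Fin (n + 1), ∑ r : Fin (n + 1), if (m : ℕ) + p + r = k then
        chiCoeff b₁ lam chi m * chiCoeff b₁ lam chi p * chiCoeff b₁ lam chi r else 0 := by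
  rw [pow_succ, pow_two, chiTrunc, Finset.sum_mul_sum, Finset.sum_mul, map_sum]
  refine Finset.sum_congr rfl fun m _ => ?_
  rw [Finset.sum_mul, map_sum]
  refine Finset.sum_congr rfl fun p _ => ?_
  rw [Finset.mul_sum, map_sum]
  refine Finset.sum_congr rfl fun r _ => ?_
  rw [monomial_mul_monomial, monomial_mul_monomial, coeff_monomial]
  simp only [eq_comm]

/-- The restricted sums in the recursion, with all indices at most `j - 2 = n + 1`, are coefficients
of powers of the truncated series. -/
theorem chiCoeff_rec (h : 3 * chi - 2 * lam ≠ 0) (n : ℕ) :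
    2 * (3 * chi - 2 * lam) * chiCoeff b₁ lam chi (n + 2)
      = -coeff (n + 3) (chiTrunc b₁ lam chi (n + 1) ^ 3)
        + 2 * lam * coeff (n + 3) (chiTrunc b₁ lam chi (n + 1) ^ 2)
        + 2 * dCoeff b₁ lam chi * coeff (n + 1) (chiTrunc b₁ lam chi (n + 1) ^ 2) := by
  rw [chiCoeff, coeff_chiTrunc_cube, coeff_chiTrunc_sq, coeff_chiTrunc_sq]
  field_simp

/-- `χ(ε)` solves the cubic at the spectral parameter `λ + d ε²`. -/
theorem chiSeries_root (h : IsDoubleRoot a₁ a₂ b₁ lam chi) (h3 : 3 * chi - 2 * lam ≠ 0) :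
    chiSeries b₁ lam chi ^ 3 - 2 * lamSeries b₁ lam chi * chiSeries b₁ lam chi ^ 2
      - C ((a₁ : ℂ) ^ 2 + (a₂ : ℂ) ^ 2 + (b₁ : ℂ) ^ 2) * chiSeries b₁ lam chi
      + (C (((a₁ : ℂ) ^ 2 - (a₂ : ℂ) ^ 2) * b₁) + C (2 * (b₁ : ℂ) ^ 2) * lamSeries b₁ lam chi)
        = 0 := by
  set s := (a₁ : ℂ) ^ 2 + (a₂ : ℂ) ^ 2 + (b₁ : ℂ) ^ 2 with hs
  set e := ((a₁ : ℂ) ^ 2 - (a₂ : ℂ) ^ 2) * b₁ with he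
  set d := dCoeff b₁ lam chi with hd
  have hdeq : (2 * (b₁ : ℂ) ^ 2 - 2 * chi ^ 2) * d = 2 * lam - 3 * chi := by
    have h4 : 2 * (b₁ : ℂ) ^ 2 - 2 * chi ^ 2 ≠ 0 := fun h5 => h.sq_ne (by linear_combination h5 / 2)
    rw [hd, dCoeff, mul_div_cancel₀ _ h4]
  have c0 : chiCoeff b₁ lam chi 0 = chi := by rw [chiCoeff]
  have c1 : chiCoeff b₁ lam chi 1 = 1 := by rw [chiCoeff]
  have hroot := h.root
  have hder := h.deriv
  have key : ∀ ξ : PowerSeries ℂ, ξ ^ 3 - 2 * lamSeries b₁ lam chi * ξ ^ 2 - C s * ξ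
      + (C e + C (2 * (b₁ : ℂ) ^ 2) * lamSeries b₁ lam chi)
      = ξ ^ 3 - C (2 * lam) * ξ ^ 2 - C (2 * d) * (X ^ 2 * ξ ^ 2) - C s * ξ
        + C (e + 2 * (b₁ : ℂ) ^ 2 * lam) + C (2 * (b₁ : ℂ) ^ 2 * d) * X ^ 2 := by
    intro ξ
    rw [lamSeries]
    simp only [map_mul, map_add, map_ofNat]
    ring
  rw [key]
  ext k
  rcases k with _ | _ | _ | n
  · simp [chiSeries, c0]
    linear_combination hroot
  · simp only [map_add, map_sub, coeff_C_mul, pow_succ, pow_zero, one_mul, coeff_one_mul', chiSeries,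
      coeff_mk, zero_add, c0, c1, coeff_zero_X]
    simp [c0]
    linear_combination hder
  -- Degree 2 is where `d` is determined: `χ^{[2]}` drops out because its factor is the derivative
  -- of the cubic at the double root.
  · have x2 : coeff 2 (X ^ 2 * chiSeries b₁ lam chi ^ 2) = chi ^ 2 := by
      have := coeff_X_pow_mul (chiSeries b₁ lam chi ^ 2) 2 0
      rw [zero_add] at this
      rw [this]
      simp [chiSeries, c0]
    have x3 : coeff 2 (C (2 * (b₁ : ℂ) ^ 2 * d) * X ^ 2) = 2 * (b₁ : ℂ) ^ 2 * d := by
      rw [coeff_C_mul, coeff_X_pow_self, mul_one]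
    simp only [zero_add, Nat.reduceAdd]
    rw [map_add, x3, map_add, map_sub, map_sub, map_sub, coeff_C_mul, coeff_C_mul, coeff_C_mul, x2]
    simp [pow_succ, coeff_mul, Finset.Nat.antidiagonal_succ, chiSeries, c0, c1, coeff_C]
    linear_combination hdeq + chiCoeff b₁ lam chi 2 * hder
  -- In degree `n + 3` the tail `X^{n+2} T` enters linearly. The newest coefficient `χ^{[n+3]}`, the
  -- linear coefficient of `T`, is multiplied by the vanishing derivative of the cubic, so this
  -- degree determines `χ^{[n+2]}` instead, with factor `2 (3χ - 2λ)`.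
  · obtain ⟨T, hT⟩ := chiSeries_eq_trunc (b₁ := b₁) (lam := lam) (chi := chi) (n + 1)
    set P := chiTrunc b₁ lam chi (n + 1) with hP
    have hrec := chiCoeff_rec (b₁ := b₁) h3 n
    have P0 : coeff 0 P = chi := by rw [coeff_chiTrunc, if_pos (by omega), c0]
    have P1 : coeff 1 P = 1 := by rw [coeff_chiTrunc, if_pos (by omega), c1]
    have hX : ∀ f : PowerSeries ℂ, coeff (n + 3) (X ^ (n + 1 + 1) * f) = coeff 1 f := fun f => by
      rw [show n + 3 = 1 + (n + 1 + 1) by omega, coeff_X_pow_mul]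
    have hXX : ∀ f : PowerSeries ℂ, coeff (n + 3) (X ^ (2 * (n + 1 + 1)) * f) = 0 := fun f => by
      rw [coeff_X_pow_mul', if_neg (by omega)]
    have T0 : coeff 0 T = chiCoeff b₁ lam chi (n + 2) := by
      have := congrArg (coeff (n + 2)) hT
      rw [map_add, coeff_chiTrunc, if_neg (by omega), zero_add, coeff_X_pow_mul', if_pos le_rfl,
        chiSeries, coeff_mk, Nat.sub_self] at this
      exact this.symm
    have e1 : coeff (n + 3) (chiSeries b₁ lam chi) = coeff 1 T := by
      rw [hT, map_add, hX, coeff_chiTrunc, if_neg (by omega), zero_add]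
    have e2 : coeff (n + 3) (chiSeries b₁ lam chi ^ 2)
        = coeff (n + 3) (P ^ 2) + coeff 1 (P * T + P * T) := by
      rw [hT, show (P + X ^ (n + 1 + 1) * T) ^ 2 = P ^ 2 + X ^ (n + 1 + 1) * (P * T + P * T)
        + X ^ (2 * (n + 1 + 1)) * T ^ 2 by ring, map_add, map_add, hX, hXX, add_zero]
    have e3 : coeff (n + 3) (chiSeries b₁ lam chi ^ 3)
        = coeff (n + 3) (P ^ 3) + coeff 1 (P * P * T + P * P * T + P * P * T) := by
      rw [hT, show (P + X ^ (n + 1 + 1) * T) ^ 3 = P ^ 3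
        + X ^ (n + 1 + 1) * (P * P * T + P * P * T + P * P * T)
        + X ^ (2 * (n + 1 + 1)) * (3 * P * T ^ 2 + X ^ (n + 1 + 1) * T ^ 3) by ring,
        map_add, map_add, hX, hXX, add_zero]
    have e4 : coeff (n + 3) (X ^ 2 * chiSeries b₁ lam chi ^ 2) = coeff (n + 1) (P ^ 2) := by
      rw [show n + 3 = n + 1 + 2 by omega, coeff_X_pow_mul, hT,
        show (P + X ^ (n + 1 + 1) * T) ^ 2 = P ^ 2 + X ^ (n + 1 + 1) * (2 * P * T
        + X ^ (n + 1 + 1) * T ^ 2) by ring, map_add, coeff_X_pow_mul', if_neg (by omega), add_zero]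
    have e5 : coeff (n + 3) (C (2 * (b₁ : ℂ) ^ 2 * d) * X ^ 2) = 0 := by
      rw [coeff_C_mul, coeff_X_pow, if_neg (by omega), mul_zero]
    have e6 : coeff (n + 3) (C (e + 2 * (b₁ : ℂ) ^ 2 * lam)) = 0 := by
      rw [coeff_C, if_neg (by omega)]
    change coeff (n + 3) _ = coeff (n + 3) _
    rw [map_add, map_add, map_sub, map_sub, map_sub, coeff_C_mul, coeff_C_mul, coeff_C_mul,
      e1, e2, e3, e4, e5, e6, map_zero]
    have PP0 : coeff 0 (P * P) = chi * chi := by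
      rw [← P0]
      simp
    simp only [map_add, coeff_one_mul', PP0, P0, P1, T0]
    linear_combination hrec + coeff 1 T * hder

theorem constantCoeff_chiSeries : constantCoeff (chiSeries b₁ lam chi) = chi := by
  rw [← coeff_zero_eq_constantCoeff_apply, chiSeries, coeff_mk, chiCoeff]

theorem constantCoeff_add_ne (h : IsDoubleRoot a₁ a₂ b₁ lam chi) :
    constantCoeff (chiSeries b₁ lam chi + C (b₁ : ℂ)) ≠ 0 := by
  simpa [constantCoeff_chiSeries] using h.add_ne

theorem constantCoeff_sub_ne (h : IsDoubleRoot a₁ a₂ b₁ lam chi) :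
    constantCoeff (chiSeries b₁ lam chi - C (b₁ : ℂ)) ≠ 0 := by
  simpa [constantCoeff_chiSeries] using h.sub_ne

/-- Partial fractions: divide the cubic by `(ξ + b₁)(ξ - b₁)`, a unit as a power series. Each of the
three terms on the right has a rank-one commutation relation with the Cauchy matrix. -/
theorem two_mul_lamSeries (h : IsDoubleRoot a₁ a₂ b₁ lam chi) (h3 : 3 * chi - 2 * lam ≠ 0) :
    2 * lamSeries b₁ lam chi = chiSeries b₁ lam chi
      - C ((a₁ : ℂ) ^ 2) * (chiSeries b₁ lam chi + C (b₁ : ℂ))⁻¹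
      - C ((a₂ : ℂ) ^ 2) * (chiSeries b₁ lam chi - C (b₁ : ℂ))⁻¹ := by
  have e := chiSeries_root h h3
  set ξ := chiSeries b₁ lam chi
  have m1 := PowerSeries.mul_inv_cancel _ (constantCoeff_add_ne h)
  have m2 := PowerSeries.mul_inv_cancel _ (constantCoeff_sub_ne h)
  set u := (ξ + C (b₁ : ℂ))⁻¹
  set v := (ξ - C (b₁ : ℂ))⁻¹
  simp only [map_add, map_mul, map_sub, map_pow, map_ofNat] at e ⊢
  set b : PowerSeries ℂ := C (b₁ : ℂ)
  set A : PowerSeries ℂ := C (a₁ : ℂ)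
  set B : PowerSeries ℂ := C (a₂ : ℂ)
  set L := lamSeries b₁ lam chi
  have key : 2 * L - (ξ - A ^ 2 * u - B ^ 2 * v)
      = (2 * L - ξ) * (1 - (ξ + b) * u * ((ξ - b) * v)) + A ^ 2 * u * (1 - (ξ - b) * v)
        + B ^ 2 * v * (1 - (ξ + b) * u) := by
    linear_combination -u * v * e
  rw [m1, m2] at key
  linear_combination key

end Series

/-! ## Block Toeplitz matrices -/

section Toeplitz

/-- The block diagonal matrix whose `i`-th block has as `k`-th column the coefficients of the series
`f i` in the degrees `φ k, φ k - 1, …`. For `φ = id` this is an upper triangular Toeplitz matrix. -/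
def toep (m n : Fin 2 → ℕ) (φ : ℕ → ℕ) (f : Fin 2 → PowerSeries ℂ) : Matrix (Idx m) (Idx n) ℂ :=
  Matrix.of fun p s =>
    if p.1 = s.1 ∧ (p.2 : ℕ) ≤ φ s.2 then coeff (φ s.2 - p.2) (f s.1) else 0

variable {l m n : Fin 2 → ℕ} {φ : ℕ → ℕ} {f g : Fin 2 → PowerSeries ℂ}

theorem toep_apply (p : Idx m) (s : Idx n) : toep m n φ f p s
    = if p.1 = s.1 ∧ (p.2 : ℕ) ≤ φ s.2 then coeff (φ s.2 - p.2) (f s.1) else 0 := rfl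

/-- Toeplitz blocks represent multiplication of series. The condition on `φ` ensures that the
intermediate space contains every degree that contributes, so truncation loses nothing. -/
theorem toep_mul (h : ∀ i k, k < n i → φ k < l i) :
    toep m l id f * toep l n φ g = toep m n φ (fun i => f i * g i) := by
  ext ⟨i, a⟩ ⟨j, k⟩
  rw [Matrix.mul_apply, Fintype.sum_sigma]
  simp only [toep_apply, id]
  by_cases hij : i = j
  · subst hij
    rw [Finset.sum_eq_single i _ (by simp)]
    · simp only [true_and]
      rw [Fin.sum_univ_eq_sum_range (fun b => (if (a : ℕ) ≤ b then coeff (b - a) (f i) else 0)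
        * (if b ≤ φ k then coeff (φ k - b) (g i) else 0)) (l i)]
      have hk := h i k k.2
      rw [← Finset.sum_subset (s₁ := Finset.Ico (a : ℕ) (φ k + 1))]
      · rw [Finset.sum_Ico_eq_sum_range]
        split_ifs with hak
        · rw [coeff_mul, Finset.Nat.sum_antidiagonal_eq_sum_range_succ
            (fun x y => coeff x (f i) * coeff y (g i)), show φ k + 1 - (a : ℕ) = φ k - a + 1 by omega]
          refine Finset.sum_congr rfl fun c hc => ?_
          rw [Finset.mem_range] at hc
          rw [if_pos (by omega), if_pos (by omega), show (a : ℕ) + c - a = c by omega,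
            show φ k - (a + c) = φ k - a - c by omega]
        · rw [show φ k + 1 - (a : ℕ) = 0 by omega, Finset.sum_range_zero]
      · intro b hb
        rw [Finset.mem_Ico] at hb
        rw [Finset.mem_range]
        omega
      · intro b _ hb
        rw [Finset.mem_Ico] at hb
        by_cases h1 : (a : ℕ) ≤ b
        · rw [if_neg (show ¬ b ≤ φ k by omega), mul_zero]
        · rw [if_neg h1, zero_mul]
    · intro b _ hb
      refine Finset.sum_eq_zero fun x _ => ?_
      rw [if_neg (fun h => hb h.1.symm), zero_mul]
  · rw [if_neg (fun h => hij h.1)]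
    refine Finset.sum_eq_zero fun b _ => Finset.sum_eq_zero fun x _ => ?_
    by_cases hb : i = b
    · rw [if_neg (fun h => hij (hb.trans h.1)) (c := b = j ∧ _), mul_zero]
    · rw [if_neg (fun h => hb h.1), zero_mul]

theorem toep_one : toep n n id (fun _ => 1) = 1 := by
  ext ⟨i, a⟩ ⟨j, k⟩
  rw [toep_apply, Matrix.one_apply]
  simp only [id, coeff_one]
  by_cases hij : i = j
  · subst hij
    by_cases hak : a = k
    · subst hak
      simp
    · have : (a : ℕ) ≠ k := fun h => hak (Fin.ext h)
      have hne : (⟨i, a⟩ : Idx n) ≠ ⟨i, k⟩ := fun h => hak (by simpa using h)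
      rw [if_neg hne]
      split_ifs with h1 h2
      · omega
      · rfl
      · rfl
  · rw [if_neg (fun h => hij h.1), if_neg (fun h => hij (congrArg Sigma.fst h))]

theorem toep_add : toep m n φ (fun i => f i + g i) = toep m n φ f + toep m n φ g := by
  ext p s
  simp only [Matrix.add_apply, toep_apply]
  split_ifs <;> simp

theorem toep_sub : toep m n φ (fun i => f i - g i) = toep m n φ f - toep m n φ g := by
  ext p s
  simp only [Matrix.sub_apply, toep_apply]
  split_ifs <;> simp

theorem toep_C_mul (c : ℂ) : toep m n φ (fun i => C c * f i) = c • toep m n φ f := by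
  ext p s
  simp only [Matrix.smul_apply, toep_apply]
  split_ifs <;> simp

/-- The row vector with entry `1` at the first place of each block. -/
def urow (n : Fin 2 → ℕ) : Matrix Unit (Idx n) ℂ :=
  Matrix.of fun _ s => if (s.2 : ℕ) = 0 then 1 else 0

theorem urow_mul_toep (h : ∀ i k, k < n i → φ k < m i) (r : Unit) (s : Idx n) :
    (urow m * toep m n φ f) r s = coeff (φ s.2) (f s.1) := by
  obtain ⟨j, k⟩ := s
  have hk := h j k k.2
  rw [Matrix.mul_apply, Finset.sum_eq_single (⟨j, ⟨0, by omega⟩⟩ : Idx m) _ (by simp)]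
  · simp [urow, toep_apply]
  · rintro ⟨i, b⟩ _ hb
    simp only [urow, toep_apply, Matrix.of_apply]
    split_ifs with h1 h2
    · exfalso
      apply hb
      obtain ⟨rfl, _⟩ := h2
      congr 1
      exact Fin.ext h1
    all_goals simp

theorem urow_mul_toep_id_one (h : ∀ i, n i ≤ m i) :
    urow m * toep m n id (fun _ => 1) = urow n := by
  ext r s
  rw [urow_mul_toep (φ := id) (fun i k hk => lt_of_lt_of_le hk (h i))]
  simp [urow, coeff_one]

/-! ## The Sylvester equation -/

/-- In the `(p, s)` entry, `H p s` is multiplied by `f_s(0) - conj (f_p(0)) ≠ 0`, and all other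
terms involve entries of `H` with a smaller index sum, because the Toeplitz matrix is upper
triangular. Hence the induction on that sum. -/
theorem sylvester_injective
    (hf : ∀ i j, constantCoeff (f j) ≠ conj (constantCoeff (f i)))
    {H : Matrix (Idx n) (Idx n) ℂ} (h : H * toep n n id f - (toep n n id f)ᴴ * H = 0) : H = 0 := by
  have key : ∀ N : ℕ, ∀ p s : Idx n, (p.2 : ℕ) + s.2 = N → H p s = 0 := by
    intro N
    induction N using Nat.strong_induction_on with
    | _ N ih =>
      intro p s hN
      have h1 := congrFun (congrFun h p) s
      rw [Matrix.sub_apply, Matrix.mul_apply, Matrix.mul_apply,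
        Finset.sum_eq_single s _ (by simp), Finset.sum_eq_single p _ (by simp)] at h1
      · simp only [Matrix.conjTranspose_apply, toep_apply, id, le_refl, and_self, if_true,
          Nat.sub_self, coeff_zero_eq_constantCoeff, Matrix.zero_apply] at h1
        have h2 : H p s * (constantCoeff (f s.1) - conj (constantCoeff (f p.1))) = 0 := by
          rw [← h1]
          simp only [RCLike.star_def]
          ring
        rcases mul_eq_zero.1 h2 with h3 | h3
        · exact h3
        · exact absurd (sub_eq_zero.1 h3) (hf p.1 s.1)
      · rintro ⟨i, b⟩ _ hb
        rw [Matrix.conjTranspose_apply, toep_apply]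
        split_ifs with h2
        · obtain ⟨j, a⟩ := p
          obtain ⟨rfl, h3⟩ := h2
          have h4 : (b : ℕ) ≠ a := fun h4 => hb (by rw [Fin.ext h4])
          simp only [id] at h3
          dsimp only at hN
          rw [ih (b + s.2) (by omega) ⟨i, b⟩ s rfl, mul_zero]
        · simp
      · rintro ⟨i, b⟩ _ hb
        rw [toep_apply]
        split_ifs with h2
        · obtain ⟨j, a⟩ := s
          obtain ⟨rfl, h3⟩ := h2
          have h4 : (b : ℕ) ≠ a := fun h4 => hb (by rw [Fin.ext h4])
          simp only [id] at h3
          dsimp only at hN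
          rw [ih (p.2 + b) (by omega) p ⟨i, b⟩ rfl, zero_mul]
        · simp
  ext p s
  exact key _ p s rfl

theorem sylvester_unique (hf : ∀ i j, constantCoeff (f j) ≠ conj (constantCoeff (f i)))
    {H G : Matrix (Idx n) (Idx n) ℂ}
    (h : H * toep n n id f - (toep n n id f)ᴴ * H = G * toep n n id f - (toep n n id f)ᴴ * G) :
    H = G := by
  refine sub_eq_zero.1 (sylvester_injective hf ?_)
  rw [Matrix.sub_mul, Matrix.mul_sub, sub_sub_sub_comm, h, sub_self]

theorem sylvester_exists (hf : ∀ i j, constantCoeff (f j) ≠ conj (constantCoeff (f i)))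
    (K : Matrix (Idx n) (Idx n) ℂ) :
    ∃ H : Matrix (Idx n) (Idx n) ℂ, H * toep n n id f - (toep n n id f)ᴴ * H = K := by
  let L : Matrix (Idx n) (Idx n) ℂ →ₗ[ℂ] Matrix (Idx n) (Idx n) ℂ :=
    LinearMap.mulRight ℂ (toep n n id f) - LinearMap.mulLeft ℂ (toep n n id f)ᴴ
  have hL : ∀ H, L H = H * toep n n id f - (toep n n id f)ᴴ * H := fun H => rfl
  have hinj : Function.Injective L := by
    rw [← LinearMap.ker_eq_bot, LinearMap.ker_eq_bot']
    intro H hH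
    exact sylvester_injective hf hH
  obtain ⟨H, hH⟩ := LinearMap.injective_iff_surjective.1 hinj K
  exact ⟨H, hH⟩

/-- Conjugate transposition shows that `G†` and `-G` solve the same Sylvester equation, the
right-hand side being Hermitian since `c` is real. -/
theorem sylvester_skew {ρ : Type*} [Fintype ρ]
    (hf : ∀ i j, constantCoeff (f j) ≠ conj (constantCoeff (f i)))
    {G : Matrix (Idx n) (Idx n) ℂ} {Y : Matrix ρ (Idx n) ℂ} {c : ℝ}
    (h : G * toep n n id f - (toep n n id f)ᴴ * G = (c : ℂ) • (Yᴴ * Y)) : Gᴴ = -G := by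
  refine sylvester_unique hf ?_
  have h1 := congrArg Matrix.conjTranspose h
  simp only [Matrix.conjTranspose_sub, Matrix.conjTranspose_mul, Matrix.conjTranspose_conjTranspose,
    Matrix.conjTranspose_smul, RCLike.star_def, Complex.conj_ofReal] at h1
  rw [← h] at h1
  rw [Matrix.neg_mul, Matrix.mul_neg, ← neg_inj, neg_sub, h1]
  abel

/-- Each diagonal block is a single Jordan block, because its superdiagonal entry `coeff 1` is
nonzero, and different blocks have different eigenvalues. -/
theorem toep_eigenvector (hf : ∀ i j, i ≠ j → constantCoeff (f i) ≠ constantCoeff (f j))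
    (hf1 : ∀ i, coeff 1 (f i) ≠ 0) {μ : ℂ} {v : Idx n → ℂ}
    (hv : toep n n id f *ᵥ v = μ • v) {s : Idx n} (hs : v s ≠ 0) :
    (s.2 : ℕ) = 0 ∧ ∀ s', s' ≠ s → v s' = 0 := by
  classical
  have key : ∀ s : Idx n, v s ≠ 0 → (s.2 : ℕ) = 0 ∧ μ = constantCoeff (f s.1) := by
    rintro ⟨i, k⟩ hk
    -- At the last nonzero position `a` of a block, the eigenvalue equation gives `μ`; one row
    -- above, it gives `coeff 1 (f i) * v a = 0`, which is impossible unless `a = 0`.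
    obtain ⟨a, ha, hmax⟩ := Finset.exists_max_image
      (Finset.univ.filter fun a : Fin (n i) => v ⟨i, a⟩ ≠ 0) (fun a => (a : ℕ)) ⟨k, by simpa using hk⟩
    have ha' : v ⟨i, a⟩ ≠ 0 := by simpa using ha
    have hgt : ∀ b : Fin (n i), (a : ℕ) < b → v ⟨i, b⟩ = 0 := by
      intro b hb
      by_contra hne
      exact absurd (hmax b (by simpa using hne)) (by omega)
    have hka : (k : ℕ) ≤ a := hmax k (by simpa using hk)
    have e1 := congrFun hv ⟨i, a⟩
    rw [Matrix.mulVec, dotProduct, Finset.sum_eq_single (⟨i, a⟩ : Idx n) _ (by simp)] at e1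
    · simp only [toep_apply, id, le_refl, and_self, if_true, Nat.sub_self,
        coeff_zero_eq_constantCoeff, Pi.smul_apply, smul_eq_mul] at e1
      have hμ : constantCoeff (f i) = μ := mul_right_cancel₀ ha' e1
      refine ⟨?_, hμ.symm⟩
      by_contra h0
      have h0' : (k : ℕ) ≠ 0 := h0
      have hlt : (a : ℕ) - 1 < n i := by omega
      have hne : (⟨i, ⟨a - 1, hlt⟩⟩ : Idx n) ≠ ⟨i, a⟩ := by
        intro h
        have h' := congrArg (fun q : Idx n => (q.2 : ℕ)) h
        dsimp only at h'
        omega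
      have e2 := congrFun hv ⟨i, ⟨a - 1, hlt⟩⟩
      rw [Matrix.mulVec, dotProduct, Fintype.sum_eq_add _ _ hne] at e2
      · have hsub : (a : ℕ) - (a - 1) = 1 := by omega
        simp only [toep_apply, id, le_refl, and_self, if_true, Nat.sub_self, Nat.sub_le,
          coeff_zero_eq_constantCoeff, Pi.smul_apply, smul_eq_mul, hμ, hsub] at e2
        have e3 : coeff 1 (f i) * v ⟨i, a⟩ = 0 := by linear_combination e2
        rcases mul_eq_zero.1 e3 with h | h
        · exact hf1 i h
        · exact ha' h
      · rintro ⟨j, b⟩ ⟨hb1, hb2⟩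
        rw [toep_apply]
        split_ifs with h
        · obtain ⟨rfl, h3⟩ := h
          simp only [id] at h3
          have n1 : (b : ℕ) ≠ a - 1 := fun h4 => hb1 (by congr 1; exact Fin.ext h4)
          have n2 : (b : ℕ) ≠ a := fun h4 => hb2 (by rw [Fin.ext h4])
          rw [hgt b (by omega), mul_zero]
        · rw [zero_mul]
    · rintro ⟨j, b⟩ _ hb
      rw [toep_apply]
      split_ifs with h
      · obtain ⟨rfl, h3⟩ := h
        simp only [id] at h3
        have n2 : (b : ℕ) ≠ a := fun h4 => hb (by rw [Fin.ext h4])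
        rw [hgt b (by omega), mul_zero]
      · rw [zero_mul]
  refine ⟨(key s hs).1, fun s' hs' => ?_⟩
  by_contra h
  have h1 := key s hs
  have h2 := key s' h
  obtain ⟨i, a⟩ := s
  obtain ⟨j, b⟩ := s'
  by_cases hij : j = i
  · subst hij
    exact hs' (congrArg (Sigma.mk j) (Fin.ext (h2.1.trans h1.1.symm)))
  · exact hf j i hij (h2.2.symm.trans h1.2)

open scoped ComplexOrder in
/-- A solution of the Sylvester equation whose right hand side is an observable Gram matrix is
invertible. -/
theorem sylvester_det_ne_zero {ρ : Type*} [Fintype ρ]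
    (hf : ∀ i j, constantCoeff (f j) ≠ conj (constantCoeff (f i)))
    (hf0 : ∀ i j, i ≠ j → constantCoeff (f i) ≠ constantCoeff (f j))
    (hf1 : ∀ i, coeff 1 (f i) ≠ 0)
    {G : Matrix (Idx n) (Idx n) ℂ} {Y : Matrix ρ (Idx n) ℂ} {c : ℝ} (hc : c ≠ 0)
    (h : G * toep n n id f - (toep n n id f)ᴴ * G = (c : ℂ) • (Yᴴ * Y))
    (hY : ∀ s : Idx n, (s.2 : ℕ) = 0 → ∃ r, Y r s ≠ 0) : G.det ≠ 0 := by
  intro hdet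
  have hskew := sylvester_skew hf h
  set T := toep n n id f with hT
  obtain ⟨v₀, hv₀, hGv₀⟩ := Matrix.exists_mulVec_eq_zero_iff.2 hdet
  -- Skewness gives `v† G = 0` as well, so the quadratic form of the left-hand side vanishes at `v`
  -- and `c ‖Y v‖² = 0`.
  have hkerY : ∀ v, G *ᵥ v = 0 → Y *ᵥ v = 0 := by
    intro v hv
    have h1 : star v ᵥ* G = 0 := by
      have h2 := congrArg star (Matrix.star_mulVec Gᴴ v)
      rw [star_star, Matrix.conjTranspose_conjTranspose] at h2
      rw [← star_eq_zero, ← h2, hskew, Matrix.neg_mulVec, hv, neg_zero]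
    have h2 : star v ⬝ᵥ ((G * T - Tᴴ * G) *ᵥ v) = 0 := by
      rw [Matrix.sub_mulVec, ← Matrix.mulVec_mulVec, ← Matrix.mulVec_mulVec, hv, Matrix.mulVec_zero,
        sub_zero, Matrix.dotProduct_mulVec, h1, zero_dotProduct]
    rw [h, Matrix.smul_mulVec, dotProduct_smul, ← Matrix.mulVec_mulVec, Matrix.dotProduct_mulVec,
      ← Matrix.star_mulVec, smul_eq_mul] at h2
    rcases mul_eq_zero.1 h2 with h3 | h3
    · exact absurd (by exact_mod_cast h3) hc
    · exact dotProduct_star_self_eq_zero.1 h3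
  -- Applying the equation to `v` leaves `G T v = 0`, so a nonzero kernel contains an eigenvector of
  -- `T`, that is, a multiple of the first basis vector of some block. This contradicts `hY`.
  have hinv : ∀ v, G *ᵥ v = 0 → G *ᵥ (T *ᵥ v) = 0 := by
    intro v hv
    have h1 := congrArg (fun A => A *ᵥ v) h
    simp only [Matrix.sub_mulVec, Matrix.smul_mulVec, ← Matrix.mulVec_mulVec, hv, hkerY v hv,
      Matrix.mulVec_zero, smul_zero, sub_zero] at h1
    exact h1
  let W : Submodule ℂ (Idx n → ℂ) := LinearMap.ker G.mulVecLin
  have hW : ∀ v ∈ W, T.mulVecLin v ∈ W := fun v hv => hinv v hv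
  have hnt : Nontrivial W := ⟨⟨v₀, hGv₀⟩, 0, fun h0 => hv₀ (congrArg Subtype.val h0)⟩
  obtain ⟨μ, hμ⟩ := Module.End.exists_eigenvalue (T.mulVecLin.restrict hW)
  obtain ⟨w, hw⟩ := hμ.exists_hasEigenvector
  have hw0 : (w : Idx n → ℂ) ≠ 0 := fun h0 => hw.2 (Subtype.ext h0)
  have hTw : T *ᵥ (w : Idx n → ℂ) = μ • (w : Idx n → ℂ) :=
    congrArg Subtype.val hw.apply_eq_smul
  obtain ⟨s, hs⟩ := Function.ne_iff.1 hw0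
  obtain ⟨hs0, hs'⟩ := toep_eigenvector hf0 hf1 hTw hs
  obtain ⟨r, hr⟩ := hY s hs0
  have h1 := congrFun (hkerY w w.2) r
  rw [Matrix.mulVec, dotProduct, Finset.sum_eq_single s _ (by simp)] at h1
  · exact (mul_ne_zero hr hs) h1
  · intro b _ hb
    rw [hs' b hb, mul_zero]

end Toeplitz

/-! ### Multiplication by a linear polynomial, as a bidiagonal matrix -/

section Linear

variable {n : Fin 2 → ℕ} {ρ : Type*} (G : Matrix ρ (Idx n) ℂ) (c d : Fin 2 → ℂ) (p : ρ)

theorem mul_toep_linear_zero {j : Fin 2} (hk : 0 < n j) :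
    (G * toep n n id (fun i => C (c i) + C (d i) * X)) p ⟨j, ⟨0, hk⟩⟩
      = c j * G p ⟨j, ⟨0, hk⟩⟩ := by
  rw [Matrix.mul_apply, Finset.sum_eq_single (⟨j, ⟨0, hk⟩⟩ : Idx n) _ (by simp)]
  · simp [toep_apply]
    ring
  · rintro ⟨i, b⟩ _ hb
    rw [toep_apply, if_neg, mul_zero]
    rintro ⟨h1, h2⟩
    dsimp only at h1
    subst h1
    exact hb (congrArg (Sigma.mk i) (Fin.ext (Nat.le_zero.1 h2)))

theorem mul_toep_linear_succ {j : Fin 2} {k : ℕ} (hk : k + 1 < n j) :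
    (G * toep n n id (fun i => C (c i) + C (d i) * X)) p ⟨j, ⟨k + 1, hk⟩⟩
      = c j * G p ⟨j, ⟨k + 1, hk⟩⟩ + d j * G p ⟨j, ⟨k, (Nat.lt_succ_self k).trans hk⟩⟩ := by
  have hne : (⟨j, ⟨k + 1, hk⟩⟩ : Idx n) ≠ ⟨j, ⟨k, (Nat.lt_succ_self k).trans hk⟩⟩ := by
    intro h
    have h' := congrArg (fun q : Idx n => (q.2 : ℕ)) h
    dsimp only at h'
    omega
  rw [Matrix.mul_apply, Fintype.sum_eq_add _ _ hne]
  · simp [toep_apply, coeff_C]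
    ring
  · rintro ⟨i, b⟩ ⟨hb1, hb2⟩
    rw [toep_apply]
    split_ifs with h
    · obtain ⟨h1, h2⟩ := h
      dsimp only [id] at h1 h2
      subst h1
      have n1 : (b : ℕ) ≠ k + 1 := fun h4 => hb1 (congrArg (Sigma.mk i) (Fin.ext h4))
      have n2 : (b : ℕ) ≠ k := fun h4 => hb2 (congrArg (Sigma.mk i) (Fin.ext h4))
      have h3 : ∃ e, k + 1 - (b : ℕ) = e + 2 := ⟨k + 1 - b - 2, by omega⟩
      obtain ⟨e, he⟩ := h3
      simp [he]
    · rw [mul_zero]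

end Linear

/-! ## The generating kernel of the block matrix -/

section Kernel

/-- The coefficients of `1 / (w - a x + d y)`. -/
def kern (w a d : ℂ) (m' m : ℕ) : ℂ :=
  (Nat.choose (m + m') m : ℂ) * (a ^ m' * (-d) ^ m / w ^ (m + m' + 1))

/-- The two-variable series `1 / (w - a x + d y)`, as a series in `y` over series in `x`. -/
def kernSeries (w a d : ℂ) : PowerSeries (PowerSeries ℂ) :=
  PowerSeries.mk fun m => PowerSeries.mk fun m' => kern w a d m' m

/-- Coefficientwise this is Pascal's rule. -/
theorem kernSeries_mul {w : ℂ} (hw : w ≠ 0) (a d : ℂ) :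
    (C (C w - C a * X) + C (C d) * X) * kernSeries w a d = 1 := by
  ext m m'
  have hpow : ∀ k, w ^ k ≠ 0 := fun k => pow_ne_zero k hw
  rw [add_mul, map_add, coeff_C_mul, mul_assoc, coeff_C_mul, kernSeries, coeff_mk, map_add, sub_mul,
    map_sub, coeff_C_mul, mul_assoc, coeff_C_mul, coeff_C_mul, coeff_mk, coeff_one]
  rcases m with _ | m <;> rcases m' with _ | m'
  · simp [kern, hw]
  · rw [coeff_succ_X_mul, coeff_mk, if_pos rfl, coeff_one, if_neg (Nat.succ_ne_zero _)]
    simp only [kern, coeff_zero_X_mul, zero_add, Nat.choose_zero_right, map_zero]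
    have := hpow (m' + 1 + 1)
    have := hpow (m' + 1)
    field_simp
    ring
  · rw [coeff_zero_X_mul, coeff_succ_X_mul, coeff_mk, coeff_mk, if_neg (Nat.succ_ne_zero _), map_zero]
    simp only [kern, add_zero, Nat.choose_self]
    have := hpow (m + 1 + 1)
    have := hpow (m + 1)
    field_simp
    ring
  · rw [coeff_succ_X_mul, coeff_succ_X_mul, coeff_mk, coeff_mk, coeff_mk,
      if_neg (Nat.succ_ne_zero _), map_zero]
    simp only [kern]
    rw [show m + 1 + (m' + 1) = (m + m' + 1) + 1 by ring, Nat.choose_succ_succ,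
      show m + 1 + m' = m + m' + 1 by ring, show m + (m' + 1) = m + m' + 1 by ring]
    push_cast
    have h1 : w ^ (m + m' + 1 + 1 + 1) = w ^ (m + m' + 1 + 1) * w := pow_succ _ _
    rw [h1]
    have := hpow (m + m' + 1 + 1)
    field_simp
    ring

/-- The convolution of the kernel with a double sequence. -/
def kernConv (w a d : ℂ) (K : ℕ → ℕ → ℂ) (r t : ℕ) : ℂ :=
  coeff r (coeff t (kernSeries w a d * PowerSeries.mk fun t => PowerSeries.mk fun r => K r t))

theorem kernConv_eq (w a d : ℂ) (K : ℕ → ℕ → ℂ) (r t : ℕ) : kernConv w a d K r t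
    = ∑ mn ∈ Finset.HasAntidiagonal.antidiagonal t, ∑ m' ∈ Finset.range (r + 1),
        kern w a d m' mn.1 * K (r - m') mn.2 := by
  rw [kernConv, coeff_mul, map_sum]
  refine Finset.sum_congr rfl fun mn _ => ?_
  rw [kernSeries, coeff_mk, coeff_mk, coeff_mul]
  simp only [coeff_mk]
  rw [Finset.Nat.sum_antidiagonal_eq_sum_range_succ (fun x y => kern w a d x mn.1 * K y mn.2)]

/-- Reindexing by the total degree `l = m + m'`. With `m + n = t`, the two filter conditions say `m
≤ l ≤ m + r`, that is, `0 ≤ m' ≤ r`. -/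
theorem kernConv_eq_sum (w a d : ℂ) (K : ℕ → ℕ → ℂ) (r t : ℕ) : kernConv w a d K r t
    = ∑ l ∈ Finset.range (r + t + 1), ∑ mn ∈ (Finset.HasAntidiagonal.antidiagonal t).filter
        (fun mn => mn.1 ≤ l ∧ mn.2 ≤ r + t - l),
        (Nat.choose l mn.1 : ℂ) * (a ^ (l - mn.1) * (-d) ^ mn.1 / w ^ (l + 1))
          * K (r + t - l - mn.2) mn.2 := by
  rw [kernConv_eq]
  simp only [Finset.sum_filter]
  conv_rhs => rw [Finset.sum_comm]
  refine Finset.sum_congr rfl fun mn hmn => ?_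
  rw [Finset.HasAntidiagonal.mem_antidiagonal] at hmn
  obtain ⟨m, k⟩ := mn
  dsimp only at hmn ⊢
  symm
  rw [← Finset.sum_subset (s₁ := Finset.Ico m (m + r + 1))]
  · rw [Finset.sum_Ico_eq_sum_range, show m + r + 1 - m = r + 1 by omega]
    refine Finset.sum_congr rfl fun m' hm' => ?_
    rw [Finset.mem_range] at hm'
    rw [if_pos (by omega), kern, show m + m' - m = m' by omega,
      show r + t - (m + m') - k = r - m' by omega]
  · intro l hl
    rw [Finset.mem_Ico] at hl
    rw [Finset.mem_range]
    omega
  · intro l hl hl'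
    rw [Finset.mem_Ico] at hl'
    rw [Finset.mem_range] at hl
    rw [if_neg (by omega)]

/-- Clearing the denominator `w - a x + d y` and comparing coefficients; this is the entrywise form
of the Sylvester equation for `Mmat`. -/
theorem kernConv_rec {w : ℂ} (hw : w ≠ 0) (a d : ℂ) (K : ℕ → ℕ → ℂ) (r t : ℕ) :
    w * kernConv w a d K r t - (if r = 0 then 0 else a * kernConv w a d K (r - 1) t)
      + (if t = 0 then 0 else d * kernConv w a d K r (t - 1)) = K r t := by
  set F := kernSeries w a d * PowerSeries.mk fun t => PowerSeries.mk fun r => K r t with hF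
  have h : (C (C w - C a * X) + C (C d) * X) * F
      = PowerSeries.mk fun t => PowerSeries.mk fun r => K r t := by
    rw [hF, ← mul_assoc, kernSeries_mul hw, one_mul]
  have h1 := congrArg (fun f => coeff r (coeff t f)) h
  simp only [coeff_mk] at h1
  rw [← h1, add_mul, map_add, coeff_C_mul, mul_assoc, coeff_C_mul, map_add, sub_mul,
    map_sub, coeff_C_mul, mul_assoc, coeff_C_mul, coeff_C_mul]
  congr 1
  · congr 1
    rcases r with _ | r
    · rw [if_pos rfl, coeff_zero_X_mul, mul_zero]
    · rw [if_neg (Nat.succ_ne_zero _), coeff_succ_X_mul, Nat.add_sub_cancel]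
      rfl
  · rcases t with _ | t
    · rw [if_pos rfl, coeff_zero_X_mul, map_zero, mul_zero]
    · rw [if_neg (Nat.succ_ne_zero _), coeff_succ_X_mul, Nat.add_sub_cancel]
      rfl

end Kernel

/-! ### The block matrix as solution of a Sylvester equation -/

section Sylvester

variable (a₁ a₂ b₁ : ℝ) (lam chi : Fin 2 → ℂ) (alpha : Fin 2 → ℕ → ℂ) (N : Fin 2 → ℕ) (x t : ℝ)

/-- The matrix of multiplication by the spectral parameter `λ + d ε²`, in the variable `ε²`. -/
def specMat (b₁ : ℝ) (lam chi : Fin 2 → ℂ) (N : Fin 2 → ℕ) : Matrix (Idx N) (Idx N) ℂ :=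
  toep N N id
    (fun i => PowerSeries.C (lam i) + PowerSeries.C (dCoeff b₁ (lam i) (chi i)) * PowerSeries.X)

theorem Mentry_eq (i j : Fin 2) (r t' : ℕ) :
    Mentry a₁ a₂ b₁ lam chi alpha x t i j r t'
      = kernConv (lam j - conj (lam i)) (conj (dCoeff b₁ (lam i) (chi i)))
          (dCoeff b₁ (lam j) (chi j)) (fun r t' =>
            star (Psi a₁ a₂ b₁ (lam i) (chi i) (alpha i) x t r) ⬝ᵥ
            Psi a₁ a₂ b₁ (lam j) (chi j) (alpha j) x t t') r t' := by
  rw [kernConv_eq_sum]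
  rfl

variable {lam}

/-- The entries of `M` are the coefficients of `⟨Ψ_i, Ψ_j⟩ / (λ_j(ε) - conj λ_i(ε'))` in the squared
variables. Multiplication by `λ_j(ε)` acts on the columns and by `conj λ_i(ε')` on the rows, which
removes the denominator and leaves the Gram matrix. -/
theorem Mmat_sylvester (hne : ∀ i j, lam j ≠ conj (lam i)) :
    Mmat a₁ a₂ b₁ lam chi alpha N x t * specMat b₁ lam chi N
      - (specMat b₁ lam chi N)ᴴ * Mmat a₁ a₂ b₁ lam chi alpha N x t
      = (Xmat a₁ a₂ b₁ lam chi alpha N x t)ᴴ * Xmat a₁ a₂ b₁ lam chi alpha N x t := by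
  set M := Mmat a₁ a₂ b₁ lam chi alpha N x t with hM
  -- This turns the row operation into a column operation, so that the bidiagonal product formulas
  -- serve both terms.
  have hSM : (specMat b₁ lam chi N)ᴴ * M = (Mᴴ * specMat b₁ lam chi N)ᴴ := by
    rw [Matrix.conjTranspose_mul, Matrix.conjTranspose_conjTranspose]
  ext ⟨i, r, hr⟩ ⟨j, k, hk⟩
  have hrec := kernConv_rec (sub_ne_zero.2 (hne i j)) (conj (dCoeff b₁ (lam i) (chi i)))
          (dCoeff b₁ (lam j) (chi j)) (fun r t' =>
            star (Psi a₁ a₂ b₁ (lam i) (chi i) (alpha i) x t r) ⬝ᵥ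
            Psi a₁ a₂ b₁ (lam j) (chi j) (alpha j) x t t') r k
  have hR : ((Xmat a₁ a₂ b₁ lam chi alpha N x t)ᴴ * Xmat a₁ a₂ b₁ lam chi alpha N x t)
      ⟨i, r, hr⟩ ⟨j, k, hk⟩ = star (Psi a₁ a₂ b₁ (lam i) (chi i) (alpha i) x t r) ⬝ᵥ
            Psi a₁ a₂ b₁ (lam j) (chi j) (alpha j) x t k := rfl
  have hMe : ∀ r' hr' k' hk', M ⟨i, r', hr'⟩ ⟨j, k', hk'⟩ =
      kernConv (lam j - conj (lam i)) (conj (dCoeff b₁ (lam i) (chi i)))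
          (dCoeff b₁ (lam j) (chi j)) (fun r t' =>
            star (Psi a₁ a₂ b₁ (lam i) (chi i) (alpha i) x t r) ⬝ᵥ
            Psi a₁ a₂ b₁ (lam j) (chi j) (alpha j) x t t') r' k' :=
    fun r' _ k' _ => Mentry_eq a₁ a₂ b₁ lam chi alpha x t i j r' k'
  rw [Matrix.sub_apply, hSM, hR, ← hrec, Matrix.conjTranspose_apply]
  unfold specMat
  rcases r with _ | r <;> rcases k with _ | k <;>
  simp only [mul_toep_linear_zero, mul_toep_linear_succ, Matrix.conjTranspose_apply, hMe, star_add,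
    star_mul', star_star, if_pos, if_neg (Nat.succ_ne_zero _), Nat.add_sub_cancel] <;>
  simp only [RCLike.star_def] <;> ring

end Sylvester

/-! ## The Cauchy matrix -/

/-- Two families of spectral data to which the determinant formula applies. -/
structure SpectralData (a₁ a₂ b₁ : ℝ) (lam chi : Fin 2 → ℂ) : Prop where
  root : ∀ i, IsDoubleRoot a₁ a₂ b₁ (lam i) (chi i)
  three_ne : ∀ i, 3 * chi i - 2 * lam i ≠ 0
  d_ne : ∀ i, dCoeff b₁ (lam i) (chi i) ≠ 0
  lam_ne : ∀ i j, i ≠ j → lam i ≠ lam j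
  lam_ne_conj : ∀ i j, lam j ≠ conj (lam i)

section Cauchy

variable {a₁ a₂ b₁ : ℝ} {lam chi : Fin 2 → ℂ} {n : Fin 2 → ℕ}

theorem SpectralData.chi_ne (h : SpectralData a₁ a₂ b₁ lam chi) (i j : Fin 2) (hij : i ≠ j) :
    chi i ≠ chi j :=
  (h.root i).chi_ne (h.root j) (h.lam_ne i j hij)

theorem SpectralData.chi_ne_conj (h : SpectralData a₁ a₂ b₁ lam chi) (i j : Fin 2) :
    chi j ≠ conj (chi i) :=
  (h.root j).chi_ne (h.root i).star (h.lam_ne_conj i j)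

/-- The matrix of multiplication by `χ(ε)`. -/
def chiMat (b₁ : ℝ) (lam chi : Fin 2 → ℂ) (n : Fin 2 → ℕ) : Matrix (Idx n) (Idx n) ℂ :=
  toep n n id fun i => chiSeries b₁ (lam i) (chi i)

/-- The matrix of multiplication by `χ(ε) + c`. -/
def shiftMat (b₁ : ℝ) (lam chi : Fin 2 → ℂ) (c : ℝ) (n : Fin 2 → ℕ) : Matrix (Idx n) (Idx n) ℂ :=
  toep n n id fun i => chiSeries b₁ (lam i) (chi i) + C (c : ℂ)

/-- The matrix of multiplication by `(χ(ε) + c)⁻¹`. -/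
def resMat (b₁ : ℝ) (lam chi : Fin 2 → ℂ) (c : ℝ) (n : Fin 2 → ℕ) : Matrix (Idx n) (Idx n) ℂ :=
  toep n n id fun i => (chiSeries b₁ (lam i) (chi i) + C (c : ℂ))⁻¹

theorem toep_C (c : ℂ) : toep n n id (fun _ => C c) = c • 1 := by
  rw [← toep_one, ← toep_C_mul]
  simp

theorem shiftMat_eq (c : ℝ) : shiftMat b₁ lam chi c n = chiMat b₁ lam chi n + (c : ℂ) • 1 := by
  rw [shiftMat, toep_add, toep_C, chiMat]

theorem shiftMat_mul_resMat {c : ℝ} (hc : ∀ i, chi i + c ≠ 0) :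
    shiftMat b₁ lam chi c n * resMat b₁ lam chi c n = 1 := by
  rw [shiftMat, resMat, toep_mul (φ := id) (fun _ _ h => h), ← toep_one]
  congr 1
  funext i
  exact PowerSeries.mul_inv_cancel _ (by simpa [constantCoeff_chiSeries] using hc i)

theorem resMat_mul_shiftMat {c : ℝ} (hc : ∀ i, chi i + c ≠ 0) :
    resMat b₁ lam chi c n * shiftMat b₁ lam chi c n = 1 :=
  mul_eq_one_comm.1 (shiftMat_mul_resMat hc)

/-- `H` is a Cauchy matrix: the matrix of coefficients of `2 / (χ_j(ε) - conj χ_i(ε'))`. -/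
def IsCauchy (b₁ : ℝ) (lam chi : Fin 2 → ℂ) (n : Fin 2 → ℕ) (H : Matrix (Idx n) (Idx n) ℂ) : Prop :=
  H * chiMat b₁ lam chi n - (chiMat b₁ lam chi n)ᴴ * H = (2 : ℂ) • ((urow n)ᴴ * urow n)

theorem SpectralData.exists_isCauchy (h : SpectralData a₁ a₂ b₁ lam chi) (n : Fin 2 → ℕ) :
    ∃ H, IsCauchy b₁ lam chi n H :=
  sylvester_exists (f := fun i => chiSeries b₁ (lam i) (chi i))
    (fun i j => by simpa [constantCoeff_chiSeries] using h.chi_ne_conj i j) _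

theorem IsCauchy.skew {H : Matrix (Idx n) (Idx n) ℂ} (hH : IsCauchy b₁ lam chi n H)
    (h : SpectralData a₁ a₂ b₁ lam chi) : Hᴴ = -H :=
  sylvester_skew (f := fun i => chiSeries b₁ (lam i) (chi i)) (Y := urow n) (c := 2)
    (fun i j => by simpa [constantCoeff_chiSeries] using h.chi_ne_conj i j)
    (by rw [Complex.ofReal_ofNat]; exact hH)

theorem IsCauchy.det_ne_zero {H : Matrix (Idx n) (Idx n) ℂ} (hH : IsCauchy b₁ lam chi n H)
    (h : SpectralData a₁ a₂ b₁ lam chi) : H.det ≠ 0 := by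
  refine sylvester_det_ne_zero (f := fun i => chiSeries b₁ (lam i) (chi i)) (Y := urow n) (c := 2)
    (fun i j => by simpa [constantCoeff_chiSeries] using h.chi_ne_conj i j)
    (fun i j hij => by simpa [constantCoeff_chiSeries] using h.chi_ne i j hij)
    (fun i => ?_) two_ne_zero (by rw [Complex.ofReal_ofNat]; exact hH)
    (fun s hs => ⟨(), by simp [urow, hs]⟩)
  rw [chiSeries, coeff_mk, chiCoeff]
  exact one_ne_zero

section Shift

variable {H : Matrix (Idx n) (Idx n) ℂ} {c : ℝ}

theorem IsCauchy.shift (hH : IsCauchy b₁ lam chi n H) :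
    H * shiftMat b₁ lam chi c n - (shiftMat b₁ lam chi c n)ᴴ * H
      = (2 : ℂ) • ((urow n)ᴴ * urow n) := by
  rw [← hH, shiftMat_eq]
  simp only [Matrix.mul_add, Matrix.conjTranspose_add, Matrix.conjTranspose_smul,
    Matrix.conjTranspose_one, Matrix.add_mul, Matrix.mul_smul, Matrix.smul_mul, Matrix.mul_one,
    Matrix.one_mul, RCLike.star_def, Complex.conj_ofReal]
  abel

/-- With `L = J + c`, the Cauchy relation moves `L†` across `H` at the cost of a rank-one term. This
is the source of the corrections `-2 X₁† Y₂` and `-2 X₁† Y₃`. -/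
theorem IsCauchy.conj_shift (hH : IsCauchy b₁ lam chi n H) (hc : ∀ i, chi i + c ≠ 0) :
    (shiftMat b₁ lam chi c n)ᴴ * H * resMat b₁ lam chi c n
      = H - (2 : ℂ) • ((urow n)ᴴ * (urow n * resMat b₁ lam chi c n)) := by
  have h1 : (shiftMat b₁ lam chi c n)ᴴ * H
      = H * shiftMat b₁ lam chi c n - (2 : ℂ) • ((urow n)ᴴ * urow n) := by
    rw [← hH.shift (c := c)]
    abel
  rw [h1, Matrix.sub_mul, Matrix.mul_assoc, shiftMat_mul_resMat hc, Matrix.mul_one,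
    Matrix.smul_mul, Matrix.mul_assoc]

/-- Multiply `conj_shift` on the left by the adjoint of `(J + c)⁻¹`. The sign is opposite to that of
the Cauchy relation and compensates the signs in `two_smul_lamMat`. -/
theorem IsCauchy.resolvent (hH : IsCauchy b₁ lam chi n H) (hc : ∀ i, chi i + c ≠ 0) :
    H * resMat b₁ lam chi c n - (resMat b₁ lam chi c n)ᴴ * H
      = -((2 : ℂ) • ((urow n * resMat b₁ lam chi c n)ᴴ * (urow n * resMat b₁ lam chi c n))) := by
  set V := resMat b₁ lam chi c n
  set L := shiftMat b₁ lam chi c n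
  have hVL : Vᴴ * Lᴴ = 1 := by
    rw [← Matrix.conjTranspose_mul, shiftMat_mul_resMat hc, Matrix.conjTranspose_one]
  have h1 := congrArg (fun A => Vᴴ * A) (hH.conj_shift hc)
  rw [← Matrix.mul_assoc, ← Matrix.mul_assoc, hVL, Matrix.one_mul, Matrix.mul_sub] at h1
  rw [h1, sub_sub_cancel_left, Matrix.mul_smul, Matrix.conjTranspose_mul, Matrix.mul_assoc]

end Shift

/-- The matrix of multiplication by the spectral parameter, in the variable `ε`. -/
def lamMat (b₁ : ℝ) (lam chi : Fin 2 → ℂ) (n : Fin 2 → ℕ) : Matrix (Idx n) (Idx n) ℂ :=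
  toep n n id fun i => lamSeries b₁ (lam i) (chi i)

theorem SpectralData.two_smul_lamMat (h : SpectralData a₁ a₂ b₁ lam chi) :
    (2 : ℂ) • lamMat b₁ lam chi n = chiMat b₁ lam chi n
      - ((a₁ ^ 2 : ℝ) : ℂ) • resMat b₁ lam chi b₁ n
      - ((a₂ ^ 2 : ℝ) : ℂ) • resMat b₁ lam chi (-b₁) n := by
  rw [lamMat, chiMat, resMat, resMat, ← toep_C_mul, ← toep_C_mul, ← toep_C_mul, ← toep_sub,
    ← toep_sub]
  congr 1
  funext i
  have := two_mul_lamSeries (h.root i) (h.three_ne i)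
  rw [map_ofNat, this]
  push_cast
  rw [map_neg, ← sub_eq_add_neg]

theorem SpectralData.add_ne (h : SpectralData a₁ a₂ b₁ lam chi) (i : Fin 2) : chi i + b₁ ≠ 0 :=
  (h.root i).add_ne

theorem SpectralData.sub_ne (h : SpectralData a₁ a₂ b₁ lam chi) (i : Fin 2) :
    chi i + (-b₁ : ℝ) ≠ 0 := by
  rw [Complex.ofReal_neg, ← sub_eq_add_neg]
  exact (h.root i).sub_ne

/-- Combine the Cauchy relation and its two resolvent forms with the coefficients `1, -a₁², -a₂²` of
the partial fractions for `2λ`. The result is the Gram matrix of the three components of the wave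
function. -/
theorem IsCauchy.spectral {H : Matrix (Idx n) (Idx n) ℂ} (hH : IsCauchy b₁ lam chi n H)
    (h : SpectralData a₁ a₂ b₁ lam chi) :
    H * lamMat b₁ lam chi n - (lamMat b₁ lam chi n)ᴴ * H
      = (urow n)ᴴ * urow n
        + ((a₁ ^ 2 : ℝ) : ℂ) • ((urow n * resMat b₁ lam chi b₁ n)ᴴ
            * (urow n * resMat b₁ lam chi b₁ n))
        + ((a₂ ^ 2 : ℝ) : ℂ) • ((urow n * resMat b₁ lam chi (-b₁) n)ᴴ
            * (urow n * resMat b₁ lam chi (-b₁) n)) := by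
  have h0 := hH
  have h1 := hH.resolvent h.add_ne
  have h2 := hH.resolvent h.sub_ne
  unfold IsCauchy at h0
  have e := h.two_smul_lamMat (n := n)
  have e' := congrArg Matrix.conjTranspose e
  simp only [Matrix.conjTranspose_sub, Matrix.conjTranspose_smul, RCLike.star_def,
    Complex.conj_ofReal, map_ofNat] at e'
  apply smul_right_injective _ (two_ne_zero (α := ℂ))
  simp only []
  rw [smul_sub, ← Matrix.mul_smul, ← Matrix.smul_mul, e, e']
  simp only [Matrix.mul_sub, Matrix.sub_mul, Matrix.mul_smul, Matrix.smul_mul]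
  generalize H * chiMat b₁ lam chi n = P at *
  generalize (chiMat b₁ lam chi n)ᴴ * H = P' at *
  generalize H * resMat b₁ lam chi b₁ n = Q at *
  generalize (resMat b₁ lam chi b₁ n)ᴴ * H = Q' at *
  generalize H * resMat b₁ lam chi (-b₁) n = R at *
  generalize (resMat b₁ lam chi (-b₁) n)ᴴ * H = R' at *
  rw [sub_eq_iff_eq_add] at h0 h1 h2
  rw [h0, h1, h2]
  module

end Cauchy

/-! ## Factorization of the block matrices -/

section Factor

variable {a₁ a₂ b₁ : ℝ} {lam chi : Fin 2 → ℂ} {N : Fin 2 → ℕ} {E : Fin 2 → PowerSeries ℂ}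

/-- The matrix which extracts the odd coefficients of `f(ε) E(ε)` from the coefficients of `f`. -/
def oddMat (N : Fin 2 → ℕ) (E : Fin 2 → PowerSeries ℂ) :
    Matrix (Idx fun i => 2 * N i) (Idx N) ℂ :=
  toep (fun i => 2 * N i) N (fun k => 2 * k + 1) E

theorem toep_mul_oddMat (f : Fin 2 → PowerSeries ℂ) :
    toep (fun i => 2 * N i) (fun i => 2 * N i) id f * oddMat N E
      = oddMat N fun i => f i * E i :=
  toep_mul fun i k hk => by omega

theorem urow_mul_oddMat (r : Unit) (s : Idx N) :
    (urow (fun i => 2 * N i) * oddMat N E) r s = coeff (2 * s.2 + 1) (E s.1) :=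
  urow_mul_toep (fun i k hk => by
    omega) r s

/-- Since `λ + d ε²` is even, multiplying by it commutes with extracting odd coefficients. It
thereby intertwines the action in the variable `ε²` on blocks of size `N i` with the action in `ε`
on blocks of size `2 N i`. -/
theorem oddMat_mul_specMat :
    oddMat N E * specMat b₁ lam chi N
      = lamMat b₁ lam chi (fun i => 2 * N i) * oddMat N E := by
  rw [lamMat, toep_mul_oddMat]
  ext p ⟨j, k, hk⟩
  have hR : lamSeries b₁ (lam j) (chi j) * E j
      = C (lam j) * E j + C (dCoeff b₁ (lam j) (chi j)) * (X ^ 2 * E j) := by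
    rw [lamSeries]
    ring
  unfold specMat
  rcases k with _ | k
  · rw [mul_toep_linear_zero, oddMat, oddMat, toep_apply, toep_apply]
    dsimp only
    split_ifs with h
    · rw [hR, map_add, coeff_C_mul, coeff_C_mul, coeff_X_pow_mul', if_neg (by omega)]
      ring
    · rw [mul_zero]
  · rw [mul_toep_linear_succ, oddMat, oddMat, toep_apply, toep_apply, toep_apply]
    dsimp only
    by_cases h : p.1 = j ∧ (p.2 : ℕ) ≤ 2 * (k + 1) + 1
    · rw [if_pos h, if_pos h, hR, map_add, coeff_C_mul, coeff_C_mul, coeff_X_pow_mul']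
      by_cases h' : (p.2 : ℕ) ≤ 2 * k + 1
      · rw [if_pos ⟨h.1, h'⟩, if_pos (by omega),
          show 2 * (k + 1) + 1 - (p.2 : ℕ) - 2 = 2 * k + 1 - p.2 by omega]
      · rw [if_neg (fun h2 => h' h2.2), if_neg (by omega)]
    · rw [if_neg h, if_neg h, if_neg (fun h2 => h ⟨h2.1, by omega⟩)]
      ring

variable (a₁ a₂ b₁ lam chi) (alpha : Fin 2 → ℕ → ℂ) (N) (x t : ℝ)

/-- The scalar factor `exp (ε α(ε)) exp (∑_{k ≥ 1} X^{[k]} ε^k)` of the wave functions. -/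
def waveSeries (i : Fin 2) : PowerSeries ℂ :=
  expSeries (epsAlphaSeries (alpha i)) * schurSeries b₁ (lam i) (chi i) x t

theorem Xmat_zero (s : Idx N) : Xmat a₁ a₂ b₁ lam chi alpha N x t 0 s
    = (urow (fun i => 2 * N i) * oddMat N (waveSeries b₁ lam chi alpha x t)) () s := by
  rw [urow_mul_oddMat]
  simp [Xmat, Psi, gauge, phiSeries, waveSeries]

theorem Xmat_one (s : Idx N) : Xmat a₁ a₂ b₁ lam chi alpha N x t 1 s
    = Complex.exp (theta a₁ a₂ b₁ x t) * (a₁ * (urow (fun i => 2 * N i)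
      * (resMat b₁ lam chi b₁ (fun i => 2 * N i)
        * oddMat N (waveSeries b₁ lam chi alpha x t))) () s) := by
  rw [resMat, toep_mul_oddMat, urow_mul_oddMat, ← coeff_C_mul]
  simp only [Xmat, Psi, gauge, phiSeries, waveSeries, Matrix.of_apply, Matrix.cons_val_one,
    Matrix.cons_val_zero]
  congr 2
  ring

theorem Xmat_two (s : Idx N) : Xmat a₁ a₂ b₁ lam chi alpha N x t 2 s
    = Complex.exp (theta a₁ a₂ (-b₁) x t) * (a₂ * (urow (fun i => 2 * N i)
      * (resMat b₁ lam chi (-b₁) (fun i => 2 * N i)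
        * oddMat N (waveSeries b₁ lam chi alpha x t))) () s) := by
  rw [resMat, toep_mul_oddMat, urow_mul_oddMat, ← coeff_C_mul]
  simp only [Xmat, Psi, gauge, phiSeries, waveSeries, Matrix.of_apply, Matrix.cons_val]
  congr 2
  rw [Complex.ofReal_neg, map_neg, ← sub_eq_add_neg]
  ring

theorem conj_exp_theta_mul (b : ℝ) :
    conj (Complex.exp (theta a₁ a₂ b x t)) * Complex.exp (theta a₁ a₂ b x t) = 1 := by
  rw [← Complex.exp_conj, ← Complex.exp_add, theta, map_mul, Complex.conj_I, Complex.conj_ofReal]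
  simp

variable {a₁ a₂ b₁ lam chi N}

/-- The phases `exp θ_j` are unimodular and disappear from the Gram matrix, leaving the right-hand
side of `IsCauchy.spectral` compressed by `oddMat`. -/
theorem Xmat_gram : (Xmat a₁ a₂ b₁ lam chi alpha N x t)ᴴ * Xmat a₁ a₂ b₁ lam chi alpha N x t
    = (oddMat N (waveSeries b₁ lam chi alpha x t))ᴴ
      * ((urow (fun i => 2 * N i))ᴴ * urow (fun i => 2 * N i)
        + ((a₁ ^ 2 : ℝ) : ℂ) • ((urow (fun i => 2 * N i) * resMat b₁ lam chi b₁ (fun i => 2 * N i))ᴴ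
            * (urow (fun i => 2 * N i) * resMat b₁ lam chi b₁ (fun i => 2 * N i)))
        + ((a₂ ^ 2 : ℝ) : ℂ) • ((urow (fun i => 2 * N i) * resMat b₁ lam chi (-b₁) (fun i => 2 * N i))ᴴ
            * (urow (fun i => 2 * N i) * resMat b₁ lam chi (-b₁) (fun i => 2 * N i))))
      * oddMat N (waveSeries b₁ lam chi alpha x t) := by
  have hx0 := Xmat_zero a₁ a₂ b₁ lam chi N alpha x t
  have hx1 := Xmat_one a₁ a₂ b₁ lam chi N alpha x t
  have hx2 := Xmat_two a₁ a₂ b₁ lam chi N alpha x t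
  set B := oddMat N (waveSeries b₁ lam chi alpha x t)
  have e : ∀ (u : Matrix Unit (Idx fun i => 2 * N i) ℂ), Bᴴ * (uᴴ * u) * B = (u * B)ᴴ * (u * B) := by
    intro u
    rw [Matrix.conjTranspose_mul]
    simp only [Matrix.mul_assoc]
  rw [Matrix.mul_add, Matrix.mul_add, Matrix.add_mul, Matrix.add_mul, Matrix.mul_smul,
    Matrix.mul_smul, Matrix.smul_mul, Matrix.smul_mul, e, e, e, Matrix.mul_assoc (urow _),
    Matrix.mul_assoc (urow _)]
  ext p s
  simp only [Matrix.add_apply, Matrix.smul_apply, Matrix.mul_apply (M := _ᴴ),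
    Matrix.conjTranspose_apply, Fin.sum_univ_three, hx0, hx1, hx2, Finset.univ_unique,
    Finset.sum_singleton, RCLike.star_def, map_mul, Complex.conj_ofReal, smul_eq_mul]
  have g1 := conj_exp_theta_mul a₁ a₂ x t b₁
  have g2 := conj_exp_theta_mul a₁ a₂ x t (-b₁)
  push_cast
  simp only [PUnit.default_eq_unit]
  generalize (urow (fun i => 2 * N i) * (resMat b₁ lam chi b₁ (fun i => 2 * N i) * B)) () s = v1
  generalize conj ((urow (fun i => 2 * N i)
    * (resMat b₁ lam chi b₁ (fun i => 2 * N i) * B)) () p) = w1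
  generalize (urow (fun i => 2 * N i) * (resMat b₁ lam chi (-b₁) (fun i => 2 * N i) * B)) () s = v2
  generalize conj ((urow (fun i => 2 * N i)
    * (resMat b₁ lam chi (-b₁) (fun i => 2 * N i) * B)) () p) = w2
  linear_combination (a₁ : ℂ) ^ 2 * w1 * v1 * g1 + (a₂ : ℂ) ^ 2 * w2 * v2 * g2

variable {H : Matrix (Idx fun i => 2 * N i) (Idx fun i => 2 * N i) ℂ}

variable (b₁ lam chi H) in
/-- The Sylvester equation for a compression. -/
theorem compress_sylvester (E : Fin 2 → PowerSeries ℂ) :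
    ((oddMat N E)ᴴ * H * oddMat N E) * specMat b₁ lam chi N
      - (specMat b₁ lam chi N)ᴴ * ((oddMat N E)ᴴ * H * oddMat N E)
      = (oddMat N E)ᴴ * (H * lamMat b₁ lam chi (fun i => 2 * N i)
        - (lamMat b₁ lam chi (fun i => 2 * N i))ᴴ * H) * oddMat N E := by
  have hS := oddMat_mul_specMat (b₁ := b₁) (lam := lam) (chi := chi) (N := N) (E := E)
  have hS' : (specMat b₁ lam chi N)ᴴ * (oddMat N E)ᴴ
      = (oddMat N E)ᴴ * (lamMat b₁ lam chi (fun i => 2 * N i))ᴴ := by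
    rw [← Matrix.conjTranspose_mul, hS, Matrix.conjTranspose_mul]
  rw [Matrix.mul_sub, Matrix.sub_mul, Matrix.mul_assoc _ _ (specMat b₁ lam chi N), hS,
    ← Matrix.mul_assoc (specMat b₁ lam chi N)ᴴ, ← Matrix.mul_assoc (specMat b₁ lam chi N)ᴴ, hS']
  simp only [Matrix.mul_assoc]

theorem constantCoeff_spec (i : Fin 2) : constantCoeff
    (C (lam i) + C (dCoeff b₁ (lam i) (chi i)) * X : PowerSeries ℂ) = lam i := by
  simp

/-- Both sides solve the same uniquely solvable Sylvester equation. -/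
theorem Mmat_eq (h : SpectralData a₁ a₂ b₁ lam chi)
    (hH : IsCauchy b₁ lam chi (fun i => 2 * N i) H) :
    Mmat a₁ a₂ b₁ lam chi alpha N x t
      = (oddMat N (waveSeries b₁ lam chi alpha x t))ᴴ * H
        * oddMat N (waveSeries b₁ lam chi alpha x t) := by
  refine sylvester_unique (f := fun i => C (lam i) + C (dCoeff b₁ (lam i) (chi i)) * X)
    (fun i j => ?_) ?_
  · rw [constantCoeff_spec, constantCoeff_spec]
    exact h.lam_ne_conj i j
  · have h1 := Mmat_sylvester a₁ a₂ b₁ chi alpha N x t h.lam_ne_conj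
    have h2 := compress_sylvester b₁ lam chi H (waveSeries b₁ lam chi alpha x t)
    rw [hH.spectral h, ← Xmat_gram] at h2
    exact h1.trans h2.symm

theorem Mmat_skew (h : SpectralData a₁ a₂ b₁ lam chi) :
    (Mmat a₁ a₂ b₁ lam chi alpha N x t)ᴴ = -Mmat a₁ a₂ b₁ lam chi alpha N x t := by
  refine sylvester_skew (f := fun i => C (lam i) + C (dCoeff b₁ (lam i) (chi i)) * X)
    (Y := Xmat a₁ a₂ b₁ lam chi alpha N x t) (c := 1) (fun i j => ?_) ?_
  · rw [constantCoeff_spec, constantCoeff_spec]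
    exact h.lam_ne_conj i j
  · rw [Complex.ofReal_one, one_smul]
    exact Mmat_sylvester a₁ a₂ b₁ chi alpha N x t h.lam_ne_conj

theorem M1mat_eq (h : SpectralData a₁ a₂ b₁ lam chi)
    (hH : IsCauchy b₁ lam chi (fun i => 2 * N i) H) :
    M1mat a₁ a₂ b₁ lam chi alpha N x t
      = (oddMat N (waveSeries b₁ lam chi alpha x t))ᴴ
        * ((shiftMat b₁ lam chi b₁ (fun i => 2 * N i))ᴴ * H
          * resMat b₁ lam chi b₁ (fun i => 2 * N i))
        * oddMat N (waveSeries b₁ lam chi alpha x t) := by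
  rw [hH.conj_shift h.add_ne, M1mat, Mmat_eq alpha x t h hH, Matrix.mul_sub, Matrix.sub_mul,
    Matrix.mul_smul, Matrix.smul_mul, ← Matrix.mul_assoc _ (urow _)ᴴ, ← Matrix.conjTranspose_mul,
    Matrix.mul_assoc _ (urow _ * _) (oddMat _ _), Matrix.mul_assoc (urow _) _ (oddMat _ _)]
  congr 2
  ext p s
  have ha : (a₁ : ℂ) ≠ 0 := by exact_mod_cast (h.root 0).a₁_ne
  rw [Matrix.vecMulVec_apply, Matrix.mul_apply (M := _ᴴ), Y2, Xmat_one, Pi.star_apply, Xmat_zero]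
  simp only [Finset.univ_unique, Finset.sum_singleton, Matrix.conjTranspose_apply,
    PUnit.default_eq_unit]
  congr 1
  rw [Complex.exp_neg]
  have := Complex.exp_ne_zero (theta a₁ a₂ b₁ x t)
  field_simp

theorem M2mat_eq (h : SpectralData a₁ a₂ b₁ lam chi)
    (hH : IsCauchy b₁ lam chi (fun i => 2 * N i) H) :
    M2mat a₁ a₂ b₁ lam chi alpha N x t
      = (oddMat N (waveSeries b₁ lam chi alpha x t))ᴴ
        * ((shiftMat b₁ lam chi (-b₁) (fun i => 2 * N i))ᴴ * H
          * resMat b₁ lam chi (-b₁) (fun i => 2 * N i))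
        * oddMat N (waveSeries b₁ lam chi alpha x t) := by
  rw [hH.conj_shift h.sub_ne, M2mat, Mmat_eq alpha x t h hH, Matrix.mul_sub, Matrix.sub_mul,
    Matrix.mul_smul, Matrix.smul_mul, ← Matrix.mul_assoc _ (urow _)ᴴ, ← Matrix.conjTranspose_mul,
    Matrix.mul_assoc _ (urow _ * _) (oddMat _ _), Matrix.mul_assoc (urow _) _ (oddMat _ _)]
  congr 2
  ext p s
  have ha : (a₂ : ℂ) ≠ 0 := by exact_mod_cast (h.root 0).a₂_ne
  rw [Matrix.vecMulVec_apply, Matrix.mul_apply (M := _ᴴ), Y3, Xmat_two, Pi.star_apply, Xmat_zero]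
  simp only [Finset.univ_unique, Finset.sum_singleton, Matrix.conjTranspose_apply,
    PUnit.default_eq_unit]
  congr 1
  rw [Complex.exp_neg]
  have := Complex.exp_ne_zero (theta a₁ a₂ (-b₁) x t)
  field_simp

end Factor

/-! ## Non-degeneracy of the block matrix -/

section Nondegenerate

variable {a₁ a₂ b₁ : ℝ} {lam chi : Fin 2 → ℂ} {N : Fin 2 → ℕ} (alpha : Fin 2 → ℕ → ℂ) (x t : ℝ)

theorem constantCoeff_epsAlphaSeries (a : ℕ → ℂ) : constantCoeff (epsAlphaSeries a) = 0 := by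
  rw [← coeff_zero_eq_constantCoeff_apply, epsAlphaSeries, coeff_mk]
  simp

theorem constantCoeff_waveSeries (i : Fin 2) :
    constantCoeff (waveSeries b₁ lam chi alpha x t i) = 1 := by
  rw [waveSeries, map_mul, constantCoeff_expSeries (constantCoeff_epsAlphaSeries _), schurSeries,
    constantCoeff_expSeries, one_mul]
  rw [← coeff_zero_eq_constantCoeff_apply, coeff_mk, if_pos rfl]

/-- If the first two entries vanished, the linear coefficients of `E` and of `(χ(ε) + b₁)⁻¹ E` would
be zero, where `E` has constant term 1. Then `(χ(ε) + b₁)⁻¹` would have no linear term, contrary to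
`χ^{[1]} = 1`. -/
theorem Xmat_col_ne_zero (h : SpectralData a₁ a₂ b₁ lam chi) (s : Idx N) (hs : (s.2 : ℕ) = 0) :
    ∃ r, Xmat a₁ a₂ b₁ lam chi alpha N x t r s ≠ 0 := by
  by_contra! hX
  have h0 := hX 0
  have h1 := hX 1
  rw [Xmat_zero, urow_mul_oddMat, hs] at h0
  rw [Xmat_one, resMat, toep_mul_oddMat, urow_mul_oddMat, hs] at h1
  have ha : (a₁ : ℂ) ≠ 0 := by exact_mod_cast (h.root 0).a₁_ne
  simp only [mul_eq_zero, Complex.exp_ne_zero, ha, false_or, mul_zero, zero_add] at h0 h1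
  rw [coeff_one_mul', h0, mul_zero, zero_add, coeff_zero_eq_constantCoeff_apply,
    constantCoeff_waveSeries, mul_one] at h1
  have hc := constantCoeff_add_ne (h.root s.1)
  have hinv := PowerSeries.mul_inv_cancel _ hc
  have e0 := congrArg constantCoeff hinv
  have e1 := congrArg (coeff 1) hinv
  rw [coeff_one_mul', h1, mul_zero, zero_add, map_add, chiSeries, coeff_mk, chiCoeff, coeff_C,
    if_neg one_ne_zero, add_zero, one_mul, coeff_one, if_neg one_ne_zero,
    coeff_zero_eq_constantCoeff_apply, ← chiSeries] at e1
  rw [map_mul, e1, mul_zero, map_one] at e0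
  exact zero_ne_one e0

theorem Mmat_det_ne_zero (h : SpectralData a₁ a₂ b₁ lam chi) :
    (Mmat a₁ a₂ b₁ lam chi alpha N x t).det ≠ 0 := by
  refine sylvester_det_ne_zero (f := fun i => C (lam i) + C (dCoeff b₁ (lam i) (chi i)) * X)
    (Y := Xmat a₁ a₂ b₁ lam chi alpha N x t) (c := 1) (fun i j => ?_) (fun i j hij => ?_)
    (fun i => ?_) one_ne_zero ?_ (Xmat_col_ne_zero alpha x t h)
  · rw [constantCoeff_spec, constantCoeff_spec]
    exact h.lam_ne_conj i j
  · rw [constantCoeff_spec, constantCoeff_spec]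
    exact h.lam_ne i j hij
  · simpa [coeff_C] using h.d_ne i
  · rw [Complex.ofReal_one, one_smul]
    exact Mmat_sylvester a₁ a₂ b₁ chi alpha N x t h.lam_ne_conj

end Nondegenerate

/-! ## The potential -/

section Potential

/-- The matrix determinant lemma; it turns the quotients of determinants into entries of `P` and
into brackets. -/
theorem det_sub_smul_vecMulVec {ι : Type*} [Fintype ι] [DecidableEq ι] {M : Matrix ι ι ℂ}
    (hM : M.det ≠ 0) (c : ℂ) (v w : ι → ℂ) :
    (M - c • Matrix.vecMulVec v w).det = M.det * (1 - c * (w ⬝ᵥ M⁻¹ *ᵥ v)) := by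
  have hu : IsUnit M.det := isUnit_iff_ne_zero.2 hM
  have h1 : M - c • Matrix.vecMulVec v w = M * (1 - Matrix.replicateCol Unit (c • (M⁻¹ *ᵥ v))
      * Matrix.replicateRow Unit w) := by
    rw [Matrix.mul_sub, Matrix.mul_one, ← Matrix.mul_assoc, ← Matrix.replicateCol_mulVec,
      Matrix.mulVec_smul, Matrix.mulVec_mulVec, Matrix.mul_nonsing_inv _ hu, Matrix.one_mulVec,
      ← Matrix.vecMulVec_eq, Matrix.smul_vecMulVec]
  rw [h1, Matrix.det_mul, Matrix.det_one_sub_mul_comm, Matrix.det_unique (1 - _ * _)]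
  simp only [Matrix.sub_apply, Matrix.one_apply_eq, Matrix.mul_apply, dotProduct, Finset.mul_sum,
    Matrix.replicateRow_apply, Matrix.replicateCol_apply, Pi.smul_apply, smul_eq_mul]
  congr 2
  refine Finset.sum_congr rfl fun i _ => ?_
  ring

variable {a₁ a₂ b₁ : ℝ} {lam chi : Fin 2 → ℂ} {N : Fin 2 → ℕ} (alpha : Fin 2 → ℕ → ℂ) (x t : ℝ)

theorem Pmat_apply_zero (r : Fin 3) : Pmat a₁ a₂ b₁ lam chi alpha N x t r 0
    = -((fun s => Xmat a₁ a₂ b₁ lam chi alpha N x t r s) ⬝ᵥ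
      (Mmat a₁ a₂ b₁ lam chi alpha N x t)⁻¹ *ᵥ star (Xmat a₁ a₂ b₁ lam chi alpha N x t 0)) := by
  rw [Pmat, Matrix.neg_apply, Matrix.mul_assoc, Matrix.mul_apply]
  rfl

theorem q1N_eq (h : SpectralData a₁ a₂ b₁ lam chi) : q1N a₁ a₂ b₁ lam chi alpha N x t
    = a₁ * Complex.exp (theta a₁ a₂ b₁ x t) + 2 * Pmat a₁ a₂ b₁ lam chi alpha N x t 1 0 := by
  have hM := Mmat_det_ne_zero (N := N) alpha x t h
  have ha : (a₁ : ℂ) ≠ 0 := by exact_mod_cast (h.root 0).a₁_ne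
  have hY : (fun s => Xmat a₁ a₂ b₁ lam chi alpha N x t 1 s)
      = (a₁ * Complex.exp (theta a₁ a₂ b₁ x t)) • Y2 a₁ a₂ b₁ lam chi alpha N x t := by
    funext s
    rw [Pi.smul_apply, smul_eq_mul, Y2, Complex.exp_neg]
    have := Complex.exp_ne_zero (theta a₁ a₂ b₁ x t)
    field_simp
  rw [q1N, M1mat, det_sub_smul_vecMulVec hM, mul_div_cancel_left₀ _ hM, Pmat_apply_zero, hY,
    smul_dotProduct, smul_eq_mul]
  ring

theorem q2N_eq (h : SpectralData a₁ a₂ b₁ lam chi) : q2N a₁ a₂ b₁ lam chi alpha N x t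
    = a₂ * Complex.exp (theta a₁ a₂ (-b₁) x t) + 2 * Pmat a₁ a₂ b₁ lam chi alpha N x t 2 0 := by
  have hM := Mmat_det_ne_zero (N := N) alpha x t h
  have ha : (a₂ : ℂ) ≠ 0 := by exact_mod_cast (h.root 0).a₂_ne
  have hY : (fun s => Xmat a₁ a₂ b₁ lam chi alpha N x t 2 s)
      = (a₂ * Complex.exp (theta a₁ a₂ (-b₁) x t)) • Y3 a₁ a₂ b₁ lam chi alpha N x t := by
    funext s
    rw [Pi.smul_apply, smul_eq_mul, Y3, Complex.exp_neg]
    have := Complex.exp_ne_zero (theta a₁ a₂ (-b₁) x t)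
    field_simp
  rw [q2N, M2mat, det_sub_smul_vecMulVec hM, mul_div_cancel_left₀ _ hM, Pmat_apply_zero, hY,
    smul_dotProduct, smul_eq_mul]
  ring

theorem inv_neg_of_det_ne_zero {ι : Type*} [Fintype ι] [DecidableEq ι] {M : Matrix ι ι ℂ}
    (hM : M.det ≠ 0) : (-M)⁻¹ = -M⁻¹ :=
  Matrix.inv_eq_right_inv (by
    rw [neg_mul_neg, Matrix.mul_nonsing_inv _ (isUnit_iff_ne_zero.2 hM)])

theorem Pmat_skew (h : SpectralData a₁ a₂ b₁ lam chi) (r s : Fin 3) :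
    Pmat a₁ a₂ b₁ lam chi alpha N x t r s
      = -conj (Pmat a₁ a₂ b₁ lam chi alpha N x t s r) := by
  have hP : (Pmat a₁ a₂ b₁ lam chi alpha N x t)ᴴ = -Pmat a₁ a₂ b₁ lam chi alpha N x t := by
    rw [Pmat, Matrix.conjTranspose_neg, Matrix.conjTranspose_mul, Matrix.conjTranspose_mul,
      Matrix.conjTranspose_conjTranspose, Matrix.conjTranspose_nonsing_inv,
      Mmat_skew alpha x t h, inv_neg_of_det_ne_zero (Mmat_det_ne_zero alpha x t h),
      Matrix.mul_assoc]
    simp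
  have h1 := congrFun (congrFun hP r) s
  rw [Matrix.conjTranspose_apply, Matrix.neg_apply] at h1
  rw [← neg_eq_iff_eq_neg, ← h1]
  rfl

theorem potential_eq (h : SpectralData a₁ a₂ b₁ lam chi) :
    potential (q1N a₁ a₂ b₁ lam chi alpha N x t) (q2N a₁ a₂ b₁ lam chi alpha N x t)
      = potential (a₁ * Complex.exp (theta a₁ a₂ b₁ x t))
          (a₂ * Complex.exp (theta a₁ a₂ (-b₁) x t))
        + Complex.I • (Pmat a₁ a₂ b₁ lam chi alpha N x t * sigma3
            - sigma3 * Pmat a₁ a₂ b₁ lam chi alpha N x t) := by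
  have h01 := Pmat_skew (N := N) alpha x t h 0 1
  have h02 := Pmat_skew (N := N) alpha x t h 0 2
  rw [q1N_eq alpha x t h, q2N_eq alpha x t h]
  ext r s
  fin_cases r <;> fin_cases s <;>
    simp [potential, sigma3, Matrix.mul_diagonal, Matrix.diagonal_mul, h01, h02, map_ofNat] <;> ring

end Potential

/-! ## Entrywise differentiation of matrix functions -/

section Calculus

variable {l m n : Type*}

/-- Entrywise derivative of a matrix-valued function of a real variable. -/
def HasMDeriv (A : ℝ → Matrix m n ℂ) (A' : Matrix m n ℂ) (s : ℝ) : Prop :=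
  ∀ i j, HasDerivAt (fun s => A s i j) (A' i j) s

theorem HasMDeriv.mul [Fintype m] {A : ℝ → Matrix l m ℂ} {A' : Matrix l m ℂ}
    {B : ℝ → Matrix m n ℂ} {B' : Matrix m n ℂ} {s : ℝ} (hA : HasMDeriv A A' s)
    (hB : HasMDeriv B B' s) : HasMDeriv (fun s => A s * B s) (A' * B s + A s * B') s := by
  intro i j
  simp only [Matrix.mul_apply, Matrix.add_apply, ← Finset.sum_add_distrib]
  exact HasDerivAt.fun_sum fun k _ => (hA i k).mul (hB k j)

theorem HasMDeriv.const_mul [Fintype m] (A : Matrix l m ℂ)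
    {B : ℝ → Matrix m n ℂ} {B' : Matrix m n ℂ} {s : ℝ}
    (hB : HasMDeriv B B' s) : HasMDeriv (fun s => A * B s) (A * B') s := by
  intro i j
  simp only [Matrix.mul_apply]
  exact HasDerivAt.fun_sum fun k _ => (hB k j).const_mul _

theorem HasMDeriv.conjTranspose {A : ℝ → Matrix m n ℂ} {A' : Matrix m n ℂ} {s : ℝ}
    (hA : HasMDeriv A A' s) : HasMDeriv (fun s => (A s)ᴴ) A'ᴴ s :=
  fun i j => (hA j i).star

theorem differentiableAt_det [Fintype n] [DecidableEq n] {A : ℝ → Matrix n n ℂ} {s : ℝ}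
    (hA : ∀ i j, DifferentiableAt ℝ (fun s => A s i j) s) :
    DifferentiableAt ℝ (fun s => (A s).det) s := by
  simp only [Matrix.det_apply']
  refine DifferentiableAt.fun_sum fun σ _ => ?_
  exact (differentiableAt_const _).mul (DifferentiableAt.fun_finsetProd fun i _ => hA _ _)

/-- Differentiability comes from the adjugate formula; the value of the derivative then follows by
differentiating `A A⁻¹ = 1`. -/
theorem HasMDeriv.inv [Fintype n] [DecidableEq n] {A : ℝ → Matrix n n ℂ} {A' : Matrix n n ℂ}
    {s : ℝ} (hA : HasMDeriv A A' s) (hdet : ∀ s, (A s).det ≠ 0) :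
    HasMDeriv (fun s => (A s)⁻¹) (-((A s)⁻¹ * A' * (A s)⁻¹)) s := by
  have hd : ∀ i j, DifferentiableAt ℝ (fun s => (A s)⁻¹ i j) s := by
    intro i j
    simp only [Matrix.inv_def, Matrix.smul_apply, Ring.inverse_eq_inv', smul_eq_mul,
      Matrix.adjugate_apply]
    refine ((differentiableAt_det fun i j => (hA i j).differentiableAt).fun_inv (hdet s)).mul ?_
    refine differentiableAt_det fun k l => ?_
    by_cases hk : k = j
    · subst hk
      simp
    · simp only [Matrix.updateRow_ne hk]
      exact (hA k l).differentiableAt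
  set R' : Matrix n n ℂ := Matrix.of fun i j => deriv (fun s => (A s)⁻¹ i j) s with hR'
  have hR : HasMDeriv (fun s => (A s)⁻¹) R' s := fun i j => (hd i j).hasDerivAt
  have h1 := hA.mul hR
  have h2 : A' * (A s)⁻¹ + A s * R' = 0 := by
    ext i j
    refine (h1 i j).unique ?_
    have h3 : (fun s => (A s * (A s)⁻¹) i j) = fun _ => (1 : Matrix n n ℂ) i j := by
      funext s
      rw [Matrix.mul_nonsing_inv _ (isUnit_iff_ne_zero.2 (hdet s))]
    rw [h3]
    exact hasDerivAt_const _ _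
  have h4 : R' = -((A s)⁻¹ * A' * (A s)⁻¹) := by
    have h5 := congrArg (fun B => (A s)⁻¹ * B) h2
    rw [Matrix.mul_add, ← Matrix.mul_assoc, ← Matrix.mul_assoc,
      Matrix.nonsing_inv_mul _ (isUnit_iff_ne_zero.2 (hdet s)), Matrix.one_mul, Matrix.mul_zero] at h5
    rw [← add_eq_zero_iff_eq_neg', h5]
  rw [← h4]
  exact hR

end Calculus

/-! ## Bilinear expressions in the wave functions -/

section Bracket

variable {a₁ a₂ b₁ : ℝ} {lam chi : Fin 2 → ℂ} {N : Fin 2 → ℕ}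

/-- The expression `(u K B) (B† H B)⁻¹ (u K' B)†`, where `B` extracts the odd coefficients. -/
def bracket (H : Matrix (Idx fun i => 2 * N i) (Idx fun i => 2 * N i) ℂ)
    (E : Fin 2 → PowerSeries ℂ) (K K' : Matrix (Idx fun i => 2 * N i) (Idx fun i => 2 * N i) ℂ) : ℂ :=
  ((urow (fun i => 2 * N i) * K * oddMat N E) * ((oddMat N E)ᴴ * H * oddMat N E)⁻¹
    * (urow (fun i => 2 * N i) * K' * oddMat N E)ᴴ) () ()

variable {H : Matrix (Idx fun i => 2 * N i) (Idx fun i => 2 * N i) ℂ} {E : Fin 2 → PowerSeries ℂ}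
  (K K' K'' : Matrix (Idx fun i => 2 * N i) (Idx fun i => 2 * N i) ℂ)

theorem bracket_smul_left (c : ℂ) : bracket H E (c • K) K' = c * bracket H E K K' := by
  simp [bracket]

theorem bracket_smul_right (c : ℂ) : bracket H E K (c • K') = conj c * bracket H E K K' := by
  simp [bracket]

theorem bracket_add_left :
    bracket H E (K + K'') K' = bracket H E K K' + bracket H E K'' K' := by
  simp [bracket, Matrix.mul_add, Matrix.add_mul]

theorem bracket_sub_left :
    bracket H E (K - K'') K' = bracket H E K K' - bracket H E K'' K' := by
  simp [bracket, Matrix.mul_sub, Matrix.sub_mul]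

theorem bracket_add_right :
    bracket H E K (K' + K'') = bracket H E K K' + bracket H E K K'' := by
  simp [bracket, Matrix.mul_add, Matrix.add_mul]

theorem conj_bracket (hH : Hᴴ = -H) (hdet : ((oddMat N E)ᴴ * H * oddMat N E).det ≠ 0) :
    conj (bracket H E K K') = -bracket H E K' K := by
  set u := urow (fun i => 2 * N i)
  set B := oddMat N E
  have hM : (Bᴴ * H * B)ᴴ = -(Bᴴ * H * B) := by
    rw [Matrix.conjTranspose_mul, Matrix.conjTranspose_mul, Matrix.conjTranspose_conjTranspose, hH]
    simp only [Matrix.neg_mul, Matrix.mul_neg, Matrix.mul_assoc]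
  have h1 : ((u * K * B) * (Bᴴ * H * B)⁻¹ * (u * K' * B)ᴴ)ᴴ
      = -((u * K' * B) * (Bᴴ * H * B)⁻¹ * (u * K * B)ᴴ) := by
    rw [Matrix.conjTranspose_mul, Matrix.conjTranspose_conjTranspose,
      Matrix.conjTranspose_mul (u * K * B), Matrix.conjTranspose_nonsing_inv, hM,
      inv_neg_of_det_ne_zero hdet]
    simp only [Matrix.neg_mul, Matrix.mul_neg, Matrix.mul_assoc]
  exact congrFun (congrFun h1 ()) ()

/-- The quadratic analogue of `bracket`, with `B† Q B` inserted in the middle. -/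
def bracketMid (H : Matrix (Idx fun i => 2 * N i) (Idx fun i => 2 * N i) ℂ)
    (E : Fin 2 → PowerSeries ℂ)
    (K Q K' : Matrix (Idx fun i => 2 * N i) (Idx fun i => 2 * N i) ℂ) : ℂ :=
  ((urow (fun i => 2 * N i) * K * oddMat N E) * ((oddMat N E)ᴴ * H * oddMat N E)⁻¹
    * ((oddMat N E)ᴴ * Q * oddMat N E) * ((oddMat N E)ᴴ * H * oddMat N E)⁻¹
    * (urow (fun i => 2 * N i) * K' * oddMat N E)ᴴ) () ()

theorem bracketMid_add (Q Q' : Matrix (Idx fun i => 2 * N i) (Idx fun i => 2 * N i) ℂ) :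
    bracketMid H E K (Q + Q') K' = bracketMid H E K Q K' + bracketMid H E K Q' K' := by
  simp [bracketMid, Matrix.mul_add, Matrix.add_mul]

theorem bracketMid_smul (c : ℂ) (Q : Matrix (Idx fun i => 2 * N i) (Idx fun i => 2 * N i) ℂ) :
    bracketMid H E K (c • Q) K' = c * bracketMid H E K Q K' := by
  simp [bracketMid]

/-- The inserted matrix has rank at most one, because `urow` is a single row, so the expression
splits into a product of two scalars. -/
theorem bracketMid_gram (A A' : Matrix (Idx fun i => 2 * N i) (Idx fun i => 2 * N i) ℂ) :
    bracketMid H E K ((urow (fun i => 2 * N i) * A)ᴴ * (urow (fun i => 2 * N i) * A')) K'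
      = bracket H E K A * bracket H E A' K' := by
  set u := urow (fun i => 2 * N i) with hu
  set B := oddMat N E with hB
  set R := (Bᴴ * H * B)⁻¹ with hR
  have h1 : (u * K * B) * R * (Bᴴ * ((u * A)ᴴ * (u * A')) * B) * R * (u * K' * B)ᴴ
      = ((u * K * B) * R * (u * A * B)ᴴ) * ((u * A' * B) * R * (u * K' * B)ᴴ) := by
    rw [Matrix.conjTranspose_mul (u * A) B]
    simp only [Matrix.mul_assoc]
  have h2 := congrFun (congrFun h1 ()) ()
  rw [Matrix.mul_apply (M := (u * K * B) * R * (u * A * B)ᴴ)] at h2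
  simp only [Finset.univ_unique, Finset.sum_singleton, PUnit.default_eq_unit] at h2
  exact h2

/-- The flow `E' = p E` acts on `B = oddMat N E` as `B' = P B`. The two outer factors contribute `K
P` and `K' P`, and the inverse contributes the term with `P† H + H P` in the middle. -/
theorem hasDerivAt_bracket {E : ℝ → Fin 2 → PowerSeries ℂ} {p : Fin 2 → PowerSeries ℂ}
    {P : Matrix (Idx fun i => 2 * N i) (Idx fun i => 2 * N i) ℂ}
    (hP : toep (fun i => 2 * N i) (fun i => 2 * N i) id p = P)
    (hE : ∀ s i n, HasDerivAt (fun s => coeff n (E s i)) (coeff n (p i * E s i)) s)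
    (hdet : ∀ s, ((oddMat N (E s))ᴴ * H * oddMat N (E s)).det ≠ 0) (s : ℝ) :
    HasDerivAt (fun s => bracket H (E s) K K')
      (bracket H (E s) (K * P) K' + bracket H (E s) K (K' * P)
        - bracketMid H (E s) K (Pᴴ * H + H * P) K') s := by
  have hB : HasMDeriv (fun s => oddMat N (E s)) (P * oddMat N (E s)) s := by
    rw [← hP, toep_mul_oddMat]
    intro q r
    simp only [oddMat, toep_apply]
    split_ifs
    · exact hE s _ _
    · exact hasDerivAt_const _ _
  have hrow : ∀ K, HasMDeriv (fun s => urow (fun i => 2 * N i) * K * oddMat N (E s))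
      (urow (fun i => 2 * N i) * (K * P) * oddMat N (E s)) s := by
    intro K
    have := hB.const_mul (urow (fun i => 2 * N i) * K)
    simpa only [Matrix.mul_assoc] using this
  have hM : HasMDeriv (fun s => (oddMat N (E s))ᴴ * H * oddMat N (E s))
      ((oddMat N (E s))ᴴ * (Pᴴ * H + H * P) * oddMat N (E s)) s := by
    have := hB.conjTranspose.mul (hB.const_mul H)
    simp only [Matrix.conjTranspose_mul] at this
    simp only [Matrix.mul_add, Matrix.add_mul, Matrix.mul_assoc] at this ⊢
    exact this
  have h := (((hrow K).mul (hM.inv hdet)).mul (hrow K').conjTranspose) () ()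
  set u := urow (fun i => 2 * N i)
  set B := oddMat N (E s)
  set R := (Bᴴ * H * B)⁻¹
  have key : (u * (K * P) * B * R + u * K * B * -(R * (Bᴴ * (Pᴴ * H + H * P) * B) * R))
        * (u * K' * B)ᴴ + u * K * B * R * (u * (K' * P) * B)ᴴ
      = u * (K * P) * B * R * (u * K' * B)ᴴ + u * K * B * R * (u * (K' * P) * B)ᴴ
        - u * K * B * R * (Bᴴ * (Pᴴ * H + H * P) * B) * R * (u * K' * B)ᴴ := by
    generalize Bᴴ * (Pᴴ * H + H * P) * B = Q
    simp only [Matrix.add_mul, Matrix.mul_neg, Matrix.neg_mul, Matrix.mul_assoc]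
    abel
  exact h.congr_deriv (congrFun (congrFun key ()) ())

theorem bracket_one_right_eq :
    bracket H E K 1 = (fun s => (urow (fun i => 2 * N i) * K * oddMat N E) () s) ⬝ᵥ
      ((oddMat N E)ᴴ * H * oddMat N E)⁻¹ *ᵥ
        star (fun s => (urow (fun i => 2 * N i) * oddMat N E) () s) := by
  rw [bracket, Matrix.mul_one, Matrix.mul_assoc, Matrix.mul_apply]
  rfl

/-- The determinant quotient in terms of the bracket. -/
theorem IsCauchy.det_ratio (hH : IsCauchy b₁ lam chi (fun i => 2 * N i) H) {c : ℝ}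
    (hc : ∀ i, chi i + c ≠ 0) (hdet : ((oddMat N E)ᴴ * H * oddMat N E).det ≠ 0) :
    ((oddMat N E)ᴴ * ((shiftMat b₁ lam chi c (fun i => 2 * N i))ᴴ * H
      * resMat b₁ lam chi c (fun i => 2 * N i)) * oddMat N E).det
        / ((oddMat N E)ᴴ * H * oddMat N E).det
      = 1 - 2 * bracket H E (resMat b₁ lam chi c (fun i => 2 * N i)) 1 := by
  rw [hH.conj_shift hc, bracket_one_right_eq, div_eq_iff hdet, mul_comm,
    ← det_sub_smul_vecMulVec hdet]
  congr 1
  rw [Matrix.mul_sub, Matrix.sub_mul, Matrix.mul_smul, Matrix.smul_mul,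
    ← Matrix.mul_assoc _ (urow _)ᴴ, ← Matrix.conjTranspose_mul,
    Matrix.mul_assoc _ (urow _ * _) (oddMat _ _)]
  congr 2
  ext p s
  rw [Matrix.vecMulVec_apply, Matrix.mul_apply]
  simp

theorem oddMat_C_mul (g : Fin 2 → ℂ) :
    oddMat N (fun i => C (g i) * E i) = oddMat N E * Matrix.diagonal fun s : Idx N => g s.1 := by
  ext p s
  rw [Matrix.mul_diagonal, oddMat, oddMat, toep_apply, toep_apply]
  split_ifs
  · rw [coeff_C_mul, mul_comm]
  · rw [zero_mul]

theorem det_diagonal_ne_zero {g : Fin 2 → ℂ} (hg : ∀ i, g i ≠ 0) :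
    (Matrix.diagonal fun s : Idx N => g s.1).det ≠ 0 := by
  rw [Matrix.det_diagonal]
  exact Finset.prod_ne_zero_iff.2 fun s _ => hg s.1

theorem compress_C_mul (g : Fin 2 → ℂ) :
    (oddMat N (fun i => C (g i) * E i))ᴴ * H * oddMat N (fun i => C (g i) * E i)
      = (Matrix.diagonal fun s : Idx N => g s.1)ᴴ * ((oddMat N E)ᴴ * H * oddMat N E)
        * Matrix.diagonal fun s : Idx N => g s.1 := by
  rw [oddMat_C_mul, Matrix.conjTranspose_mul]
  simp only [Matrix.mul_assoc]

/-- Scaling the series multiplies `B` on the right by an invertible diagonal matrix, which cancels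
against the inverse of `B† H B`. Hence the exponential factor `exp X^{[0]}` may be inserted freely.
-/
theorem bracket_C_mul {g : Fin 2 → ℂ} (hg : ∀ i, g i ≠ 0) :
    bracket H (fun i => C (g i) * E i) K K' = bracket H E K K' := by
  have hG := isUnit_iff_ne_zero.2 (det_diagonal_ne_zero (N := N) hg)
  rw [bracket, compress_C_mul, oddMat_C_mul]
  set G := Matrix.diagonal fun s : Idx N => g s.1
  have hG' : IsUnit Gᴴ.det := by
    rw [Matrix.det_conjTranspose]
    exact hG.star
  set u := urow (fun i => 2 * N i)
  set B := oddMat N E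
  set M := Bᴴ * H * B
  rw [bracket, Matrix.mul_inv_rev, Matrix.mul_inv_rev, ← Matrix.mul_assoc _ B G,
    ← Matrix.mul_assoc _ B G, Matrix.conjTranspose_mul _ G]
  refine congrFun (congrFun ?_ ()) ()
  calc u * K * B * G * (G⁻¹ * (M⁻¹ * Gᴴ⁻¹)) * (Gᴴ * (u * K' * B)ᴴ)
      = u * K * B * (G * G⁻¹) * M⁻¹ * (Gᴴ⁻¹ * Gᴴ) * (u * K' * B)ᴴ := by
        simp only [Matrix.mul_assoc]
    _ = _ := by
        rw [Matrix.mul_nonsing_inv _ hG, Matrix.nonsing_inv_mul _ hG', Matrix.mul_one,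
          Matrix.mul_one]

end Bracket

/-- Square matrices of twice the block sizes. -/
abbrev SqMat (N : Fin 2 → ℕ) : Type := Matrix (Idx fun i => 2 * N i) (Idx fun i => 2 * N i) ℂ

/-! ## The evolution of the wave functions -/

section Evolution

variable (b₁ : ℝ) (lam chi : Fin 2 → ℂ) (alpha : Fin 2 → ℕ → ℂ)

/-- The exponent of `waveSeries`. -/
def phaseSeries (x t : ℝ) (i : Fin 2) : PowerSeries ℂ :=
  epsAlphaSeries (alpha i)
    + PowerSeries.mk fun k => if k = 0 then 0 else omegaCoeff b₁ (lam i) (chi i) x t k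

theorem constantCoeff_phaseSeries (x t : ℝ) (i : Fin 2) :
    constantCoeff (phaseSeries b₁ lam chi alpha x t i) = 0 := by
  rw [phaseSeries, map_add, constantCoeff_epsAlphaSeries, zero_add,
    ← coeff_zero_eq_constantCoeff_apply, coeff_mk, if_pos rfl]

theorem waveSeries_eq (x t : ℝ) (i : Fin 2) :
    waveSeries b₁ lam chi alpha x t i = expSeries (phaseSeries b₁ lam chi alpha x t i) := by
  rw [waveSeries, schurSeries, phaseSeries, expSeries_add (constantCoeff_epsAlphaSeries _)]
  rw [← coeff_zero_eq_constantCoeff_apply, coeff_mk, if_pos rfl]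

/-- The wave series with the factor `exp X^{[0]}` restored. -/
def fullSeries (x t : ℝ) (i : Fin 2) : PowerSeries ℂ :=
  C (Complex.exp (omegaCoeff b₁ (lam i) (chi i) x t 0)) * waveSeries b₁ lam chi alpha x t i

theorem omegaCoeff_eq (l c : ℂ) (x t : ℝ) (k : ℕ) : omegaCoeff b₁ l c x t k
    = Complex.I * coeff k (chiSeries b₁ l c) * x
      + Complex.I / 2 * coeff k (chiSeries b₁ l c ^ 2) * t := by
  rw [pow_two, coeff_mul, Finset.Nat.sum_antidiagonal_eq_sum_range_succ
    (fun i j => coeff i (chiSeries b₁ l c) * coeff j (chiSeries b₁ l c)), omegaCoeff]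
  simp only [chiSeries, coeff_mk]
  ring

theorem hasDerivAt_omegaCoeff_left (l c : ℂ) (x t : ℝ) (k : ℕ) :
    HasDerivAt (fun x => omegaCoeff b₁ l c x t k)
      (coeff k (C Complex.I * chiSeries b₁ l c)) x := by
  simp only [omegaCoeff_eq, coeff_C_mul]
  simpa using ((Complex.ofRealCLM.hasDerivAt (x := x)).const_mul
    (Complex.I * coeff k (chiSeries b₁ l c))).add_const
      (Complex.I / 2 * coeff k (chiSeries b₁ l c ^ 2) * t)

theorem hasDerivAt_omegaCoeff_right (l c : ℂ) (x t : ℝ) (k : ℕ) :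
    HasDerivAt (fun t => omegaCoeff b₁ l c x t k)
      (coeff k (C (Complex.I / 2) * chiSeries b₁ l c ^ 2)) t := by
  simp only [omegaCoeff_eq, coeff_C_mul]
  simpa using ((Complex.ofRealCLM.hasDerivAt (x := t)).const_mul
    (Complex.I / 2 * coeff k (chiSeries b₁ l c ^ 2))).const_add
      (Complex.I * coeff k (chiSeries b₁ l c) * x)

/-- The exponent is split into its constant term, exponentiated as a number, and the rest, to which
`expSeries` applies. With the constant term restored, the logarithmic derivative is all of `p`, so
`fullSeries` evolves by multiplication with exactly `i χ(ε)` in `x` and `i χ(ε)² / 2` in `t`. -/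
theorem hasDerivAt_coeff_exp_mul {w : ℝ → ℕ → ℂ} {p f : PowerSeries ℂ} {s : ℝ}
    (hf : constantCoeff f = 0) (hw : ∀ k, HasDerivAt (fun s => w s k) (coeff k p) s) (n : ℕ) :
    HasDerivAt (fun s => coeff n (C (Complex.exp (w s 0))
        * expSeries (f + PowerSeries.mk fun k => if k = 0 then 0 else w s k)))
      (coeff n (p * (C (Complex.exp (w s 0))
        * expSeries (f + PowerSeries.mk fun k => if k = 0 then 0 else w s k)))) s := by
  set h : PowerSeries ℂ := PowerSeries.mk fun k => if k = 0 then 0 else coeff k p with hh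
  have hp : p = C (coeff 0 p) + h := by
    ext k
    rw [hh, map_add, coeff_C, coeff_mk]
    by_cases hk : k = 0
    · simp [hk]
    · simp [hk]
  have h1 := hasDerivAt_coeff_expSeries
    (g := fun s => f + PowerSeries.mk fun k => if k = 0 then 0 else w s k) (h := h) s
    (fun s => by
      rw [map_add, hf, zero_add, ← coeff_zero_eq_constantCoeff_apply, coeff_mk, if_pos rfl])
    (fun k => by
      simp only [map_add, coeff_mk, hh]
      by_cases hk : k = 0
      · simpa [hk] using hasDerivAt_const s (coeff 0 f)
      · simpa [hk] using (hw k).const_add (coeff k f)) n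
  have h2 := ((hw 0).cexp).mul h1
  simp only [coeff_C_mul]
  refine h2.congr_deriv ?_
  rw [mul_left_comm, coeff_C_mul]
  conv_rhs => rw [hp, add_mul, map_add, coeff_C_mul]
  ring

theorem hasDerivAt_fullSeries_left (x t : ℝ) (i : Fin 2) (n : ℕ) :
    HasDerivAt (fun x => coeff n (fullSeries b₁ lam chi alpha x t i))
      (coeff n (C Complex.I * chiSeries b₁ (lam i) (chi i)
        * fullSeries b₁ lam chi alpha x t i)) x := by
  simp only [fullSeries, waveSeries_eq]
  exact hasDerivAt_coeff_exp_mul (constantCoeff_epsAlphaSeries _)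
    (hasDerivAt_omegaCoeff_left b₁ _ _ x t) n

theorem hasDerivAt_fullSeries_right (x t : ℝ) (i : Fin 2) (n : ℕ) :
    HasDerivAt (fun t => coeff n (fullSeries b₁ lam chi alpha x t i))
      (coeff n (C (Complex.I / 2) * chiSeries b₁ (lam i) (chi i) ^ 2
        * fullSeries b₁ lam chi alpha x t i)) t := by
  simp only [fullSeries, waveSeries_eq]
  exact hasDerivAt_coeff_exp_mul (constantCoeff_epsAlphaSeries _)
    (hasDerivAt_omegaCoeff_right b₁ _ _ x t) n

end Evolution

/-! ### Derivatives and algebraic relations of the brackets along the flow -/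

section Flow

variable {a₁ a₂ b₁ : ℝ} {lam chi : Fin 2 → ℂ} {N : Fin 2 → ℕ} (alpha : Fin 2 → ℕ → ℂ)
  {H : Matrix (Idx fun i => 2 * N i) (Idx fun i => 2 * N i) ℂ}

theorem full_det_ne_zero (h : SpectralData a₁ a₂ b₁ lam chi)
    (hH : IsCauchy b₁ lam chi (fun i => 2 * N i) H) (x t : ℝ) :
    ((oddMat N (fullSeries b₁ lam chi alpha x t))ᴴ * H
      * oddMat N (fullSeries b₁ lam chi alpha x t)).det ≠ 0 := by
  have h1 := Mmat_det_ne_zero (N := N) alpha x t h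
  rw [Mmat_eq alpha x t h hH] at h1
  have h2 := compress_C_mul (N := N) (H := H) (E := waveSeries b₁ lam chi alpha x t)
    (fun i => Complex.exp (omegaCoeff b₁ (lam i) (chi i) x t 0))
  change ((oddMat N fun i => C (Complex.exp (omegaCoeff b₁ (lam i) (chi i) x t 0))
    * waveSeries b₁ lam chi alpha x t i)ᴴ * H * oddMat N fun i =>
      C (Complex.exp (omegaCoeff b₁ (lam i) (chi i) x t 0))
        * waveSeries b₁ lam chi alpha x t i).det ≠ 0
  have h3 := det_diagonal_ne_zero (N := N)
    (g := fun i => Complex.exp (omegaCoeff b₁ (lam i) (chi i) x t 0)) fun i => Complex.exp_ne_zero _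
  rw [h2, Matrix.det_mul, Matrix.det_mul, Matrix.det_conjTranspose]
  exact mul_ne_zero (mul_ne_zero (star_ne_zero.2 h3) h1) h3

theorem bracket_full (x t : ℝ) (K K' : Matrix (Idx fun i => 2 * N i) (Idx fun i => 2 * N i) ℂ) :
    bracket H (fullSeries b₁ lam chi alpha x t) K K'
      = bracket H (waveSeries b₁ lam chi alpha x t) K K' :=
  bracket_C_mul K K' (g := fun i => Complex.exp (omegaCoeff b₁ (lam i) (chi i) x t 0))
    fun _ => Complex.exp_ne_zero _

variable (K K' : Matrix (Idx fun i => 2 * N i) (Idx fun i => 2 * N i) ℂ)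

/-- `bracket` along the flow. -/
def flowBracket (b₁ : ℝ) (lam chi : Fin 2 → ℂ) (alpha : Fin 2 → ℕ → ℂ)
    (H : Matrix (Idx fun i => 2 * N i) (Idx fun i => 2 * N i) ℂ) (x t : ℝ)
    (K K' : Matrix (Idx fun i => 2 * N i) (Idx fun i => 2 * N i) ℂ) : ℂ :=
  bracket H (fullSeries b₁ lam chi alpha x t) K K'

/-- For `P = i J` the middle matrix is `P† H + H P = i (H J - J† H) = 2 i u† u`, so its contribution
factors into a product of brackets. -/
theorem hasDerivAt_flowBracket_left (h : SpectralData a₁ a₂ b₁ lam chi)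
    (hH : IsCauchy b₁ lam chi (fun i => 2 * N i) H) (x t : ℝ) :
    HasDerivAt (fun x => flowBracket b₁ lam chi alpha H x t K K')
      (Complex.I * (flowBracket b₁ lam chi alpha H x t (K * chiMat b₁ lam chi _) K'
        - flowBracket b₁ lam chi alpha H x t K (K' * chiMat b₁ lam chi _)
        - 2 * flowBracket b₁ lam chi alpha H x t K 1
          * flowBracket b₁ lam chi alpha H x t 1 K')) x := by
  have hd := hasDerivAt_bracket K K'
    (p := fun i => C Complex.I * chiSeries b₁ (lam i) (chi i)) (N := N) (H := H)
    (P := Complex.I • chiMat b₁ lam chi _) (toep_C_mul _)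
    (fun s i n => hasDerivAt_fullSeries_left b₁ lam chi alpha s t i n)
    (fun s => full_det_ne_zero alpha h hH s t) x
  refine hd.congr_deriv ?_
  have hQ : (Complex.I • chiMat b₁ lam chi (fun i => 2 * N i))ᴴ * H
      + H * (Complex.I • chiMat b₁ lam chi (fun i => 2 * N i))
      = (2 * Complex.I) • ((urow (fun i => 2 * N i) * (1 : SqMat N))ᴴ * (urow (fun i => 2 * N i) * (1 : SqMat N))) := by
    have h1 := congrArg (fun A => Complex.I • A) hH
    simp only [smul_sub, smul_smul] at h1
    rw [Matrix.mul_one, mul_comm 2 Complex.I, ← h1, Matrix.conjTranspose_smul, Matrix.smul_mul,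
      Matrix.mul_smul, RCLike.star_def, Complex.conj_I, neg_smul]
    abel
  rw [hQ, bracketMid_smul, bracketMid_gram, Matrix.mul_smul, Matrix.mul_smul, bracket_smul_left,
    bracket_smul_right, Complex.conj_I]
  simp only [flowBracket]
  ring

/-- As for `x`, now with `P = (i/2) J²`: applying the Cauchy relation twice gives `H J² - J†² H = 2
u† (u J) + 2 (u J)† u`, hence two products of brackets. -/
theorem hasDerivAt_flowBracket_right (h : SpectralData a₁ a₂ b₁ lam chi)
    (hH : IsCauchy b₁ lam chi (fun i => 2 * N i) H) (x t : ℝ) :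
    HasDerivAt (fun t => flowBracket b₁ lam chi alpha H x t K K')
      (Complex.I / 2 * (flowBracket b₁ lam chi alpha H x t
            (K * (chiMat b₁ lam chi _ * chiMat b₁ lam chi _)) K'
          - flowBracket b₁ lam chi alpha H x t K
            (K' * (chiMat b₁ lam chi _ * chiMat b₁ lam chi _)))
        - Complex.I * (flowBracket b₁ lam chi alpha H x t K 1
            * flowBracket b₁ lam chi alpha H x t (chiMat b₁ lam chi _) K'
          + flowBracket b₁ lam chi alpha H x t K (chiMat b₁ lam chi _)
            * flowBracket b₁ lam chi alpha H x t 1 K')) t := by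
  have hJ : toep (fun i => 2 * N i) (fun i => 2 * N i) id
      (fun i => C (Complex.I / 2) * chiSeries b₁ (lam i) (chi i) ^ 2)
      = (Complex.I / 2) • (chiMat b₁ lam chi _ * chiMat b₁ lam chi _) := by
    rw [toep_C_mul, chiMat, toep_mul (φ := id) (fun _ _ h => h)]
    simp only [pow_two]
  have hd := hasDerivAt_bracket K K' (N := N) (H := H) hJ
    (fun s i n => hasDerivAt_fullSeries_right b₁ lam chi alpha x s i n)
    (fun s => full_det_ne_zero alpha h hH x s) t
  refine hd.congr_deriv ?_
  set J := chiMat b₁ lam chi (fun i => 2 * N i) with hJdef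
  set u := urow (fun i => 2 * N i) with hu
  have hc : conj (Complex.I / 2) = -(Complex.I / 2) := by
    rw [map_div₀, Complex.conj_I, map_ofNat, neg_div]
  have hQ : ((Complex.I / 2) • (J * J))ᴴ * H + H * ((Complex.I / 2) • (J * J))
      = Complex.I • ((u * (1 : SqMat N))ᴴ * (u * J)) + Complex.I • ((u * J)ᴴ * (u * (1 : SqMat N))) := by
    have h1 : H * (J * J) - (J * J)ᴴ * H = (2 : ℂ) • ((u * (1 : SqMat N))ᴴ * (u * J))
        + (2 : ℂ) • ((u * J)ᴴ * (u * (1 : SqMat N))) := by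
      have h2 : H * J = Jᴴ * H + (2 : ℂ) • (uᴴ * u) := by
        rw [← (hH : H * J - Jᴴ * H = (2 : ℂ) • (uᴴ * u))]
        abel
      rw [← Matrix.mul_assoc, h2, Matrix.add_mul, Matrix.mul_assoc Jᴴ H J, h2, Matrix.mul_add,
        Matrix.conjTranspose_mul J J, Matrix.conjTranspose_mul u J, Matrix.mul_one]
      simp only [Matrix.smul_mul, Matrix.mul_smul, Matrix.mul_assoc]
      abel
    have h3 := congrArg (fun A => (Complex.I / 2) • A) h1
    simp only [smul_sub, smul_add, smul_smul] at h3
    rw [div_mul_cancel₀ Complex.I two_ne_zero] at h3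
    rw [← h3, Matrix.conjTranspose_smul, Matrix.smul_mul,
      Matrix.mul_smul, RCLike.star_def, hc, neg_smul]
    abel
  rw [hQ, bracketMid_add, bracketMid_smul, bracketMid_smul, bracketMid_gram, bracketMid_gram,
    Matrix.mul_smul, Matrix.mul_smul, bracket_smul_left, bracket_smul_right, hc]
  simp only [flowBracket]
  ring

/-- The spectral relation in terms of the bracket. -/
theorem flowBracket_spectral (h : SpectralData a₁ a₂ b₁ lam chi)
    (hH : IsCauchy b₁ lam chi (fun i => 2 * N i) H) (x t : ℝ) :
    flowBracket b₁ lam chi alpha H x t (chiMat b₁ lam chi _) 1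
        - flowBracket b₁ lam chi alpha H x t 1 (chiMat b₁ lam chi _)
      = 2 * flowBracket b₁ lam chi alpha H x t 1 1 ^ 2
        + (a₁ : ℂ) ^ 2 * (flowBracket b₁ lam chi alpha H x t (resMat b₁ lam chi b₁ _) 1
          - flowBracket b₁ lam chi alpha H x t 1 (resMat b₁ lam chi b₁ _)
          + 2 * flowBracket b₁ lam chi alpha H x t 1 (resMat b₁ lam chi b₁ _)
            * flowBracket b₁ lam chi alpha H x t (resMat b₁ lam chi b₁ _) 1)
        + (a₂ : ℂ) ^ 2 * (flowBracket b₁ lam chi alpha H x t (resMat b₁ lam chi (-b₁) _) 1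
          - flowBracket b₁ lam chi alpha H x t 1 (resMat b₁ lam chi (-b₁) _)
          + 2 * flowBracket b₁ lam chi alpha H x t 1 (resMat b₁ lam chi (-b₁) _)
            * flowBracket b₁ lam chi alpha H x t (resMat b₁ lam chi (-b₁) _) 1) := by
  simp only [flowBracket]
  set E := fullSeries b₁ lam chi alpha x t
  have hdet : ((oddMat N E)ᴴ * H * oddMat N E).det ≠ 0 := full_det_ne_zero alpha h hH x t
  have hL := h.two_smul_lamMat (n := fun i => 2 * N i)
  have hJ : chiMat b₁ lam chi (fun i => 2 * N i) = (2 : ℂ) • lamMat b₁ lam chi (fun i => 2 * N i)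
      + ((a₁ ^ 2 : ℝ) : ℂ) • resMat b₁ lam chi b₁ _
      + ((a₂ ^ 2 : ℝ) : ℂ) • resMat b₁ lam chi (-b₁) _ := by
    rw [hL]
    abel
  -- Since `Λ B = B S`, the difference is `u B (S M⁻¹ - M⁻¹ S†) (u B)†`, and `S M⁻¹ - M⁻¹ S† = M⁻¹
  -- (M S - S† M) M⁻¹` brings in the Sylvester equation.
  have key : bracket H E (lamMat b₁ lam chi _) 1 - bracket H E 1 (lamMat b₁ lam chi _)
      = bracketMid H E 1 (H * lamMat b₁ lam chi (fun i => 2 * N i)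
        - (lamMat b₁ lam chi (fun i => 2 * N i))ᴴ * H) 1 := by
    have hS := oddMat_mul_specMat (b₁ := b₁) (lam := lam) (chi := chi) (N := N) (E := E)
    have hC := compress_sylvester b₁ lam chi H E
    set L := lamMat b₁ lam chi (fun i => 2 * N i)
    set S := specMat b₁ lam chi N
    set u := urow (fun i => 2 * N i)
    set B := oddMat N E
    set M := Bᴴ * H * B with hM
    have e : u * L * B * M⁻¹ * (u * (1 : SqMat N) * B)ᴴ - u * (1 : SqMat N) * B * M⁻¹ * (u * L * B)ᴴ
        = u * (1 : SqMat N) * B * M⁻¹ * (Bᴴ * (H * L - Lᴴ * H) * B) * M⁻¹ * (u * (1 : SqMat N) * B)ᴴ := by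
      have hu := isUnit_iff_ne_zero.2 hdet
      rw [← hC, Matrix.mul_assoc u L B, ← hS, Matrix.mul_one, ← Matrix.mul_assoc u B S,
        Matrix.conjTranspose_mul (u * B) S]
      calc u * B * S * M⁻¹ * (u * B)ᴴ - u * B * M⁻¹ * (Sᴴ * (u * B)ᴴ)
          = u * B * (M⁻¹ * M) * S * M⁻¹ * (u * B)ᴴ
            - u * B * M⁻¹ * Sᴴ * (M * M⁻¹) * (u * B)ᴴ := by
            rw [Matrix.nonsing_inv_mul _ hu, Matrix.mul_nonsing_inv _ hu, Matrix.mul_one,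
              Matrix.mul_one, Matrix.mul_assoc (u * B * M⁻¹)]
        _ = _ := by
            rw [Matrix.mul_sub, Matrix.sub_mul, Matrix.sub_mul]
            simp only [Matrix.mul_assoc]
    exact congrFun (congrFun e ()) ()
  have hu1 : ((urow (fun i => 2 * N i))ᴴ * urow (fun i => 2 * N i))
      = ((urow (fun i => 2 * N i) * (1 : SqMat N))ᴴ * (urow (fun i => 2 * N i) * (1 : SqMat N))) := by
    rw [Matrix.mul_one]
  rw [hH.spectral h, hu1, bracketMid_add, bracketMid_add, bracketMid_smul, bracketMid_smul,
    bracketMid_gram, bracketMid_gram, bracketMid_gram] at key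
  rw [hJ]
  simp only [bracket_add_left, bracket_add_right, bracket_smul_left, bracket_smul_right,
    Complex.conj_ofReal, map_ofNat]
  push_cast at key ⊢
  linear_combination 2 * key

end Flow

/-! ## The envelope equation -/

section Envelope

variable {a₁ a₂ b₁ : ℝ} {lam chi : Fin 2 → ℂ} {N : Fin 2 → ℕ} (alpha : Fin 2 → ℕ → ℂ) {H : SqMat N}

/-- The envelope `1 - 2 (u (χ + c)⁻¹ B) (B† H B)⁻¹ (u B)†`. -/
def envelope (b₁ : ℝ) (lam chi : Fin 2 → ℂ) (alpha : Fin 2 → ℕ → ℂ) (H : SqMat N) (c : ℝ)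
    (x t : ℝ) : ℂ :=
  1 - 2 * flowBracket b₁ lam chi alpha H x t (resMat b₁ lam chi c _) 1

/-- Keeps the family of brackets small under differentiation: products of the resolvent with powers
of `J` reduce to the resolvent and lower powers of `J`. -/
theorem resMat_mul_chiMat {c : ℝ} (hc : ∀ i, chi i + c ≠ 0) (n : Fin 2 → ℕ) :
    resMat b₁ lam chi c n * chiMat b₁ lam chi n = 1 - (c : ℂ) • resMat b₁ lam chi c n := by
  have h := resMat_mul_shiftMat (b₁ := b₁) (lam := lam) (n := n) hc
  rw [shiftMat_eq, Matrix.mul_add, Matrix.mul_smul, Matrix.mul_one] at h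
  rw [← h]
  abel

theorem flowBracket_sub_left (x t : ℝ) (K K'' K' : SqMat N) :
    flowBracket b₁ lam chi alpha H x t (K - K'') K' = flowBracket b₁ lam chi alpha H x t K K'
      - flowBracket b₁ lam chi alpha H x t K'' K' :=
  bracket_sub_left K K' K''

theorem flowBracket_smul_left (x t : ℝ) (c : ℂ) (K K' : SqMat N) :
    flowBracket b₁ lam chi alpha H x t (c • K) K' = c * flowBracket b₁ lam chi alpha H x t K K' :=
  bracket_smul_left K K' c

/-- The envelope has two `x`-derivatives and a `t`-derivative, which satisfy a linear Schroedinger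
equation with a self-consistent potential. -/
theorem envelope_equation (h : SpectralData a₁ a₂ b₁ lam chi)
    (hH : IsCauchy b₁ lam chi (fun i => 2 * N i) H) {c : ℝ} (hc : ∀ i, chi i + c ≠ 0) :
    ∃ fx fxx ft : ℝ → ℝ → ℂ, ∀ x t,
      HasDerivAt (fun x => envelope b₁ lam chi alpha H c x t) (fx x t) x ∧
      HasDerivAt (fun x => fx x t) (fxx x t) x ∧
      HasDerivAt (fun t => envelope b₁ lam chi alpha H c x t) (ft x t) t ∧
      Complex.I * ft x t + 1 / 2 * fxx x t + Complex.I * c * fx x t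
        - 2 * (flowBracket b₁ lam chi alpha H x t (chiMat b₁ lam chi _) 1
          - flowBracket b₁ lam chi alpha H x t 1 (chiMat b₁ lam chi _)
          - 2 * flowBracket b₁ lam chi alpha H x t 1 1 ^ 2)
          * envelope b₁ lam chi alpha H c x t = 0 := by
  set J := chiMat b₁ lam chi (fun i => 2 * N i) with hJ
  set V := resMat b₁ lam chi c (fun i => 2 * N i) with hV
  have hVJ : V * J = 1 - (c : ℂ) • V := resMat_mul_chiMat hc _
  have hVJJ : V * (J * J) = J - ((c : ℂ) • (1 : SqMat N) - ((c : ℂ) * c) • V) := by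
    rw [← Matrix.mul_assoc, hVJ, Matrix.sub_mul, Matrix.one_mul, Matrix.smul_mul, hVJ, smul_sub,
      smul_smul]
  set F := flowBracket b₁ lam chi alpha H with hF
  have d1 := fun x t => hasDerivAt_flowBracket_left alpha V 1 h hH x t
  have d2 := fun x t => hasDerivAt_flowBracket_left alpha 1 1 h hH x t
  have d3 := fun x t => hasDerivAt_flowBracket_left alpha V J h hH x t
  have d4 := fun x t => hasDerivAt_flowBracket_right alpha V 1 h hH x t
  simp only [← hJ, hVJ, hVJJ, Matrix.one_mul, flowBracket_sub_left, flowBracket_smul_left, ← hF]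
    at d1 d2 d3 d4
  have e1 := fun x t => ((d1 x t).const_mul 2).const_sub 1
  have e4 := fun x t => ((d4 x t).const_mul 2).const_sub 1
  have e2 := fun x t => ((((((d2 x t).sub ((d1 x t).const_mul (c : ℂ))).sub (d3 x t)).sub
    (((d1 x t).const_mul 2).mul (d2 x t))).const_mul Complex.I).const_mul 2).neg
  -- The derivatives are read off from `e1`, `e2`, `e4`. What remains is a polynomial identity in
  -- the brackets; in particular the bracket of `V` with `J²` cancels between `f_t` and `f_xx`.
  refine ⟨_, _, _, fun x t => ⟨e1 x t, e2 x t, e4 x t, ?_⟩⟩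
  simp only [envelope, ← hV, ← hF]
  generalize F x t 1 1 = g00
  generalize F x t V 1 = h0
  generalize F x t V J = h1
  generalize F x t J 1 = g10
  generalize F x t 1 J = g01
  generalize F x t V (J * J) = h2
  have hI := Complex.I_sq
  ring_nf
  simp only [hI]
  ring

/-- `H` is skew-Hermitian, so conjugating a bracket swaps its arguments and changes the sign. -/
theorem normSq_envelope (h : SpectralData a₁ a₂ b₁ lam chi)
    (hH : IsCauchy b₁ lam chi (fun i => 2 * N i) H) (c x t : ℝ) :
    ((‖envelope b₁ lam chi alpha H c x t‖ ^ 2 : ℝ) : ℂ)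
      = envelope b₁ lam chi alpha H c x t
        * (1 + 2 * flowBracket b₁ lam chi alpha H x t 1 (resMat b₁ lam chi c _)) := by
  have h1 : conj (flowBracket b₁ lam chi alpha H x t (resMat b₁ lam chi c _) 1)
      = -flowBracket b₁ lam chi alpha H x t 1 (resMat b₁ lam chi c _) :=
    conj_bracket _ _ (hH.skew h) (full_det_ne_zero alpha h hH x t)
  rw [Complex.ofReal_pow, ← Complex.mul_conj', envelope, map_sub, map_mul, h1, map_one, map_ofNat]
  ring

/-- By `normSq_envelope`, `|f_c|² - 1` is `-2` times the combination of resolvent brackets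
multiplying `a_j²` in `flowBracket_spectral`. This makes the potential in `envelope_equation`
self-consistent. -/
theorem envelope_potential (h : SpectralData a₁ a₂ b₁ lam chi)
    (hH : IsCauchy b₁ lam chi (fun i => 2 * N i) H) (x t : ℝ) :
    (a₁ : ℂ) ^ 2 * (((‖envelope b₁ lam chi alpha H b₁ x t‖ ^ 2 : ℝ) : ℂ) - 1)
        + (a₂ : ℂ) ^ 2 * (((‖envelope b₁ lam chi alpha H (-b₁) x t‖ ^ 2 : ℝ) : ℂ) - 1)
      = -2 * (flowBracket b₁ lam chi alpha H x t (chiMat b₁ lam chi _) 1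
          - flowBracket b₁ lam chi alpha H x t 1 (chiMat b₁ lam chi _)
          - 2 * flowBracket b₁ lam chi alpha H x t 1 1 ^ 2) := by
  rw [normSq_envelope alpha h hH, normSq_envelope alpha h hH, flowBracket_spectral alpha h hH]
  simp only [envelope]
  ring

theorem hasDerivAt_theta_left (a₁ a₂ b x t : ℝ) :
    HasDerivAt (fun x => theta a₁ a₂ b x t) (Complex.I * b) x := by
  have h1 : HasDerivAt (fun x : ℝ => b * x + (a₁ ^ 2 + a₂ ^ 2 - b ^ 2 / 2) * t) b x := by
    simpa using ((hasDerivAt_id x).const_mul b).add_const ((a₁ ^ 2 + a₂ ^ 2 - b ^ 2 / 2) * t)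
  exact h1.ofReal_comp.const_mul Complex.I

theorem hasDerivAt_theta_right (a₁ a₂ b x t : ℝ) :
    HasDerivAt (fun t => theta a₁ a₂ b x t)
      (Complex.I * ((a₁ : ℂ) ^ 2 + (a₂ : ℂ) ^ 2 - (b : ℂ) ^ 2 / 2)) t := by
  have h1 : HasDerivAt (fun t : ℝ => b * x + (a₁ ^ 2 + a₂ ^ 2 - b ^ 2 / 2) * t)
      (a₁ ^ 2 + a₂ ^ 2 - b ^ 2 / 2) t := by
    simpa using ((hasDerivAt_id t).const_mul (a₁ ^ 2 + a₂ ^ 2 - b ^ 2 / 2)).const_add (b * x)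
  refine (h1.ofReal_comp.const_mul Complex.I).congr_deriv ?_
  push_cast
  rfl

/-- Passage from the envelope to the plane-wave-modulated field. -/
theorem schroedinger_of_envelope {a₁ a₂ c : ℝ} {A W : ℂ} {q : ℝ → ℝ → ℂ} {f fx fxx ft : ℝ → ℝ → ℂ}
    (hq : ∀ x t, q x t = A * f x t * Complex.exp (theta a₁ a₂ c x t))
    (hfx : ∀ x t, HasDerivAt (fun x => f x t) (fx x t) x)
    (hfxx : ∀ x t, HasDerivAt (fun x => fx x t) (fxx x t) x)
    (hft : ∀ x t, HasDerivAt (fun t => f x t) (ft x t) t) (x t : ℝ)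
    (he : Complex.I * ft x t + 1 / 2 * fxx x t + Complex.I * c * fx x t + W * f x t = 0) :
    Complex.I * deriv (fun s => q x s) t + (1 / 2 : ℂ) * iteratedDeriv 2 (fun y => q y t) x
      + (W + (a₁ : ℂ) ^ 2 + (a₂ : ℂ) ^ 2) * q x t = 0 := by
  have et : HasDerivAt (fun s => q x s) (A * (ft x t
      + Complex.I * ((a₁ : ℂ) ^ 2 + (a₂ : ℂ) ^ 2 - (c : ℂ) ^ 2 / 2) * f x t)
        * Complex.exp (theta a₁ a₂ c x t)) t := by
    simp only [hq]
    refine (((hft x t).const_mul A).mul (hasDerivAt_theta_right a₁ a₂ c x t).cexp).congr_deriv ?_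
    ring
  have ex : ∀ y, HasDerivAt (fun y => q y t) (A * (fx y t + Complex.I * c * f y t)
        * Complex.exp (theta a₁ a₂ c y t)) y := by
    intro y
    simp only [hq]
    refine (((hfx y t).const_mul A).mul (hasDerivAt_theta_left a₁ a₂ c y t).cexp).congr_deriv ?_
    ring
  have ex' : deriv (fun y => q y t) = fun y => A * (fx y t + Complex.I * c * f y t)
        * Complex.exp (theta a₁ a₂ c y t) := funext fun y => (ex y).deriv
  have exx := ((((hfxx x t).add ((hfx x t).const_mul (Complex.I * c))).const_mul A).mul
    (hasDerivAt_theta_left a₁ a₂ c x t).cexp)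
  rw [show (2 : ℕ) = 1 + 1 from rfl, iteratedDeriv_succ, iteratedDeriv_one, ex', et.deriv]
  erw [exx.deriv]
  rw [hq]
  simp only [Pi.add_apply]
  linear_combination (A * Complex.exp (theta a₁ a₂ c x t)) * he
    + (A * Complex.exp (theta a₁ a₂ c x t)) * ((a₁ : ℂ) ^ 2 + (a₂ : ℂ) ^ 2) * f x t * Complex.I_sq

end Envelope

/-! ## Asymptotics of the column space of `oddMat` -/

section Frame

open Filter Topology

/-- A diagonal block of `oddMat`. -/
def oddBlock (m n : ℕ) (f : PowerSeries ℂ) : Matrix (Fin m) (Fin n) ℂ :=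
  Matrix.of fun p k => if (p : ℕ) ≤ 2 * k + 1 then coeff (2 * k + 1 - p) f else 0

theorem oddMat_eq_blockDiagonal' (N : Fin 2 → ℕ) (E : Fin 2 → PowerSeries ℂ) :
    oddMat N E = Matrix.blockDiagonal' fun i => oddBlock (2 * N i) (N i) (E i) := by
  ext ⟨i, p⟩ ⟨j, k⟩
  rw [oddMat, toep_apply]
  by_cases hij : i = j
  · subst hij
    rw [Matrix.blockDiagonal'_apply_eq]
    simp [oddBlock]
  · rw [Matrix.blockDiagonal'_apply_ne _ _ _ hij, if_neg fun h => hij h.1]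

/-- The leading coefficients `1 / (2k + 1 - m)!` form an invertible matrix. -/
theorem det_oddBlock_exp_ne_zero (n : ℕ) : (oddBlock n n (PowerSeries.exp ℂ)).det ≠ 0 := by
  intro hdet
  obtain ⟨v, hv, hv0⟩ := Matrix.exists_mulVec_eq_zero_iff.2 hdet
  -- Since `1 / (2k + 1 - m)!` is the falling factorial of `2k + 1` of order `m` divided by `(2k +
  -- 1)!`, the matrix is, up to transposition and column scaling, a generalized Vandermonde matrix
  -- at the distinct nodes `2k + 1`. For `m > 2k + 1` the falling factorial vanishes, in accordance
  -- with the zero entries.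
  have hV : (Matrix.of fun i j : Fin n => Polynomial.eval ((2 * (i : ℕ) + 1 : ℕ) : ℂ)
      (descPochhammer ℂ j)).det ≠ 0 := by
    rw [← Matrix.det_eval_matrixOfPolynomials_eq_det_vandermonde
      (fun i : Fin n => ((2 * (i : ℕ) + 1 : ℕ) : ℂ)) (fun j : Fin n => descPochhammer ℂ j)
      (fun i => descPochhammer_natDegree ℂ i) (fun i => monic_descPochhammer ℂ i),
      Matrix.det_vandermonde_ne_zero_iff]
    intro i j hij
    have h1 : 2 * (i : ℕ) + 1 = 2 * (j : ℕ) + 1 := Nat.cast_injective (R := ℂ) hij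
    exact Fin.ext (by omega)
  have hw : (fun k : Fin n => v k / ((2 * (k : ℕ) + 1).factorial : ℂ)) = 0 := by
    refine Matrix.eq_zero_of_vecMul_eq_zero hV ?_
    funext m
    have h1 := congrFun hv0 m
    refine Eq.trans ?_ h1
    simp only [Matrix.mulVec, Matrix.vecMul, dotProduct, oddBlock, Matrix.of_apply]
    refine Finset.sum_congr rfl fun k _ => ?_
    rw [descPochhammer_eval_eq_descFactorial]
    have hk : ((2 * (k : ℕ) + 1).factorial : ℂ) ≠ 0 := by exact_mod_cast Nat.factorial_ne_zero _
    split_ifs with h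
    · rw [PowerSeries.coeff_exp]
      have h2 := Nat.factorial_mul_descFactorial h
      have h3 : ((2 * (k : ℕ) + 1 - m).factorial : ℂ) ≠ 0 := by
        exact_mod_cast Nat.factorial_ne_zero _
      have h4 : ((2 * (k : ℕ) + 1 - m).factorial : ℂ) * ((2 * (k : ℕ) + 1).descFactorial m : ℂ)
          = ((2 * (k : ℕ) + 1).factorial : ℂ) := by exact_mod_cast h2
      simp only [map_div₀, map_one, map_natCast]
      rw [← h4] at hk ⊢
      have h5 := right_ne_zero_of_mul hk
      field_simp
    · rw [Nat.descFactorial_of_lt (by omega)]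
      simp
  apply hv
  funext k
  have h1 := congrFun hw k
  have hk : ((2 * (k : ℕ) + 1).factorial : ℂ) ≠ 0 := by exact_mod_cast Nat.factorial_ne_zero _
  simpa [hk] using h1

theorem tendsto_matrix {α m n : Type*} {l : Filter α} {A : α → Matrix m n ℂ} {A₀ : Matrix m n ℂ} :
    Tendsto A l (𝓝 A₀) ↔ ∀ i j, Tendsto (fun a => A a i j) l (𝓝 (A₀ i j)) :=
  tendsto_pi_nhds.trans (forall_congr' fun _ => tendsto_pi_nhds)

theorem tendsto_matrix_mul {α m n k : Type*} [Fintype n] {l : Filter α} {A : α → Matrix m n ℂ}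
    {A₀ : Matrix m n ℂ} {B : α → Matrix n k ℂ} {B₀ : Matrix n k ℂ} (hA : Tendsto A l (𝓝 A₀))
    (hB : Tendsto B l (𝓝 B₀)) : Tendsto (fun a => A a * B a) l (𝓝 (A₀ * B₀)) := by
  refine tendsto_matrix.2 fun i j => ?_
  simp only [Matrix.mul_apply]
  exact tendsto_finsetSum _ fun p _ => (tendsto_matrix.1 hA i p).mul (tendsto_matrix.1 hB p j)

theorem tendsto_matrix_det {α n : Type*} [Fintype n] [DecidableEq n] {l : Filter α}
    {A : α → Matrix n n ℂ} {A₀ : Matrix n n ℂ} (h : Tendsto A l (𝓝 A₀)) :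
    Tendsto (fun a => (A a).det) l (𝓝 A₀.det) :=
  ((continuous_id.matrix_det).tendsto A₀).comp h

theorem tendsto_matrix_inv {α n : Type*} [Fintype n] [DecidableEq n] {l : Filter α}
    {A : α → Matrix n n ℂ} {A₀ : Matrix n n ℂ} (h : Tendsto A l (𝓝 A₀)) (h0 : A₀.det ≠ 0) :
    Tendsto (fun a => (A a)⁻¹) l (𝓝 A₀⁻¹) := by
  simp only [Matrix.inv_def, Ring.inverse_eq_inv']
  have h2 : Tendsto (fun a => (A a).adjugate) l (𝓝 A₀.adjugate) :=
    ((continuous_id.matrix_adjugate).tendsto A₀).comp h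
  exact ((tendsto_matrix_det h).inv₀ h0).smul h2

/-- Weighted homogeneity: the entry of degree `2k + 1 - p` carries the factor `z^{2k+1} z^{-p}`. -/
theorem oddBlock_rescale {m n : ℕ} (f : PowerSeries ℂ) {z : ℂ} (hz : z ≠ 0) :
    oddBlock m n f = Matrix.diagonal (fun p : Fin m => (z ^ (p : ℕ))⁻¹)
      * oddBlock m n (PowerSeries.mk fun j => coeff j f / z ^ j)
      * Matrix.diagonal (fun k : Fin n => z ^ (2 * (k : ℕ) + 1)) := by
  ext p k
  rw [Matrix.mul_diagonal, Matrix.diagonal_mul]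
  simp only [oddBlock, Matrix.of_apply, coeff_mk]
  split_ifs with h
  · have h1 : z ^ (2 * (k : ℕ) + 1) = z ^ (p : ℕ) * z ^ (2 * (k : ℕ) + 1 - p) := by
      rw [← pow_add]
      congr 1
      omega
    rw [h1]
    have h2 := pow_ne_zero (p : ℕ) hz
    have h3 := pow_ne_zero (2 * (k : ℕ) + 1 - p) hz
    field_simp
  · simp

theorem scaled_entry {n : ℕ} {A b : Matrix (Fin (2 * n)) (Fin n) ℂ}
    {c : Matrix (Fin n) (Fin n) ℂ} {z : ℂ} (hz : z ≠ 0)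
    (hA : A = Matrix.diagonal (fun p : Fin (2 * n) => (z ^ (p : ℕ))⁻¹) * b
      * Matrix.diagonal (fun k : Fin n => z ^ (2 * (k : ℕ) + 1))) (p : Fin (2 * n)) (s : Fin n) :
    (A * (Matrix.diagonal (fun k : Fin n => (z ^ (2 * (k : ℕ) + 1))⁻¹) * c
      * Matrix.diagonal (fun k : Fin n => z ^ (k : ℕ)))) p s
      = (z ^ (p : ℕ))⁻¹ * (b * c) p s * z ^ (s : ℕ) := by
  have hD : Matrix.diagonal (fun k : Fin n => z ^ (2 * (k : ℕ) + 1))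
      * Matrix.diagonal (fun k : Fin n => (z ^ (2 * (k : ℕ) + 1))⁻¹) = 1 := by
    rw [Matrix.diagonal_mul_diagonal, ← Matrix.diagonal_one]
    congr 1
    funext k
    exact mul_inv_cancel₀ (pow_ne_zero _ hz)
  have h : A * (Matrix.diagonal (fun k : Fin n => (z ^ (2 * (k : ℕ) + 1))⁻¹) * c
      * Matrix.diagonal (fun k : Fin n => z ^ (k : ℕ)))
      = Matrix.diagonal (fun p : Fin (2 * n) => (z ^ (p : ℕ))⁻¹) * (b * c)
        * Matrix.diagonal (fun k : Fin n => z ^ (k : ℕ)) := by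
    calc _ = Matrix.diagonal (fun p : Fin (2 * n) => (z ^ (p : ℕ))⁻¹)
            * b * (Matrix.diagonal (fun k : Fin n => z ^ (2 * (k : ℕ) + 1))
              * Matrix.diagonal (fun k : Fin n => (z ^ (2 * (k : ℕ) + 1))⁻¹)) * c
            * Matrix.diagonal (fun k : Fin n => z ^ (k : ℕ)) := by
            simp only [Matrix.mul_assoc, hA]
        _ = _ := by
            rw [hD, Matrix.mul_one]
            simp only [Matrix.mul_assoc]
  rw [h, Matrix.mul_diagonal, Matrix.diagonal_mul]

/-- After a change of basis, the columns of `oddBlock` tend to the first basis vectors. -/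
theorem exists_frame_block {α : Type*} {l : Filter α} {E : α → PowerSeries ℂ} {z : α → ℂ}
    (hz : Tendsto (fun a => ‖z a‖) l atTop)
    (hE : ∀ j, Tendsto (fun a => coeff j (E a) / z a ^ j) l (𝓝 (1 / (j.factorial : ℂ)))) (n : ℕ) :
    ∃ R : α → Matrix (Fin n) (Fin n) ℂ, (∀ᶠ a in l, (R a).det ≠ 0) ∧
      ∀ (p : Fin (2 * n)) (s : Fin n), Tendsto (fun a => (oddBlock (2 * n) n (E a) * R a) p s) l
        (𝓝 (if (p : ℕ) = s then 1 else 0)) := by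
  have hz0 : ∀ᶠ a in l, z a ≠ 0 := by
    filter_upwards [hz.eventually_gt_atTop 0] with a ha
    exact norm_pos_iff.1 ha
  obtain ⟨b, hbdef⟩ : ∃ b : (m : ℕ) → α → Matrix (Fin m) (Fin n) ℂ, ∀ m a, b m a
      = oddBlock m n (PowerSeries.mk fun j => coeff j (E a) / z a ^ j) := ⟨_, fun _ _ => rfl⟩
  have hb : ∀ m, Tendsto (b m) l (𝓝 (oddBlock m n (PowerSeries.exp ℂ))) := by
    intro m
    refine tendsto_matrix.2 fun p k => ?_
    simp only [hbdef, oddBlock, Matrix.of_apply, coeff_mk]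
    split_ifs
    · simpa [PowerSeries.coeff_exp] using hE (2 * k + 1 - p)
    · exact tendsto_const_nhds
  have hdet0 := det_oddBlock_exp_ne_zero n
  have hdet : ∀ᶠ a in l, (b n a).det ≠ 0 := (tendsto_matrix_det (hb n)).eventually_ne hdet0
  have hlim := tendsto_matrix_mul (hb (2 * n)) (tendsto_matrix_inv (hb n) hdet0)
  -- The new basis undoes the column weights, inverts the top square block of the rescaled matrix,
  -- and restores the weight `z^s`. The `(p, s)` entry becomes `z^{s-p}` times a convergent factor.
  refine ⟨fun a => Matrix.diagonal (fun k : Fin n => (z a ^ (2 * (k : ℕ) + 1))⁻¹) * (b n a)⁻¹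
    * Matrix.diagonal (fun k : Fin n => z a ^ (k : ℕ)), ?_, ?_⟩
  · filter_upwards [hz0, hdet] with a ha hda
    rw [Matrix.det_mul, Matrix.det_mul, Matrix.det_diagonal, Matrix.det_diagonal]
    refine mul_ne_zero (mul_ne_zero ?_ ?_) ?_
    · exact Finset.prod_ne_zero_iff.2 fun k _ => inv_ne_zero (pow_ne_zero _ ha)
    · exact (Matrix.isUnit_nonsing_inv_det _ (isUnit_iff_ne_zero.2 hda)).ne_zero
    · exact Finset.prod_ne_zero_iff.2 fun k _ => pow_ne_zero _ ha
  · intro p s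
    refine Tendsto.congr' (f₁ := fun a =>
      (z a ^ (p : ℕ))⁻¹ * (b (2 * n) a * (b n a)⁻¹) p s * z a ^ (s : ℕ)) ?_ ?_
    · filter_upwards [hz0] with a ha
      refine (scaled_entry ha ?_ p s).symm
      rw [hbdef]
      exact oddBlock_rescale (E a) ha
    -- In the top half the convergent factor is exactly the identity matrix; in the bottom half `p ≥
    -- n > s`, so the power of `z` decays.
    by_cases hp : (p : ℕ) < n
    · refine Tendsto.congr' (f₁ := fun _ => if (p : ℕ) = s then 1 else 0) ?_ tendsto_const_nhds
      filter_upwards [hz0, hdet] with a ha hda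
      have h1 : (b (2 * n) a * (b n a)⁻¹) p s = (b n a * (b n a)⁻¹) ⟨p, hp⟩ s := by
        simp only [Matrix.mul_apply, hbdef, oddBlock, Matrix.of_apply]
      rw [h1, Matrix.mul_nonsing_inv _ (isUnit_iff_ne_zero.2 hda), Matrix.one_apply]
      by_cases hps : (p : ℕ) = s
      · rw [if_pos hps, if_pos (Fin.ext hps), hps, mul_one]
        exact (inv_mul_cancel₀ (pow_ne_zero _ ha)).symm
      · rw [if_neg hps, if_neg (fun h => hps (congrArg Fin.val h)), mul_zero, zero_mul]
    · have hs := s.2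
      rw [if_neg (by omega)]
      have h1 := tendsto_matrix.1 hlim p s
      have h3 : Tendsto (fun a => (z a ^ ((p : ℕ) - s))⁻¹) l (𝓝 0) := by
        rw [tendsto_zero_iff_norm_tendsto_zero]
        simp only [norm_inv, norm_pow]
        exact tendsto_inv_atTop_zero.comp ((tendsto_pow_atTop (by omega)).comp hz)
      have h4 := h3.mul h1
      rw [zero_mul] at h4
      refine Tendsto.congr' ?_ h4
      filter_upwards [hz0] with a ha
      have h5 : z a ^ (p : ℕ) = z a ^ ((p : ℕ) - s) * z a ^ (s : ℕ) := by
        rw [← pow_add]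
        congr 1
        omega
      rw [h5]
      have h6 := pow_ne_zero (s : ℕ) ha
      have h7 := pow_ne_zero ((p : ℕ) - s) ha
      field_simp

theorem exists_frame {α : Type*} {l : Filter α} {E : α → Fin 2 → PowerSeries ℂ}
    {z : Fin 2 → α → ℂ} (hz : ∀ i, Tendsto (fun a => ‖z i a‖) l atTop)
    (hE : ∀ i j, Tendsto (fun a => coeff j (E a i) / z i a ^ j) l (𝓝 (1 / (j.factorial : ℂ))))
    (N : Fin 2 → ℕ) :
    ∃ R : α → Matrix (Idx N) (Idx N) ℂ, (∀ᶠ a in l, (R a).det ≠ 0) ∧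
      Tendsto (fun a => oddMat N (E a) * R a) l
        (𝓝 (toep (fun i => 2 * N i) N id fun _ => 1)) := by
  choose R hR hRlim using fun i => exists_frame_block (hz i) (hE i) (N i)
  refine ⟨fun a => Matrix.blockDiagonal' fun i => R i a, ?_, ?_⟩
  · filter_upwards [eventually_all.2 hR] with a ha
    have h1 : (Matrix.blockDiagonal' fun i => R i a) * (Matrix.blockDiagonal' fun i => (R i a)⁻¹)
        = 1 := by
      rw [← Matrix.blockDiagonal'_mul, ← Matrix.blockDiagonal'_one]
      congr 1
      funext i
      exact Matrix.mul_nonsing_inv _ (isUnit_iff_ne_zero.2 (ha i))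
    exact (Matrix.isUnit_det_of_right_inverse h1).ne_zero
  · refine tendsto_matrix.2 ?_
    rintro ⟨i, p⟩ ⟨j, s⟩
    simp only [oddMat_eq_blockDiagonal', ← Matrix.blockDiagonal'_mul, toep_apply]
    by_cases hij : i = j
    · subst hij
      simp only [Matrix.blockDiagonal'_apply_eq]
      convert hRlim i p s using 2
      simp only [true_and, id, coeff_one]
      split_ifs <;> first | rfl | omega
    · simp only [Matrix.blockDiagonal'_apply_ne _ _ _ hij, if_neg (fun h : i = j ∧ _ => hij h.1)]
      exact tendsto_const_nhds

end Frame

/-! ## The limit at infinity -/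

section Limit

open Filter Topology

variable {a₁ a₂ b₁ : ℝ} {lam chi : Fin 2 → ℂ} {N : Fin 2 → ℕ} {H : SqMat N}

/-- The inclusion of the first `N i` basis vectors of each block. -/
def inclMat (N : Fin 2 → ℕ) : Matrix (Idx fun i => 2 * N i) (Idx N) ℂ :=
  toep (fun i => 2 * N i) N id fun _ => 1

/-- Upper triangular matrices preserve the span of the first basis vectors of each block and act
there as the smaller Toeplitz matrix of the same series. -/
theorem toep_mul_inclMat (f : Fin 2 → PowerSeries ℂ) :
    toep (fun i => 2 * N i) (fun i => 2 * N i) id f * inclMat N = inclMat N * toep N N id f := by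
  rw [inclMat, toep_mul (φ := id) (fun i k hk => by rw [id]; omega),
    toep_mul (φ := id) (fun i k hk => hk)]
  congr 1
  funext i
  rw [mul_one, one_mul]

/-- Compressing to a `J`-invariant subspace preserves the Cauchy relation. The compression is
therefore again non-degenerate, so the limiting denominator at infinity is nonzero. -/
theorem IsCauchy.incl (hH : IsCauchy b₁ lam chi (fun i => 2 * N i) H) :
    IsCauchy b₁ lam chi N ((inclMat N)ᴴ * H * inclMat N) := by
  have h1 : chiMat b₁ lam chi (fun i => 2 * N i) * inclMat N = inclMat N * chiMat b₁ lam chi N :=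
    toep_mul_inclMat _
  have h2 := congrArg Matrix.conjTranspose h1
  have h3 : urow (fun i => 2 * N i) * inclMat N = urow N :=
    urow_mul_toep_id_one fun i => by omega
  rw [Matrix.conjTranspose_mul, Matrix.conjTranspose_mul] at h2
  have h4 := congrArg (fun A => (inclMat N)ᴴ * A * inclMat N) hH
  simp only [Matrix.mul_sub, Matrix.sub_mul, Matrix.mul_smul, Matrix.smul_mul] at h4
  rw [IsCauchy, ← h3, Matrix.conjTranspose_mul, Matrix.mul_assoc _ _ (chiMat b₁ lam chi N), ← h1,
    ← Matrix.mul_assoc (chiMat b₁ lam chi N)ᴴ, ← Matrix.mul_assoc (chiMat b₁ lam chi N)ᴴ, ← h2]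
  simpa only [Matrix.mul_assoc] using h4

/-- On the invariant subspace `(J + c)†` and `(J + c)⁻¹` become outer square factors, and their
determinants are the conjugate and the inverse of one and the same number. -/
theorem det_incl_shift {c : ℝ} (hc : ∀ i, chi i + c ≠ 0)
    (hdet : ((inclMat N)ᴴ * H * inclMat N).det ≠ 0) :
    ‖((inclMat N)ᴴ * ((shiftMat b₁ lam chi c fun i => 2 * N i)ᴴ * H
        * resMat b₁ lam chi c fun i => 2 * N i) * inclMat N).det
      / ((inclMat N)ᴴ * H * inclMat N).det‖ = 1 := by
  have h1 : shiftMat b₁ lam chi c (fun i => 2 * N i) * inclMat N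
      = inclMat N * shiftMat b₁ lam chi c N := toep_mul_inclMat _
  have h2 := congrArg Matrix.conjTranspose h1
  rw [Matrix.conjTranspose_mul, Matrix.conjTranspose_mul] at h2
  have h3 : resMat b₁ lam chi c (fun i => 2 * N i) * inclMat N
      = inclMat N * resMat b₁ lam chi c N := toep_mul_inclMat _
  have h4 : (inclMat N)ᴴ * ((shiftMat b₁ lam chi c fun i => 2 * N i)ᴴ * H
        * resMat b₁ lam chi c fun i => 2 * N i) * inclMat N
      = (shiftMat b₁ lam chi c N)ᴴ * ((inclMat N)ᴴ * H * inclMat N) * resMat b₁ lam chi c N := by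
    calc _ = ((inclMat N)ᴴ * (shiftMat b₁ lam chi c fun i => 2 * N i)ᴴ) * H
          * (resMat b₁ lam chi c (fun i => 2 * N i) * inclMat N) := by
          simp only [Matrix.mul_assoc]
      _ = _ := by
          rw [h2, h3]
          simp only [Matrix.mul_assoc]
  have h5 := congrArg Matrix.det (shiftMat_mul_resMat (b₁ := b₁) (lam := lam) (n := N) hc)
  rw [Matrix.det_mul, Matrix.det_one] at h5
  have h6 := congrArg norm h5
  rw [norm_mul, norm_one] at h6
  rw [h4, Matrix.det_mul, Matrix.det_mul, Matrix.det_conjTranspose, norm_div, norm_mul, norm_mul,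
    norm_star, mul_right_comm, h6, one_mul]
  exact div_self (norm_ne_zero_iff.2 hdet)

/-- A change of basis of the column space of `oddMat` multiplies both determinants by the same
factor, so `oddMat` may be replaced by the frame of `exists_frame`, which converges to `inclMat`. -/
theorem SpectralData.tendsto_norm_det_ratio {α : Type*} {l : Filter α}
    {E : α → Fin 2 → PowerSeries ℂ} {z : Fin 2 → α → ℂ}
    (h : SpectralData a₁ a₂ b₁ lam chi) (hH : IsCauchy b₁ lam chi (fun i => 2 * N i) H)
    {c : ℝ} (hc : ∀ i, chi i + c ≠ 0) (hz : ∀ i, Tendsto (fun a => ‖z i a‖) l atTop)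
    (hE : ∀ i j, Tendsto (fun a => coeff j (E a i) / z i a ^ j) l (𝓝 (1 / (j.factorial : ℂ)))) :
    Tendsto (fun a => ‖((oddMat N (E a))ᴴ * ((shiftMat b₁ lam chi c fun i => 2 * N i)ᴴ * H
        * resMat b₁ lam chi c fun i => 2 * N i) * oddMat N (E a)).det
      / ((oddMat N (E a))ᴴ * H * oddMat N (E a)).det‖) l (𝓝 1) := by
  obtain ⟨R, hR, hlim⟩ := exists_frame hz hE N
  have hdet : ((inclMat N)ᴴ * H * inclMat N).det ≠ 0 := hH.incl.det_ne_zero h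
  have key : ∀ Q : SqMat N, Tendsto (fun a => ((oddMat N (E a) * R a)ᴴ * Q
      * (oddMat N (E a) * R a)).det) l (𝓝 ((inclMat N)ᴴ * Q * inclMat N).det) := by
    intro Q
    have hstar : Tendsto (fun a => (oddMat N (E a) * R a)ᴴ) l (𝓝 (inclMat N)ᴴ) :=
      tendsto_matrix.2 fun i j => (Complex.continuous_conj.tendsto _).comp
        (tendsto_matrix.1 hlim j i)
    exact tendsto_matrix_det
      (tendsto_matrix_mul (tendsto_matrix_mul hstar tendsto_const_nhds) hlim)
  have hsplit : ∀ (Q : SqMat N) a, ((oddMat N (E a) * R a)ᴴ * Q * (oddMat N (E a) * R a)).det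
      = star (R a).det * ((oddMat N (E a))ᴴ * Q * oddMat N (E a)).det * (R a).det := by
    intro Q a
    rw [← Matrix.det_conjTranspose, ← Matrix.det_mul, ← Matrix.det_mul, Matrix.conjTranspose_mul]
    simp only [Matrix.mul_assoc]
  have hlim2 := ((key ((shiftMat b₁ lam chi c fun i => 2 * N i)ᴴ * H
        * resMat b₁ lam chi c fun i => 2 * N i)).div (key H) hdet).norm
  rw [det_incl_shift hc hdet] at hlim2
  refine Tendsto.congr' ?_ hlim2
  filter_upwards [hR] with a ha
  simp only [Pi.div_apply]
  rw [hsplit, hsplit, mul_div_mul_right _ _ ha, mul_div_mul_left _ _ (star_ne_zero.2 ha)]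

/-! ### Growth of the phases -/

/-- For non-real `κ` the numbers `1` and `κ` form a real basis of `ℂ`, so `|x + κ t|` is comparable
to the norm of `(x, t)`. -/
theorem norm_le_mul_norm_add_mul {κ : ℂ} (hκ : κ.im ≠ 0) (p : ℝ × ℝ) :
    ‖p‖ ≤ (1 + (1 + ‖κ‖) / |κ.im|) * ‖(p.1 + κ * p.2 : ℂ)‖ := by
  have hpos : 0 < |κ.im| := abs_pos.2 hκ
  have h1 : |κ.im| * |p.2| ≤ ‖(p.1 + κ * p.2 : ℂ)‖ := by
    have := Complex.abs_im_le_norm (p.1 + κ * p.2 : ℂ)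
    simpa [abs_mul] using this
  have h2 : |p.2| ≤ ‖(p.1 + κ * p.2 : ℂ)‖ / |κ.im| := by
    rw [le_div_iff₀ hpos, mul_comm]
    exact h1
  have h3 : |p.1| ≤ ‖(p.1 + κ * p.2 : ℂ)‖ + ‖κ‖ * |p.2| := by
    have h4 : (p.1 : ℂ) = (p.1 + κ * p.2) - κ * p.2 := by ring
    have h5 := norm_sub_le (p.1 + κ * p.2 : ℂ) (κ * p.2)
    rw [← h4] at h5
    simpa using h5
  have h6 : ‖κ‖ * |p.2| ≤ ‖κ‖ * (‖(p.1 + κ * p.2 : ℂ)‖ / |κ.im|) :=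
    mul_le_mul_of_nonneg_left h2 (norm_nonneg _)
  have h7 : (1 + (1 + ‖κ‖) / |κ.im|) * ‖(p.1 + κ * p.2 : ℂ)‖
      = ‖(p.1 + κ * p.2 : ℂ)‖ + ‖(p.1 + κ * p.2 : ℂ)‖ / |κ.im|
        + ‖κ‖ * (‖(p.1 + κ * p.2 : ℂ)‖ / |κ.im|) := by
    field_simp
    ring
  have h8 : 0 ≤ ‖(p.1 + κ * p.2 : ℂ)‖ / |κ.im| := by positivity
  have h9 : 0 ≤ ‖κ‖ * (‖(p.1 + κ * p.2 : ℂ)‖ / |κ.im|) := by positivity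
  rw [h7, Prod.norm_def, Real.norm_eq_abs, Real.norm_eq_abs]
  exact max_le (by linarith) (by linarith [norm_nonneg (p.1 + κ * p.2 : ℂ)])

theorem tendsto_norm_add_mul {κ : ℂ} (hκ : κ.im ≠ 0) :
    Tendsto (fun p : ℝ × ℝ => ‖Complex.I * (p.1 + κ * p.2 : ℂ)‖) (cocompact (ℝ × ℝ)) atTop := by
  have hC : 0 < 1 + (1 + ‖κ‖) / |κ.im| := by positivity
  have h1 : Tendsto (fun p : ℝ × ℝ => ‖p‖ / (1 + (1 + ‖κ‖) / |κ.im|)) (cocompact (ℝ × ℝ)) atTop :=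
    tendsto_norm_cocompact_atTop.atTop_div_const hC
  refine tendsto_atTop_mono (fun p => ?_) h1
  rw [norm_mul, Complex.norm_I, one_mul, div_le_iff₀ hC, mul_comm]
  exact norm_le_mul_norm_add_mul hκ p

/-- Affine functions of `(x, t)` are negligible with respect to `(x + κ t) ^ k`, `k ≥ 2`. -/
theorem tendsto_affine_div_pow {κ : ℂ} (hκ : κ.im ≠ 0) (u v w : ℂ) {k : ℕ} (hk : 2 ≤ k) :
    Tendsto (fun p : ℝ × ℝ => (u + v * p.1 + w * p.2) / (Complex.I * (p.1 + κ * p.2)) ^ k)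
      (cocompact (ℝ × ℝ)) (𝓝 0) := by
  have hz := tendsto_norm_add_mul hκ
  set z : ℝ × ℝ → ℂ := fun p => Complex.I * (p.1 + κ * p.2) with hzdef
  obtain ⟨K, hK⟩ : ∃ K, K = 1 + (1 + ‖κ‖) / |κ.im| := ⟨_, rfl⟩
  have hpow : ∀ m, 1 ≤ m → Tendsto (fun p => (‖z p‖ ^ m)⁻¹) (cocompact (ℝ × ℝ)) (𝓝 0) := fun m hm =>
    tendsto_inv_atTop_zero.comp ((tendsto_pow_atTop (by omega)).comp hz)
  have hlim : Tendsto (fun p => ‖u‖ * (‖z p‖ ^ k)⁻¹ + (‖v‖ + ‖w‖) * K * (‖z p‖ ^ (k - 1))⁻¹)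
      (cocompact (ℝ × ℝ)) (𝓝 0) := by
    simpa using ((hpow k (by omega)).const_mul ‖u‖).add
      ((hpow (k - 1) (by omega)).const_mul ((‖v‖ + ‖w‖) * K))
  refine squeeze_zero_norm' ?_ hlim
  filter_upwards [hz.eventually_gt_atTop 0] with p hp
  have h1 : ‖p‖ ≤ K * ‖z p‖ := by
    rw [hK, hzdef]
    simp only [norm_mul, Complex.norm_I, one_mul]
    exact norm_le_mul_norm_add_mul hκ p
  have h2 : ‖(p.1 : ℂ)‖ ≤ ‖p‖ := by simpa using norm_fst_le p
  have h3 : ‖(p.2 : ℂ)‖ ≤ ‖p‖ := by simpa using norm_snd_le p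
  have h4 : ‖u + v * p.1 + w * p.2‖ ≤ ‖u‖ + (‖v‖ + ‖w‖) * (K * ‖z p‖) := by
    refine (norm_add₃_le).trans ?_
    rw [norm_mul, norm_mul]
    have h5 := mul_le_mul_of_nonneg_left (h2.trans h1) (norm_nonneg v)
    have h6 := mul_le_mul_of_nonneg_left (h3.trans h1) (norm_nonneg w)
    linarith
  change ‖_ / z p ^ k‖ ≤ _
  rw [norm_div, norm_pow]
  refine (div_le_div_of_nonneg_right h4 (by positivity)).trans (le_of_eq ?_)
  have h7 : ‖z p‖ ^ k = ‖z p‖ ^ (k - 1) * ‖z p‖ := by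
    rw [← pow_succ]
    congr 1
    omega
  have hp' : ‖z p‖ ≠ 0 := hp.ne'
  rw [h7]
  field_simp

theorem coeff_phaseSeries (alpha : Fin 2 → ℕ → ℂ) (x t : ℝ) (i : Fin 2) {k : ℕ} (hk : k ≠ 0) :
    coeff k (phaseSeries b₁ lam chi alpha x t i) = coeff k (epsAlphaSeries (alpha i))
      + Complex.I * coeff k (chiSeries b₁ (lam i) (chi i)) * x
      + Complex.I / 2 * coeff k (chiSeries b₁ (lam i) (chi i) ^ 2) * t := by
  rw [phaseSeries, map_add, coeff_mk, if_neg hk, omegaCoeff_eq, add_assoc]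

theorem coeff_one_chiSeries (l c : ℂ) : coeff 1 (chiSeries b₁ l c) = 1 := by
  rw [chiSeries, coeff_mk, chiCoeff]

theorem coeff_one_chiSeries_sq (l c : ℂ) : coeff 1 (chiSeries b₁ l c ^ 2) = 2 * c := by
  rw [pow_two, coeff_mul, Finset.Nat.sum_antidiagonal_eq_sum_range_succ
    (fun i j => coeff i (chiSeries b₁ l c) * coeff j (chiSeries b₁ l c)), Finset.sum_range_succ,
    Finset.sum_range_one, Nat.sub_self, Nat.sub_zero, coeff_one_chiSeries,
    coeff_zero_eq_constantCoeff_apply, constantCoeff_chiSeries]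
  ring

theorem tendsto_affine_div {κ : ℂ} (hκ : κ.im ≠ 0) (e : ℂ) :
    Tendsto (fun p : ℝ × ℝ => (e + Complex.I * 1 * p.1 + Complex.I / 2 * (2 * κ) * p.2)
      / (Complex.I * (p.1 + κ * p.2))) (cocompact (ℝ × ℝ)) (𝓝 1) := by
  have hz := tendsto_norm_add_mul hκ
  have h1 : Tendsto (fun p : ℝ × ℝ => (Complex.I * (p.1 + κ * p.2 : ℂ))⁻¹)
      (cocompact (ℝ × ℝ)) (𝓝 0) := by
    rw [tendsto_zero_iff_norm_tendsto_zero]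
    simp only [norm_inv]
    exact tendsto_inv_atTop_zero.comp hz
  have h2 : Tendsto (fun p : ℝ × ℝ => e * (Complex.I * (p.1 + κ * p.2 : ℂ))⁻¹ + 1)
      (cocompact (ℝ × ℝ)) (𝓝 1) := by
    simpa using (h1.const_mul e).add_const 1
  refine Tendsto.congr' ?_ h2
  filter_upwards [hz.eventually_gt_atTop 0] with p hp
  have hp' := norm_pos_iff.1 hp
  rw [eq_div_iff hp', add_mul, mul_assoc, inv_mul_cancel₀ hp']
  ring

/-- All coefficients of the exponent are affine in `(x, t)`. The linear one is `i (x + χ t)` plus a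
constant, and the one of degree `k ≥ 2` is negligible against its `k`-th power. -/
theorem SpectralData.tendsto_coeff_waveSeries (h : SpectralData a₁ a₂ b₁ lam chi)
    (alpha : Fin 2 → ℕ → ℂ) (i : Fin 2) (j : ℕ) :
    Tendsto (fun p : ℝ × ℝ => coeff j (waveSeries b₁ lam chi alpha p.1 p.2 i)
      / (Complex.I * (p.1 + chi i * p.2)) ^ j) (cocompact (ℝ × ℝ)) (𝓝 (1 / (j.factorial : ℂ))) := by
  have him := (h.root i).chi_im_ne
  have hone := tendsto_affine_div him (coeff 1 (epsAlphaSeries (alpha i)))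
  have htwo := fun k (hk : 2 ≤ k) => tendsto_affine_div_pow him
    (coeff k (epsAlphaSeries (alpha i))) (Complex.I * coeff k (chiSeries b₁ (lam i) (chi i)))
    (Complex.I / 2 * coeff k (chiSeries b₁ (lam i) (chi i) ^ 2)) hk
  have e1 : ∀ p : ℝ × ℝ, coeff 1 (phaseSeries b₁ lam chi alpha p.1 p.2 i)
      = coeff 1 (epsAlphaSeries (alpha i)) + Complex.I * 1 * p.1
        + Complex.I / 2 * (2 * chi i) * p.2 := fun p => by
    rw [coeff_phaseSeries _ _ _ _ one_ne_zero, coeff_one_chiSeries, coeff_one_chiSeries_sq]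
  simp only [← e1] at hone
  have e2 : ∀ k, 2 ≤ k → ∀ p : ℝ × ℝ, coeff k (phaseSeries b₁ lam chi alpha p.1 p.2 i)
      = coeff k (epsAlphaSeries (alpha i))
        + Complex.I * coeff k (chiSeries b₁ (lam i) (chi i)) * p.1
        + Complex.I / 2 * coeff k (chiSeries b₁ (lam i) (chi i) ^ 2) * p.2 := fun k hk p =>
    coeff_phaseSeries _ _ _ _ (by omega)
  have h3 := tendsto_coeff_expSeries
    (fun p : ℝ × ℝ => constantCoeff_phaseSeries b₁ lam chi alpha p.1 p.2 i) hone
    (fun k hk => (htwo k hk).congr fun p => by rw [e2 k hk]) j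
  exact h3.congr fun p => by rw [waveSeries_eq]

theorem SpectralData.tendsto_norm_background (h : SpectralData a₁ a₂ b₁ lam chi)
    (alpha : Fin 2 → ℕ → ℂ) (hH : IsCauchy b₁ lam chi (fun i => 2 * N i) H)
    {c : ℝ} (hc : ∀ i, chi i + c ≠ 0) {A b : ℝ} {q : ℝ → ℝ → ℂ}
    (hq : ∀ x t, q x t = A * (((oddMat N (waveSeries b₁ lam chi alpha x t))ᴴ
        * ((shiftMat b₁ lam chi c fun i => 2 * N i)ᴴ * H * resMat b₁ lam chi c fun i => 2 * N i)
        * oddMat N (waveSeries b₁ lam chi alpha x t)).det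
      / ((oddMat N (waveSeries b₁ lam chi alpha x t))ᴴ * H
        * oddMat N (waveSeries b₁ lam chi alpha x t)).det) * Complex.exp (theta a₁ a₂ b x t)) :
    Tendsto (fun p : ℝ × ℝ => ‖q p.1 p.2‖) (cocompact (ℝ × ℝ)) (𝓝 |A|) := by
  have h1 := (h.tendsto_norm_det_ratio hH hc (fun i => tendsto_norm_add_mul (h.root i).chi_im_ne)
    (fun i j => h.tendsto_coeff_waveSeries alpha i j)).const_mul |A|
  rw [mul_one] at h1
  refine h1.congr fun p => ?_
  have h2 : ‖Complex.exp (theta a₁ a₂ b p.1 p.2)‖ = 1 := by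
    rw [theta, mul_comm, Complex.norm_exp_ofReal_mul_I]
  rw [hq, norm_mul, norm_mul, h2, mul_one, Complex.norm_real, Real.norm_eq_abs]

end Limit

/-! ## Rationality and smoothness -/

/-- Complex polynomial functions of the real variables `x` and `t`. -/
def IsPoly (f : ℝ → ℝ → ℂ) : Prop :=
  ∃ p : MvPolynomial (Fin 2) ℂ, ∀ x t : ℝ, MvPolynomial.eval ![(x : ℂ), (t : ℂ)] p = f x t

section Poly

variable {f g : ℝ → ℝ → ℂ}

theorem isPoly_const (c : ℂ) : IsPoly fun _ _ => c :=
  ⟨MvPolynomial.C c, fun _ _ => MvPolynomial.eval_C c⟩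

theorem isPoly_fst : IsPoly fun x _ => (x : ℂ) :=
  ⟨MvPolynomial.X 0, fun _ _ => by rw [MvPolynomial.eval_X]; rfl⟩

theorem isPoly_snd : IsPoly fun _ t => (t : ℂ) :=
  ⟨MvPolynomial.X 1, fun _ _ => by rw [MvPolynomial.eval_X]; rfl⟩

theorem IsPoly.add (hf : IsPoly f) (hg : IsPoly g) : IsPoly fun x t => f x t + g x t := by
  obtain ⟨p, hp⟩ := hf
  obtain ⟨q, hq⟩ := hg
  exact ⟨p + q, fun x t => by rw [map_add, hp, hq]⟩

theorem IsPoly.mul (hf : IsPoly f) (hg : IsPoly g) : IsPoly fun x t => f x t * g x t := by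
  obtain ⟨p, hp⟩ := hf
  obtain ⟨q, hq⟩ := hg
  exact ⟨p * q, fun x t => by rw [map_mul, hp, hq]⟩

/-- The variables are real, so conjugation acts on the coefficients only. -/
theorem IsPoly.conj (hf : IsPoly f) : IsPoly fun x t => starRingEnd ℂ (f x t) := by
  obtain ⟨p, hp⟩ := hf
  refine ⟨MvPolynomial.map (starRingEnd ℂ) p, fun x t => ?_⟩
  beta_reduce
  rw [← hp, MvPolynomial.eval_map, ← MvPolynomial.eval₂_id, MvPolynomial.eval₂_comp_left,
    RingHom.comp_id]
  congr 1
  funext i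
  fin_cases i <;> simp

theorem isPoly_sum {ι : Type*} {s : Finset ι} {F : ι → ℝ → ℝ → ℂ} (hF : ∀ i ∈ s, IsPoly (F i)) :
    IsPoly fun x t => ∑ i ∈ s, F i x t := by
  classical
  induction s using Finset.induction_on with
  | empty => simpa using isPoly_const 0
  | insert a s ha ih =>
    simp only [Finset.sum_insert ha]
    exact (hF a (Finset.mem_insert_self a s)).add
      (ih fun i hi => hF i (Finset.mem_insert_of_mem hi))

theorem isPoly_prod {ι : Type*} {s : Finset ι} {F : ι → ℝ → ℝ → ℂ} (hF : ∀ i ∈ s, IsPoly (F i)) :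
    IsPoly fun x t => ∏ i ∈ s, F i x t := by
  classical
  induction s using Finset.induction_on with
  | empty => simpa using isPoly_const 1
  | insert a s ha ih =>
    simp only [Finset.prod_insert ha]
    exact (hF a (Finset.mem_insert_self a s)).mul
      (ih fun i hi => hF i (Finset.mem_insert_of_mem hi))

theorem isPoly_matrix_mul {l m n : Type*} [Fintype m] {A : ℝ → ℝ → Matrix l m ℂ}
    {B : ℝ → ℝ → Matrix m n ℂ} (hA : ∀ i j, IsPoly fun x t => A x t i j)
    (hB : ∀ i j, IsPoly fun x t => B x t i j) (i : l) (j : n) :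
    IsPoly fun x t => (A x t * B x t) i j := by
  simp only [Matrix.mul_apply]
  exact isPoly_sum fun k _ => (hA i k).mul (hB k j)

theorem isPoly_det {n : Type*} [Fintype n] [DecidableEq n] {A : ℝ → ℝ → Matrix n n ℂ}
    (hA : ∀ i j, IsPoly fun x t => A x t i j) : IsPoly fun x t => (A x t).det := by
  simp only [Matrix.det_apply']
  exact isPoly_sum fun σ _ => (isPoly_const _).mul (isPoly_prod fun i _ => hA _ _)

theorem isPoly_coeff_expSeries {g : ℝ → ℝ → PowerSeries ℂ}
    (hg0 : ∀ x t, constantCoeff (g x t) = 0) (hg : ∀ n, IsPoly fun x t => coeff n (g x t)) (n : ℕ) :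
    IsPoly fun x t => coeff n (expSeries (g x t)) := by
  induction n using Nat.strong_induction_on with
  | _ n ih =>
    rcases n with _ | n
    · simp only [coeff_zero_eq_constantCoeff_apply, constantCoeff_expSeries (hg0 _ _)]
      exact isPoly_const 1
    · simp only [coeff_succ_of_derivative_eq (derivative_expSeries (hg0 _ _)), div_eq_mul_inv]
      refine (isPoly_sum fun p hp => ?_).mul (isPoly_const _)
      have := Finset.HasAntidiagonal.mem_antidiagonal.1 hp
      exact ((hg _).mul (isPoly_const _)).mul (ih _ (by omega))

theorem isPoly_coeff_waveSeries (b₁ : ℝ) (lam chi : Fin 2 → ℂ) (alpha : Fin 2 → ℕ → ℂ) (i : Fin 2)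
    (n : ℕ) : IsPoly fun x t => coeff n (waveSeries b₁ lam chi alpha x t i) := by
  simp only [waveSeries_eq]
  refine isPoly_coeff_expSeries (fun x t => constantCoeff_phaseSeries b₁ lam chi alpha x t i)
    (fun k => ?_) n
  by_cases hk : k = 0
  · subst hk
    simp only [coeff_zero_eq_constantCoeff_apply, constantCoeff_phaseSeries]
    exact isPoly_const 0
  · simp only [coeff_phaseSeries _ _ _ _ hk]
    exact ((isPoly_const _).add ((isPoly_const _).mul isPoly_fst)).add
      ((isPoly_const _).mul isPoly_snd)

theorem isPoly_oddMat (b₁ : ℝ) (lam chi : Fin 2 → ℂ) (alpha : Fin 2 → ℕ → ℂ) (N : Fin 2 → ℕ)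
    (p : Idx fun i => 2 * N i) (s : Idx N) :
    IsPoly fun x t => oddMat N (waveSeries b₁ lam chi alpha x t) p s := by
  simp only [oddMat, toep_apply]
  split_ifs
  · exact isPoly_coeff_waveSeries b₁ lam chi alpha _ _
  · exact isPoly_const 0

theorem isPoly_det_compress (b₁ : ℝ) (lam chi : Fin 2 → ℂ) (alpha : Fin 2 → ℕ → ℂ)
    (N : Fin 2 → ℕ) (Q : SqMat N) :
    IsPoly fun x t => ((oddMat N (waveSeries b₁ lam chi alpha x t))ᴴ * Q
      * oddMat N (waveSeries b₁ lam chi alpha x t)).det :=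
  isPoly_det (isPoly_matrix_mul (isPoly_matrix_mul
    (fun i j => (isPoly_oddMat b₁ lam chi alpha N j i).conj) fun _ _ => isPoly_const _)
    (isPoly_oddMat b₁ lam chi alpha N))

theorem contDiff_eval (p : MvPolynomial (Fin 2) ℂ) :
    ContDiff ℝ ∞ fun y : ℝ × ℝ => MvPolynomial.eval ![(y.1 : ℂ), (y.2 : ℂ)] p := by
  induction p using MvPolynomial.induction_on with
  | C c =>
    simp only [MvPolynomial.eval_C]
    exact contDiff_const
  | add p q hp hq =>
    simp only [map_add]
    exact hp.add hq
  | mul_X p i hp =>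
    simp only [map_mul, MvPolynomial.eval_X]
    refine hp.mul ?_
    fin_cases i
    · exact Complex.ofRealCLM.contDiff.comp contDiff_fst
    · exact Complex.ofRealCLM.contDiff.comp contDiff_snd

theorem contDiff_of_rational {p r : MvPolynomial (Fin 2) ℂ} {a₁ a₂ b : ℝ} {A : ℂ}
    {q : ℝ → ℝ → ℂ} (hr : ∀ x t : ℝ, MvPolynomial.eval ![(x : ℂ), (t : ℂ)] r ≠ 0)
    (hq : ∀ x t : ℝ, q x t = A * (MvPolynomial.eval ![(x : ℂ), (t : ℂ)] p
      / MvPolynomial.eval ![(x : ℂ), (t : ℂ)] r) * Complex.exp (theta a₁ a₂ b x t)) :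
    ContDiff ℝ ∞ fun y : ℝ × ℝ => q y.1 y.2 := by
  simp only [hq, div_eq_mul_inv]
  refine (contDiff_const.mul ((contDiff_eval p).mul ((contDiff_eval r).inv fun y => hr _ _))).mul ?_
  refine ContDiff.cexp (contDiff_const.mul (Complex.ofRealCLM.contDiff.comp ?_))
  exact (contDiff_const.mul contDiff_fst).add (contDiff_const.mul contDiff_snd)

end Poly

/-! ## The main theorem -/

section Main

variable {a₁ a₂ b₁ : ℝ} {lam chi : Fin 2 → ℂ}

theorem SpectralData.of_isDoubleRoot (hΔ : 0 < Delta a₁ a₂ b₁)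
    (hpair : lam 0 ≠ lam 1 ∧ lam 0 ≠ conj (lam 1))
    (h : ∀ i, IsDoubleRoot a₁ a₂ b₁ (lam i) (chi i)) : SpectralData a₁ a₂ b₁ lam chi where
  root := h
  three_ne i := (h i).three_ne hΔ
  d_ne i := (h i).dCoeff_ne hΔ
  lam_ne := by
    simp only [Fin.forall_fin_two]
    exact ⟨⟨fun h => absurd rfl h, fun _ => hpair.1⟩, fun _ => hpair.1.symm, fun h => absurd rfl h⟩
  lam_ne_conj := by
    simp only [Fin.forall_fin_two]
    refine ⟨⟨(h 0).lam_ne_conj, fun h1 => hpair.2 ?_⟩, hpair.2, (h 1).lam_ne_conj⟩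
    rw [h1, Complex.conj_conj]

variable {N : Fin 2 → ℕ} {H : SqMat N} (alpha : Fin 2 → ℕ → ℂ)

theorem SpectralData.det_ratio_eq_envelope (h : SpectralData a₁ a₂ b₁ lam chi)
    (hH : IsCauchy b₁ lam chi (fun i => 2 * N i) H) {c : ℝ} (hc : ∀ i, chi i + c ≠ 0) (x t : ℝ) :
    ((oddMat N (waveSeries b₁ lam chi alpha x t))ᴴ
        * ((shiftMat b₁ lam chi c fun i => 2 * N i)ᴴ * H * resMat b₁ lam chi c fun i => 2 * N i)
        * oddMat N (waveSeries b₁ lam chi alpha x t)).det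
      / ((oddMat N (waveSeries b₁ lam chi alpha x t))ᴴ * H
        * oddMat N (waveSeries b₁ lam chi alpha x t)).det
      = envelope b₁ lam chi alpha H c x t := by
  have hdet := Mmat_det_ne_zero (N := N) alpha x t h
  rw [Mmat_eq alpha x t h hH] at hdet
  rw [hH.det_ratio hc hdet, envelope, flowBracket, bracket_full]

theorem SpectralData.q1N_eq_envelope (h : SpectralData a₁ a₂ b₁ lam chi)
    (hH : IsCauchy b₁ lam chi (fun i => 2 * N i) H) (x t : ℝ) :
    q1N a₁ a₂ b₁ lam chi alpha N x t
      = a₁ * envelope b₁ lam chi alpha H b₁ x t * Complex.exp (theta a₁ a₂ b₁ x t) := by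
  rw [q1N, M1mat_eq alpha x t h hH, Mmat_eq alpha x t h hH,
    h.det_ratio_eq_envelope alpha hH h.add_ne]

theorem SpectralData.q2N_eq_envelope (h : SpectralData a₁ a₂ b₁ lam chi)
    (hH : IsCauchy b₁ lam chi (fun i => 2 * N i) H) (x t : ℝ) :
    q2N a₁ a₂ b₁ lam chi alpha N x t
      = a₂ * envelope b₁ lam chi alpha H (-b₁) x t * Complex.exp (theta a₁ a₂ (-b₁) x t) := by
  rw [q2N, M2mat_eq alpha x t h hH, Mmat_eq alpha x t h hH,
    h.det_ratio_eq_envelope alpha hH h.sub_ne]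

theorem SpectralData.isRationalRogueWave (h : SpectralData a₁ a₂ b₁ lam chi)
    (alpha : Fin 2 → ℕ → ℂ) (N : Fin 2 → ℕ) :
    IsRationalRogueWave a₁ a₂ b₁ (q1N a₁ a₂ b₁ lam chi alpha N)
      (q2N a₁ a₂ b₁ lam chi alpha N) := by
  -- Blocks of size `2 N i` hold the degrees `0, …, 2 N i - 1`, exactly enough for the odd
  -- coefficients up to degree `2 (N i - 1) + 1`.
  obtain ⟨H, hH⟩ := h.exists_isCauchy (fun i => 2 * N i)
  have e1 := h.q1N_eq_envelope alpha hH
  have e2 := h.q2N_eq_envelope alpha hH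
  have g1 : ∀ x t, q1N a₁ a₂ b₁ lam chi alpha N x t = _ := fun x t => by
    rw [q1N, M1mat_eq alpha x t h hH, Mmat_eq alpha x t h hH]
  have g2 : ∀ x t, q2N a₁ a₂ b₁ lam chi alpha N x t = _ := fun x t => by
    rw [q2N, M2mat_eq alpha x t h hH, Mmat_eq alpha x t h hH]
  obtain ⟨p₁, hp₁⟩ := isPoly_det_compress b₁ lam chi alpha N
    ((shiftMat b₁ lam chi b₁ fun i => 2 * N i)ᴴ * H * resMat b₁ lam chi b₁ fun i => 2 * N i)
  obtain ⟨p₂, hp₂⟩ := isPoly_det_compress b₁ lam chi alpha N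
    ((shiftMat b₁ lam chi (-b₁) fun i => 2 * N i)ᴴ * H * resMat b₁ lam chi (-b₁) fun i => 2 * N i)
  obtain ⟨r, hr⟩ := isPoly_det_compress b₁ lam chi alpha N H
  beta_reduce at hp₁ hp₂ hr
  have hr0 : ∀ x t : ℝ, MvPolynomial.eval ![(x : ℂ), (t : ℂ)] r ≠ 0 := fun x t => by
    rw [hr, ← Mmat_eq alpha x t h hH]
    exact Mmat_det_ne_zero alpha x t h
  have r1 := g1
  have r2 := g2
  simp only [← hp₁, ← hp₂, ← hr] at r1 r2
  have norm_theta : ∀ b x t, ‖Complex.exp (theta a₁ a₂ b x t)‖ = 1 := fun b x t => by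
    rw [theta, mul_comm, Complex.norm_exp_ofReal_mul_I]
  -- The total intensity equals the potential of the envelope equation plus the background `a₁² +
  -- a₂²`; the latter is absorbed by the plane-wave phases in `schroedinger_of_envelope`.
  have hW : ∀ x t : ℝ, ((‖q1N a₁ a₂ b₁ lam chi alpha N x t‖ ^ 2
      + ‖q2N a₁ a₂ b₁ lam chi alpha N x t‖ ^ 2 : ℝ) : ℂ)
      = -2 * (flowBracket b₁ lam chi alpha H x t (chiMat b₁ lam chi _) 1
          - flowBracket b₁ lam chi alpha H x t 1 (chiMat b₁ lam chi _)
          - 2 * flowBracket b₁ lam chi alpha H x t 1 1 ^ 2)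
        + (a₁ : ℂ) ^ 2 + (a₂ : ℂ) ^ 2 := fun x t => by
    rw [← envelope_potential alpha h hH x t, e1, e2]
    simp only [norm_mul, norm_theta, Complex.norm_real, Real.norm_eq_abs, mul_one, mul_pow, sq_abs]
    push_cast
    ring
  refine ⟨⟨contDiff_of_rational hr0 r1, contDiff_of_rational hr0 r2, fun x t => ?_, fun x t => ?_⟩,
    ⟨p₁, p₂, r, fun x t => ⟨hr0 x t, r1 x t, r2 x t⟩⟩,
    h.tendsto_norm_background alpha hH h.add_ne g1,
    h.tendsto_norm_background alpha hH h.sub_ne g2⟩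
  · obtain ⟨fx, fxx, ft, hf⟩ := envelope_equation alpha h hH h.add_ne
    rw [hW]
    refine schroedinger_of_envelope e1 (fun x t => (hf x t).1) (fun x t => (hf x t).2.1)
      (fun x t => (hf x t).2.2.1) x t ?_
    rw [← (hf x t).2.2.2]
    ring
  · obtain ⟨fx, fxx, ft, hf⟩ := envelope_equation alpha h hH h.sub_ne
    rw [hW]
    refine schroedinger_of_envelope e2 (fun x t => (hf x t).1) (fun x t => (hf x t).2.1)
      (fun x t => (hf x t).2.2.1) x t ?_
    rw [← (hf x t).2.2.2]
    ring

end Main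

end CNLS

end

theorem mainTheorem1 (a₁ a₂ b₁ : ℝ) (hΔ : 0 < CNLS.Delta a₁ a₂ b₁)
    (lam chi : Fin 2 → ℂ)
    (hlam : ∀ i, CNLS.discrQuartic a₁ a₂ b₁ (lam i) = 0)
    (hpair : lam 0 ≠ lam 1 ∧ lam 0 ≠ (starRingEnd ℂ) (lam 1))
    (hchi : ∀ i, 2 ≤ (CNLS.cubic a₁ a₂ b₁ (lam i)).rootMultiplicity (chi i))
    (alpha : Fin 2 → ℕ → ℂ) (N : Fin 2 → ℕ) :
    (∀ x t : ℝ, (CNLS.Mmat a₁ a₂ b₁ lam chi alpha N x t).det ≠ 0) ∧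
    (∀ x t : ℝ,
      CNLS.potential (CNLS.q1N a₁ a₂ b₁ lam chi alpha N x t)
          (CNLS.q2N a₁ a₂ b₁ lam chi alpha N x t)
        = CNLS.potential (a₁ * Complex.exp (CNLS.theta a₁ a₂ b₁ x t))
            (a₂ * Complex.exp (CNLS.theta a₁ a₂ (-b₁) x t))
          + Complex.I • (CNLS.Pmat a₁ a₂ b₁ lam chi alpha N x t * CNLS.sigma3
              - CNLS.sigma3 * CNLS.Pmat a₁ a₂ b₁ lam chi alpha N x t)) ∧
    CNLS.IsRationalRogueWave a₁ a₂ b₁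
      (CNLS.q1N a₁ a₂ b₁ lam chi alpha N) (CNLS.q2N a₁ a₂ b₁ lam chi alpha N) := by
  have hroot : ∀ i, CNLS.IsDoubleRoot a₁ a₂ b₁ (lam i) (chi i) := fun i =>
    have h := CNLS.ne_zero_of_Delta_pos hΔ
    have h' := CNLS.eval_eq_zero_of_two_le_rootMultiplicity (hchi i)
    ⟨h.1, h.2.1, h.2.2, h'.1, h'.2⟩
  have h := CNLS.SpectralData.of_isDoubleRoot hΔ hpair hroot
  exact ⟨fun x t => CNLS.Mmat_det_ne_zero alpha x t h, fun x t => CNLS.potential_eq alpha x t h,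
    h.isRationalRogueWave alpha N⟩
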